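/- Let $d\in\{2,3\}$, let $\Omega\subset\mathbb R^d$ be a bounded polygonal domain with a finite conforming simplicial grid $\mathcal T_h$ (disjoint open $d$-simplices $K\subset\Omega$ with $\bigcup_K\overline K=\overline\Omega$, two closed elements meeting in the convex hull of their common vertices). Let $\mathcal F_h$ be the set of its faces $\Gamma$; an inner face is shared by two elements $K^-,K^+$ (in a fixed order), a boundary face belongs to one element $K^-$. Let $n$ be the unit normal on $\Gamma$ pointing away from $K^-$, $h_\Gamma=\operatorname{diam}\Gamma$; on inner faces $\langle w\rangle=\frac12(w^-+w^+)$, $[w]=w^--w^+$, on boundary faces $\langle w\rangle=[w]=w^-$. Let $\mathcal P\subset\mathbb R^p$ be compact, $f\in L^2(\Omega)$, $\nu>0$, and for $\mu\in\mathcal P$ let $\sigma_\mu\in L^\infty(\Omega)$ be scalar, bounded below by a positive constant (which may depend on $\mu$), and have one-sided traces from each adjacent element a.e. on every face (the trace at $x$ from $K$ being the limit of the averages over $B(x,r)\cap K$ as $r\to0$). Let $V_h=\{v\in L^2(\Omega): v|_K\in\mathbb P_1(K)\ \forall K\in\mathcal T_h\}$ and, for a coefficient $\sigma$, $$a_{h,\sigma}(u,v)=\sum_{K}\int_K(\sigma\nabla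 u)\cdot\nabla v\,dx+\sum_{\Gamma\in\mathcal F_h}\int_\Gamma-\langle(\sigma\nabla v)\cdot n\rangle[u]-\langle(\sigma\nabla u)\cdot n\rangle[v]+\tfrac{\nu}{h_\Gamma}[u][v]\,ds,\qquad a_{h,\mu}:=a_{h,\sigma_\mu}.$$ An IPDG solution for $\sigma$ is a $u\in V_h$ with $a_{h,\sigma}(u,v)=(f,v)_{L^2(\Omega)}$ for all $v\in V_h$. Put $H_{\rm div}(\Omega)=\{q\in L^2(\Omega)^d:\nabla\cdot q\in L^2(\Omega)\}$ with $(p,q)_{H_{\rm div}}=(p,q)_{L^2}+(\nabla\cdot p,\nabla\cdot q)_{L^2}$, and for $g\in L^2(\Omega)$ $$H_{\rm div}(\mathcal T_h,g)=\{q\in H_{\rm div}(\Omega):(\nabla\cdot q,1)_{L^2(K)}=(g,1)_{L^2(K)}\ \forall K\in\mathcal T_h\}.$$ Let $Q_h\subset H_{\rm div}(\Omega)$ be the lowest-order Raviart--Thomas--Nédélec space (fields $q|_K(x)=a_K+b_Kx$, $a_K\in\mathbb R^d$, $b_K\in\mathbb R$, with continuous normal components), and for $v\in V_h$ let $R_{h,\sigma}v\in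 Q_h$ be given by $$\int_\Gamma R_{h,\sigma}v\cdot n\,ds=\int_\Gamma-\langle(\sigma\nabla v)\cdot n\rangle+\tfrac{\nu}{h_\Gamma}[v]\,ds\quad\forall\,\Gamma\in\mathcal F_h,\qquad R_{h,\mu}:=R_{h,\sigma_\mu}.$$ Let $u_{h,f}$ be an IPDG solution for $\sigma=1$ and $t_f:=R_{h,1}u_{h,f}$. Let $\mu_1,\dots,\mu_n\in\mathcal P$ be arbitrary (for instance selected by a greedy algorithm), let $u_{h,\mu_i}$ be IPDG solutions for $\sigma_{\mu_i}$, and set $$V_n=\operatorname{span}\{u_{h,\mu_i}\}_{i\le n},\qquad Q_n=\operatorname{span}\{R_{h,\mu_i}u_{h,\mu_i}-t_f\}_{i\le n}.$$ A reduced solution for $\mu\in\mathcal P$ is a $u_{n,\mu}\in V_n$ with $a_{h,\mu}(u_{n,\mu},v)=(f,v)_{L^2(\Omega)}$ for all $v\in V_n$. For $v\in V_n$, let $\Pi_0v\in Q_n$ be given by $(\Pi_0v,q)_{H_{\rm div}}=(R_{h,\mu}v-t_f,q)_{H_{\rm div}}$ for all $q\in Q_n$. Then: 1. For $\sigma=1$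 and for $\sigma=\sigma_\mu$, $\mu\in\mathcal P$, the reconstruction $R_{h,\sigma}v$ exists and is unique for every $v\in V_h$. For every $\mu\in\mathcal P$ and every IPDG solution $u_{h,\mu}$ for $\sigma_\mu$, $R_{h,\mu}u_{h,\mu}\in H_{\rm div}(\mathcal T_h,f)$; also $t_f\in H_{\rm div}(\mathcal T_h,f)$ and $Q_n\subset H_{\rm div}(\mathcal T_h,0)$. 2. For every $\mu\in\mathcal P$, $\Pi_0v$ exists and is unique for every $v\in V_n$, and for every reduced solution $u_{n,\mu}$ the reduced flux $t_{n,\mu}:=\Pi_0u_{n,\mu}+t_f$ is locally conservative: $t_{n,\mu}\in H_{\rm div}(\mathcal T_h,f)$. 3. All required computations depend separably on $\mu$. (a) If $a_{h,\mu}=\sum_{\xi=1}^{\Xi}\theta_\xi(\mu)a_\xi$ on $V_h$ for all $\mu\in\mathcal P$ with bilinear forms $a_\xi$ independent of $\mu$, then for every finite family $(\psi_j)$ spanning $V_n$, every $\mu\in\mathcal P$ and every coefficient vector $\alpha$, $\sum_j\alpha_j\psi_j$ is a reduced solution for $\mu$ if and only if $\big(\sum_\xi\theta_\xi(\mu)A_\xi\big)\alpha=F$,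 where $(A_\xi)_{ij}=a_\xi(\psi_j,\psi_i)$, $F_i=(f,\psi_i)_{L^2(\Omega)}$. (b) If $\sigma_\mu=\sum_{\xi=1}^{\Xi}\theta_\xi(\mu)\tau_\xi$ a.e. in $\Omega$ for all $\mu\in\mathcal P$, with $\tau_\xi\in L^\infty(\Omega)$ having one-sided traces a.e. on faces as above, then there are bilinear forms $a_0,\dots,a_\Xi$ on $V_h$ and linear maps $R_0,\dots,R_\Xi:V_h\to H_{\rm div}(\Omega)$, independent of $\mu$, such that for all $\mu\in\mathcal P$ $$a_{h,\mu}=a_0+\sum_{\xi=1}^\Xi\theta_\xi(\mu)a_\xi,\qquad R_{h,\mu}=R_0+\sum_{\xi=1}^\Xi\theta_\xi(\mu)R_\xi;$$ and for all finite families $(\psi_j)$ spanning $V_n$ and $(\chi_j)$ spanning $Q_n$, all $\mu\in\mathcal P$ and all coefficient vectors $\alpha,\beta$: $\sum_j\alpha_j\psi_j$ is a reduced solution for $\mu$ if and only if $\big(A_0+\sum_\xi\theta_\xi(\mu)A_\xi\big)\alpha=F$; and $\Pi_0\big(\sum_j\alpha_j\psi_j\big)=\sum_j\beta_j\chi_j$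 if and only if $$G\beta=\Big(B_0+\sum_{\xi=1}^\Xi\theta_\xi(\mu)B_\xi\Big)\alpha-c,$$ with $(A_\xi)_{ij}=a_\xi(\psi_j,\psi_i)$, $F_i=(f,\psi_i)_{L^2(\Omega)}$, $G_{ij}=(\chi_j,\chi_i)_{H_{\rm div}}$, $(B_\xi)_{ij}=(R_\xi\psi_j,\chi_i)_{H_{\rm div}}$, $c_i=(t_f,\chi_i)_{H_{\rm div}}$. -/

import Mathlib

open MeasureTheory Filter Topology
open scoped ContDiff

noncomputable section

namespace IPDG

/-- The Euclidean space `ℝ^d`. -/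
abbrev Space (d : ℕ) := EuclideanSpace ℝ (Fin d)

/-! ### The space `H_div(Ω)` -/

/-- `L²(Ω)^d`. -/
abbrev L2Vec {d : ℕ} (Ω : Set (Space d)) := Lp (Space d) 2 (volume.restrict Ω)

/-- `L²(Ω)`. -/
abbrev L2Scal {d : ℕ} (Ω : Set (Space d)) := Lp ℝ 2 (volume.restrict Ω)

/-- Smooth test functions with compact support in `Ω`. -/
def IsTestFunction {d : ℕ} (Ω : Set (Space d)) (φ : Space d → ℝ) : Prop :=
  ContDiff ℝ ∞ φ ∧ HasCompactSupport φ ∧ tsupport φ ⊆ Ω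

/-- `g` is the weak divergence of `q` on `Ω`:
`∫_Ω q · ∇φ = - ∫_Ω g φ` for every test function `φ`. -/
def IsWeakDiv {d : ℕ} (Ω : Set (Space d)) (q : Space d → Space d) (g : Space d → ℝ) : Prop :=
  ∀ φ : Space d → ℝ, IsTestFunction Ω φ →
    ∫ x in Ω, inner ℝ (q x) (gradient φ x) = - ∫ x in Ω, g x * φ x

theorem IsTestFunction.continuous_gradient {d : ℕ} {Ω : Set (Space d)} {φ : Space d → ℝ}
    (h : IsTestFunction Ω φ) : Continuous (gradient φ) := by
  unfold gradient
  exact (InnerProductSpace.toDual ℝ (Space d)).symm.continuous.comp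
    (h.1.continuous_fderiv (by simp))

theorem IsTestFunction.hasCompactSupport_gradient {d : ℕ} {Ω : Set (Space d)}
    {φ : Space d → ℝ} (h : IsTestFunction Ω φ) : HasCompactSupport (gradient φ) :=
  (h.2.1.fderiv ℝ).comp_left
    (g := (InnerProductSpace.toDual ℝ (Space d)).symm) (by simp)

theorem IsTestFunction.integrable_inner {d : ℕ} {Ω : Set (Space d)} {φ : Space d → ℝ}
    (h : IsTestFunction Ω φ) (q : L2Vec Ω) :
    Integrable (fun x => inner ℝ (q x) (gradient φ x)) (volume.restrict Ω) := by
  have h2 : MemLp (gradient φ) 2 (volume.restrict Ω) :=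
    h.continuous_gradient.memLp_of_hasCompactSupport h.hasCompactSupport_gradient
  have := L2.integrable_inner (𝕜 := ℝ) q h2.toLp
  refine this.congr ?_
  filter_upwards [h2.coeFn_toLp] with x hx
  rw [hx]

theorem IsTestFunction.integrable_mul {d : ℕ} {Ω : Set (Space d)} {φ : Space d → ℝ}
    (h : IsTestFunction Ω φ) (g : L2Scal Ω) :
    Integrable (fun x => g x * φ x) (volume.restrict Ω) :=
  (Lp.memLp g).integrable_mul (q := 2)
    (h.1.continuous.memLp_of_hasCompactSupport h.2.1)

/-- `H_div(Ω)`: pairs of a field `q ∈ L²(Ω)^d` and its weak divergence `∇·q ∈ L²(Ω)`.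
As a subspace of the `ℓ²`-product of `L²(Ω)^d` and `L²(Ω)` it carries the inner product
`(p, q)_{H_div} = (p, q)_{L²} + (∇·p, ∇·q)_{L²}`. -/
def HDiv {d : ℕ} (Ω : Set (Space d)) : Submodule ℝ (WithLp 2 (L2Vec Ω × L2Scal Ω)) where
  carrier := {z | IsWeakDiv Ω z.fst z.snd}
  zero_mem' := by
    intro φ _
    have h1 : ∫ x in Ω, inner ℝ ((0 : L2Vec Ω) x) (gradient φ x) = 0 := by
      apply integral_eq_zero_of_ae
      filter_upwards [Lp.coeFn_zero (Space d) 2 (volume.restrict Ω)] with x hx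
      rw [hx, Pi.zero_apply, inner_zero_left, Pi.zero_apply]
    have h2 : ∫ x in Ω, (0 : L2Scal Ω) x * φ x = 0 := by
      apply integral_eq_zero_of_ae
      filter_upwards [Lp.coeFn_zero ℝ 2 (volume.restrict Ω)] with x hx
      rw [hx, Pi.zero_apply, zero_mul]
    change ∫ x in Ω, inner ℝ ((0 : L2Vec Ω) x) (gradient φ x)
      = - ∫ x in Ω, (0 : L2Scal Ω) x * φ x
    rw [h1, h2, neg_zero]
  add_mem' := by
    intro y z hy hz φ hφ
    have h1 : ∫ x in Ω, inner ℝ ((y.fst + z.fst : L2Vec Ω) x) (gradient φ x)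
        = (∫ x in Ω, inner ℝ (y.fst x) (gradient φ x))
          + ∫ x in Ω, inner ℝ (z.fst x) (gradient φ x) := by
      rw [← integral_add (hφ.integrable_inner _) (hφ.integrable_inner _)]
      apply integral_congr_ae
      filter_upwards [Lp.coeFn_add y.fst z.fst] with x hx
      rw [hx, Pi.add_apply, inner_add_left]
    have h2 : ∫ x in Ω, (y.snd + z.snd : L2Scal Ω) x * φ x
        = (∫ x in Ω, y.snd x * φ x) + ∫ x in Ω, z.snd x * φ x := by
      rw [← integral_add (hφ.integrable_mul _) (hφ.integrable_mul _)]
      apply integral_congr_ae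
      filter_upwards [Lp.coeFn_add y.snd z.snd] with x hx
      rw [hx, Pi.add_apply, add_mul]
    change ∫ x in Ω, inner ℝ ((y.fst + z.fst : L2Vec Ω) x) (gradient φ x)
      = - ∫ x in Ω, (y.snd + z.snd : L2Scal Ω) x * φ x
    rw [h1, h2, hy φ hφ, hz φ hφ, neg_add]
  smul_mem' := by
    intro c z hz φ hφ
    have h1 : ∫ x in Ω, inner ℝ ((c • z.fst : L2Vec Ω) x) (gradient φ x)
        = c * ∫ x in Ω, inner ℝ (z.fst x) (gradient φ x) := by
      rw [← integral_const_mul]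
      apply integral_congr_ae
      filter_upwards [Lp.coeFn_smul c z.fst] with x hx
      rw [hx, Pi.smul_apply, real_inner_smul_left]
    have h2 : ∫ x in Ω, (c • z.snd : L2Scal Ω) x * φ x = c * ∫ x in Ω, z.snd x * φ x := by
      rw [← integral_const_mul]
      apply integral_congr_ae
      filter_upwards [Lp.coeFn_smul c z.snd] with x hx
      rw [hx, Pi.smul_apply, smul_eq_mul, mul_assoc]
    change ∫ x in Ω, inner ℝ ((c • z.fst : L2Vec Ω) x) (gradient φ x)
      = - ∫ x in Ω, (c • z.snd : L2Scal Ω) x * φ x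
    rw [h1, h2, hz φ hφ, mul_neg]

/-- The field underlying an element of `H_div(Ω)`. -/
def HDiv.field {d : ℕ} {Ω : Set (Space d)} (q : HDiv Ω) : L2Vec Ω := q.1.fst

/-- The weak divergence of an element of `H_div(Ω)`. -/
def HDiv.div {d : ℕ} {Ω : Set (Space d)} (q : HDiv Ω) : L2Scal Ω := q.1.snd

/-! ### Simplicial grids -/

/-- The open convex hull of a vertex set; an open simplex for the vertices of a `d`-simplex. -/
def cell {d : ℕ} (K : Finset (Space d)) : Set (Space d) :=
  interior (convexHull ℝ (K : Set (Space d)))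

/-- A conforming simplicial grid of `Ω`. An element is given by its set of `d + 1` vertices; two
closed elements meet in the convex hull of their common vertices. -/
structure Mesh {d : ℕ} (Ω : Set (Space d)) where
  cells : Finset (Finset (Space d))
  card_cell : ∀ K ∈ cells, K.card = d + 1
  affineIndependent : ∀ K ∈ cells, AffineIndependent ℝ (Subtype.val : K → Space d)
  conforming : ∀ K ∈ cells, ∀ L ∈ cells,
    convexHull ℝ (K : Set (Space d)) ∩ convexHull ℝ (L : Set (Space d))
      = convexHull ℝ ((K : Set (Space d)) ∩ (L : Set (Space d)))
  cell_subset : ∀ K ∈ cells, cell K ⊆ Ω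
  iUnion_closure : ⋃ K ∈ cells, convexHull ℝ (K : Set (Space d)) = closure Ω

namespace Mesh

variable {d : ℕ} {Ω : Set (Space d)} (T : Mesh Ω)

open scoped Classical in
/-- The faces of codimension one of the elements, each given by its `d` vertices. -/
def faces : Finset (Finset (Space d)) := T.cells.biUnion (Finset.powersetCard d)

open scoped Classical in
/-- The elements adjacent to a face: two for an inner face, one for a boundary face. -/
def adjacent (Γ : T.faces) : Finset T.cells := Finset.univ.filter fun K => Γ.1 ⊆ K.1

/-- A choice, for every face `Γ`, of the adjacent element called `K⁻`. -/
structure Orientation where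
  minus : T.faces → T.cells
  subset_minus : ∀ Γ, Γ.1 ⊆ (minus Γ).1

end Mesh

/-- The surface measure (`(d-1)`-dimensional Hausdorff measure, normalised to agree with Lebesgue
measure) on the closed face with vertices `Γ`. -/
def surface {d : ℕ} (Γ : Finset (Space d)) : Measure (Space d) :=
  (Measure.euclideanHausdorffMeasure (d - 1)).restrict (convexHull ℝ (Γ : Set (Space d)))

/-- The diameter `h_Γ` of a face. -/
def faceDiam {d : ℕ} (Γ : Finset (Space d)) : ℝ :=
  Metric.diam (convexHull ℝ (Γ : Set (Space d)))

/-- The unit normal on a face `Γ` of a simplex `K` pointing out of `K`: the normalised component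
orthogonal to `Γ` of the vector from the centroid of `K` to the centroid of `Γ`. -/
def outerNormal {d : ℕ} (K Γ : Finset (Space d)) : Space d :=
  let w : Space d := (vectorSpan ℝ (Γ : Set (Space d)))ᗮ.starProjection
    (Γ.centroid ℝ id - K.centroid ℝ id)
  ‖w‖⁻¹ • w

/-! ### Traces of coefficients -/

/-- `c` is the trace at `x` of `s` seen from the element `K`: the limit of the averages of `s`
over `B(x, r) ∩ K` as `r → 0`. -/
def HasTraceAt {d : ℕ} (K : Finset (Space d)) (s : Space d → ℝ) (x : Space d) (c : ℝ) : Prop :=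
  Tendsto (fun r : ℝ => ⨍ y in Metric.ball x r ∩ cell K, s y) (𝓝[>] 0) (𝓝 c)

/-- The one-sided trace of `s` from `K`. -/
def trace {d : ℕ} (K : Finset (Space d)) (s : Space d → ℝ) (x : Space d) : ℝ :=
  limUnder (𝓝[>] (0 : ℝ)) fun r : ℝ => ⨍ y in Metric.ball x r ∩ cell K, s y

namespace Mesh

variable {d : ℕ} {Ω : Set (Space d)} (T : Mesh Ω)

/-- `s` belongs to `L^∞(Ω)` and has one-sided traces almost everywhere on all faces. -/
structure IsCoefficient (s : Space d → ℝ) : Prop where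
  memLp : MemLp s ⊤ (volume.restrict Ω)
  hasTrace : ∀ (Γ : T.faces), ∀ K ∈ T.adjacent Γ, ∀ᵐ x ∂(surface Γ.1), ∃ c, HasTraceAt K.1 s x c

/-! ### The IPDG discretisation -/

/-- The space `V_h` of functions whose restriction to every element is a polynomial of degree at
most one; such a function is the family of its restrictions `v|_K`. -/
abbrev DGSpace := T.cells → (Space d →ᵃ[ℝ] ℝ)

end Mesh

/-- The (constant) gradient of an affine function. -/
def affGrad {d : ℕ} (v : Space d →ᵃ[ℝ] ℝ) : Space d :=
  (InnerProductSpace.toDual ℝ (Space d)).symm v.linear.toContinuousLinearMap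

namespace Mesh

variable {d : ℕ} {Ω : Set (Space d)} (T : Mesh Ω)

/-- The average over a face of a quantity with a value for every element: the mean of the two
values on an inner face, the single value on a boundary face. -/
def avg (Γ : T.faces) (w : T.cells → ℝ) : ℝ :=
  ((T.adjacent Γ).card : ℝ)⁻¹ * ∑ K ∈ T.adjacent Γ, w K

open scoped Classical in
/-- The jump `w⁻ - w⁺` over an inner face; `w⁻` on a boundary face (where the sum is empty). -/
def jump (o : T.Orientation) (Γ : T.faces) (w : T.cells → ℝ) : ℝ :=
  w (o.minus Γ) - ∑ K ∈ (T.adjacent Γ).erase (o.minus Γ), w K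

/-- The normal on a face pointing away from `K⁻`. -/
def normal (o : T.Orientation) (Γ : T.faces) : Space d := outerNormal (o.minus Γ).1 Γ.1

/-- `⟨(s ∇v) · n⟩` at a point of a face. -/
def avgFlux (o : T.Orientation) (s : Space d → ℝ) (v : T.DGSpace) (Γ : T.faces)
    (x : Space d) : ℝ :=
  T.avg Γ fun K => trace K.1 s x * inner ℝ (affGrad (v K)) (T.normal o Γ)

/-- `[v]` at a point of a face. -/
def jumpAt (o : T.Orientation) (v : T.DGSpace) (Γ : T.faces) (x : Space d) : ℝ :=
  T.jump o Γ fun K => v K x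

/-- The symmetric interior penalty bilinear form for the coefficient `s`. -/
def ipForm (o : T.Orientation) (ν : ℝ) (s : Space d → ℝ) (u v : T.DGSpace) : ℝ :=
  (∑ K : T.cells, ∫ x in cell K.1, s x * inner ℝ (affGrad (u K)) (affGrad (v K)))
  + ∑ Γ : T.faces, ∫ x,
      (- T.avgFlux o s v Γ x * T.jumpAt o u Γ x - T.avgFlux o s u Γ x * T.jumpAt o v Γ x
        + ν / faceDiam Γ.1 * T.jumpAt o u Γ x * T.jumpAt o v Γ x) ∂(surface Γ.1)

/-- `(f, v)_{L²(Ω)}` for `v ∈ V_h`. -/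
def load (f : Space d → ℝ) (v : T.DGSpace) : ℝ :=
  ∑ K : T.cells, ∫ x in cell K.1, f x * v K x

/-- `u ∈ V` is the Galerkin solution in the subspace `V` of `V_h`:
`a_h(u, v) = (f, v)` for all `v ∈ V`. For `V = ⊤` it is the IPDG solution. -/
def IsGalerkinSolution (o : T.Orientation) (ν : ℝ) (s f : Space d → ℝ)
    (V : Submodule ℝ T.DGSpace) (u : T.DGSpace) : Prop :=
  u ∈ V ∧ ∀ v ∈ V, T.ipForm o ν s u v = T.load f v

/-! ### Fluxes -/

/-- The set `H_div(T_h, g)` of locally conservative fluxes. -/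
def conservative (g : Space d → ℝ) : Set (HDiv Ω) :=
  {q | ∀ K ∈ T.cells, ∫ x in cell K, HDiv.div q x = ∫ x in cell K, g x}

/-- `q` belongs to the Raviart-Thomas-Nedelec space of order zero, with
`q|_K (x) = a_K + b_K x`, where `c K = (a_K, b_K)`; its normal components are continuous. -/
structure IsRT0With (o : T.Orientation) (q : HDiv Ω) (c : T.cells → Space d × ℝ) : Prop where
  ae_eq : ∀ K : T.cells, ∀ᵐ x ∂(volume.restrict (cell K.1)),
    HDiv.field q x = (c K).1 + (c K).2 • x
  normal_continuous : ∀ Γ : T.faces, ∀ K ∈ T.adjacent Γ, ∀ L ∈ T.adjacent Γ,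
    ∀ x ∈ convexHull ℝ (Γ.1 : Set (Space d)),
      inner ℝ ((c K).1 + (c K).2 • x) (T.normal o Γ)
        = inner ℝ ((c L).1 + (c L).2 • x) (T.normal o Γ)

/-- `q ∈ Q_h` satisfies the face conditions that define the diffusive flux reconstruction of `v`:
`∫_Γ q · n = ∫_Γ - ⟨(s ∇v) · n⟩ + ν / h_Γ [v]` for every face. -/
def IsFluxReconstruction (o : T.Orientation) (ν : ℝ) (s : Space d → ℝ) (v : T.DGSpace)
    (q : HDiv Ω) : Prop :=
  ∃ c : T.cells → Space d × ℝ, T.IsRT0With o q c ∧ ∀ Γ : T.faces,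
    ∫ x, inner ℝ ((c (o.minus Γ)).1 + (c (o.minus Γ)).2 • x) (T.normal o Γ) ∂(surface Γ.1)
      = ∫ x, (- T.avgFlux o s v Γ x + ν / faceDiam Γ.1 * T.jumpAt o v Γ x) ∂(surface Γ.1)

open scoped Classical in
/-- The diffusive flux reconstruction `R_h v`: the element of `Q_h` determined by the face
conditions (the default value `0` is never used, since such an element exists uniquely). -/
def fluxReconstruction (o : T.Orientation) (ν : ℝ) (s : Space d → ℝ) (v : T.DGSpace) : HDiv Ω :=
  if h : ∃ q, T.IsFluxReconstruction o ν s v q then h.choose else 0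

end Mesh

namespace Mesh

variable {d : ℕ} {Ω : Set (Space d)} (T : Mesh Ω)

/-- The flux `t_f`: the reconstruction, for the coefficient `1`, of the IPDG solution `uf` for the
coefficient `1`. -/
def sourceFlux (o : T.Orientation) (ν : ℝ) (uf : T.DGSpace) : HDiv Ω :=
  T.fluxReconstruction o ν (fun _ => 1) uf

/-- The reduced space `V_n`, spanned by the snapshots. -/
def reducedSpace {n : ℕ} (us : Fin n → T.DGSpace) : Submodule ℝ T.DGSpace :=
  Submodule.span ℝ (Set.range us)

/-- The reduced flux space `Q_n`, spanned by the fluxes `R_{h, μ_i} u_{h, μ_i} - t_f`, where `s i`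
is the coefficient for the parameter `μ_i`. -/
def reducedFluxSpace (o : T.Orientation) (ν : ℝ) {n : ℕ} (s : Fin n → Space d → ℝ)
    (us : Fin n → T.DGSpace) (tf : HDiv Ω) : Submodule ℝ (HDiv Ω) :=
  Submodule.span ℝ (Set.range fun i => T.fluxReconstruction o ν (s i) (us i) - tf)

end Mesh

/-- `p` is the `H_div(Ω)`-orthogonal projection of `z` onto `Q`:
`p ∈ Q` and `(p, q) = (z, q)` for all `q ∈ Q`. -/
def IsProjection {d : ℕ} {Ω : Set (Space d)} (Q : Submodule ℝ (HDiv Ω)) (z p : HDiv Ω) : Prop :=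
  p ∈ Q ∧ ∀ q ∈ Q, inner ℝ p q = inner ℝ z q

end IPDG

end

open MeasureTheory Filter Topology
open scoped ContDiff

noncomputable section

namespace IPDG

/-! Local conservation comes from one choice of test function. The characteristic function of an
element K lies in V_h and has zero gradient, so in the IPDG equation only the terms containing its
jump survive: the face data -⟨(σ∇u)·n⟩ + ν/h_Γ [u], weighted by the sign of the outer normal of K
relative to n. These are by definition the fluxes of the reconstruction through the faces of K, so
the divergence theorem turns their sum into the integral of its divergence over K, while the
right-hand side is the integral of f (`divIntegral_fluxReconstruction`, `ipForm_charFun`). The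
difference of two such fluxes has a divergence of mean zero on every element. This is a linear
condition, so it holds on all of Q_n, and t_f plus any element of Q_n is again locally conservative.

Most of the work lies in the reconstruction. On a simplex with barycentric coordinates λ_a, the
fields |∇λ_a| (x - a) are dual to the normal components on the faces, which are constant for fields
a + b x; such a field is therefore determined by d + 1 numbers (`inner_rtCoef`, `rt_unique`). Glued
fields belong to H_div: after integration by parts on each element, the contributions of the two
sides of an inner face cancel, because conformity makes the outer normals opposite, and test
functions vanish on boundary faces (`outerNormal_eq_neg`, `sum_sign_mul`, `isWeakDiv_rtFun`).

The divergence theorem on a simplex, with Hausdorff measure on the faces, is derived from Fubini and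
the fundamental theorem of calculus on a reference simplex. A derivative along the edge a - b
produces integrals over the faces opposite b and a, and every direction is a combination of edges
(`exists_map_param`, `integral_fderiv_edge`, `integral_fderiv`).

Separability holds because traces, being limits of averages, are linear in the coefficient; they are
also measurable and bounded, so all face integrals split (`trace_sum`, `integrable_trace_mul`). The
penalty supplies the parts independent of μ. The matrix equations say that linear identities need
only be tested on spanning families. -/

/-! ### The reference simplex -/

/-- The reference simplex `{y ≥ 0, ∑ y ≤ 1}`. -/
def refSimplex (m : ℕ) : Set (Fin m → ℝ) := {y | (∀ i, 0 ≤ y i) ∧ ∑ i, y i ≤ 1}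

/-- The reference simplex in one dimension more, with one coordinate singled out. -/
def refCone (m : ℕ) : Set (ℝ × (Fin m → ℝ)) :=
  {p | 0 ≤ p.1 ∧ (∀ i, 0 ≤ p.2 i) ∧ p.1 + ∑ i, p.2 i ≤ 1}

theorem isCompact_refSimplex (m : ℕ) : IsCompact (refSimplex m) := by
  refine (isCompact_Icc (a := (0 : Fin m → ℝ)) (b := 1)).of_isClosed_subset ?_ ?_
  · have h1 : IsClosed {y : Fin m → ℝ | ∀ i, 0 ≤ y i} := by
      simp only [Set.ofPred_forall]
      exact isClosed_iInter fun i => isClosed_le continuous_const (continuous_apply i)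
    have h2 : IsClosed {y : Fin m → ℝ | ∑ i, y i ≤ 1} := isClosed_le (by fun_prop) (by fun_prop)
    exact h1.inter h2
  · rintro y ⟨h0, h1⟩
    exact ⟨h0, fun i => (Finset.single_le_sum (fun j _ => h0 j) (Finset.mem_univ i)).trans h1⟩

theorem isCompact_refCone (m : ℕ) : IsCompact (refCone m) := by
  refine (isCompact_Icc (a := (0 : ℝ × (Fin m → ℝ))) (b := 1)).of_isClosed_subset ?_ ?_
  · have h1 : IsClosed {p : ℝ × (Fin m → ℝ) | ∀ i, 0 ≤ p.2 i} := by
      simp only [Set.ofPred_forall]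
      exact isClosed_iInter fun i => isClosed_le continuous_const (by fun_prop)
    have h2 : IsClosed {p : ℝ × (Fin m → ℝ) | p.1 + ∑ i, p.2 i ≤ 1} :=
      isClosed_le (by fun_prop) (by fun_prop)
    exact (isClosed_le continuous_const continuous_fst).inter (h1.inter h2)
  · rintro ⟨t, y⟩ ⟨ht, h0, h1⟩
    have hs : 0 ≤ ∑ i, y i := Finset.sum_nonneg fun j _ => h0 j
    simp only at ht h0 h1
    refine ⟨⟨ht, h0⟩, ⟨?_, fun i => ?_⟩⟩
    · change t ≤ 1
      linarith
    · have := Finset.single_le_sum (f := y) (fun j _ => h0 j) (Finset.mem_univ i)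
      change y i ≤ 1
      linarith

/-- Needed to see that faces have nonzero surface measure, so that a face integral determines a
constant normal component. -/
theorem volume_refSimplex_pos (m : ℕ) : 0 < volume (refSimplex m) := by
  have ho : IsOpen {y : Fin m → ℝ | (∀ i, 0 < y i) ∧ ∑ i, y i < 1} := by
    have h1 : IsOpen {y : Fin m → ℝ | ∀ i, 0 < y i} := by
      simp only [Set.ofPred_forall]
      exact isOpen_iInter_of_finite fun i => isOpen_lt continuous_const (continuous_apply i)
    have h2 : IsOpen {y : Fin m → ℝ | ∑ i, y i < 1} := isOpen_lt (by fun_prop) (by fun_prop)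
    exact h1.inter h2
  refine (ho.measure_pos volume ⟨fun _ => 1 / (m + 1 : ℝ), fun i => by positivity, ?_⟩).trans_le
    (measure_mono fun y hy => ⟨fun i => (hy.1 i).le, hy.2.le⟩)
  rw [Finset.sum_const, Finset.card_univ, Fintype.card_fin, nsmul_eq_mul, mul_one_div,
    div_lt_one (by positivity)]
  linarith

/-- Lets the Jacobians of two parametrizations of one simplex be compared by integrating the
constant 1. -/
theorem volume_refCone_pos (m : ℕ) : 0 < volume (refCone m) := by
  have ho : IsOpen {p : ℝ × (Fin m → ℝ) | 0 < p.1 ∧ (∀ i, 0 < p.2 i) ∧ p.1 + ∑ i, p.2 i < 1} := by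
    have h1 : IsOpen {p : ℝ × (Fin m → ℝ) | ∀ i, 0 < p.2 i} := by
      simp only [Set.ofPred_forall]
      exact isOpen_iInter_of_finite fun i => isOpen_lt continuous_const (by fun_prop)
    have h2 : IsOpen {p : ℝ × (Fin m → ℝ) | p.1 + ∑ i, p.2 i < 1} :=
      isOpen_lt (by fun_prop) (by fun_prop)
    exact (isOpen_lt continuous_const continuous_fst).inter (h1.inter h2)
  refine (ho.measure_pos volume ⟨(1 / (m + 2 : ℝ), fun _ => 1 / (m + 2 : ℝ)), by positivity,
    fun i => by positivity, ?_⟩).trans_le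
    (measure_mono fun y hy => ⟨hy.1.le, fun i => (hy.2.1 i).le, hy.2.2.le⟩)
  rw [Finset.sum_const, Finset.card_univ, Fintype.card_fin, nsmul_eq_mul, mul_one_div,
    ← add_div, div_lt_one (by positivity)]
  linarith

/-- Integration of a partial derivative over the reference simplex. -/
theorem setIntegral_refCone_deriv {m : ℕ} {G G' : ℝ × (Fin m → ℝ) → ℝ} (hG' : Continuous G')
    (hG : ∀ t y, HasDerivAt (fun t => G (t, y)) (G' (t, y)) t) :
    ∫ p in refCone m, G' p = ∫ y in refSimplex m, (G (1 - ∑ i, y i, y) - G (0, y)) := by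
  have hm := (isCompact_refCone m).isClosed.measurableSet
  have hm' := (isCompact_refSimplex m).isClosed.measurableSet
  have hint : Integrable ((refCone m).indicator G') (volume : Measure (ℝ × (Fin m → ℝ))) :=
    (integrable_indicator_iff hm).2 (hG'.continuousOn.integrableOn_compact (isCompact_refCone m))
  rw [← integral_indicator hm, ← integral_indicator hm', Measure.volume_eq_prod] at *
  -- Fubini with the distinguished coordinate as the inner variable: the slice over `y` is the
  -- interval [0, 1 - ∑ y], or empty if `y` is outside the base.
  rw [integral_prod_symm _ hint]
  congr 1
  ext y
  by_cases hy : y ∈ refSimplex m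
  · rw [Set.indicator_of_mem hy]
    have hle : 0 ≤ 1 - ∑ i, y i := by linarith [hy.2]
    have : ∀ t, (refCone m).indicator G' (t, y)
        = (Set.Icc 0 (1 - ∑ i, y i)).indicator (fun t => G' (t, y)) t := by
      intro t
      refine Set.indicator_eq_indicator ?_ rfl
      constructor
      · rintro ⟨h1, -, h2⟩
        exact ⟨h1, by simp only at h2; linarith⟩
      · rintro ⟨h1, h2⟩
        exact ⟨h1, hy.1, by simp only; linarith⟩
    simp only [this]
    rw [integral_indicator measurableSet_Icc, integral_Icc_eq_integral_Ioc,
      ← intervalIntegral.integral_of_le hle]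
    exact intervalIntegral.integral_eq_sub_of_hasDerivAt (f := fun t => G (t, y))
      (fun t _ => hG t y) (Continuous.intervalIntegrable (by fun_prop) _ _)
  · rw [Set.indicator_of_notMem hy]
    refine integral_eq_zero_of_ae (ae_of_all _ fun t => Set.indicator_of_notMem ?_ _)
    rintro ⟨h1, h2, h3⟩
    refine hy ⟨h2, ?_⟩
    simp only at h1 h3
    linarith

/-! ### Parametrizations of simplices -/

section Param

variable {E : Type*} [NormedAddCommGroup E] [InnerProductSpace ℝ E]

/-- The parametrization of the simplex with vertices `b` and `V k` by the reference simplex. -/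
def faceMap {m : ℕ} (b : E) (V : Fin m → E) (y : Fin m → ℝ) : E := b + ∑ k, y k • (V k - b)

/-- The parametrization of the simplex with vertices `b`, `a` and `V k` by the reference
simplex. -/
def coneMap {m : ℕ} (b a : E) (V : Fin m → E) (p : ℝ × (Fin m → ℝ)) : E :=
  b + (p.1 • (a - b) + ∑ k, p.2 k • (V k - b))

/-- The upper end of each slice runs over the face opposite `b`, the lower end (`coneMap_zero`) over
the face opposite `a`. These are the two boundary terms of the fundamental theorem of calculus. -/
theorem coneMap_slanted {m : ℕ} (b a : E) (V : Fin m → E) (y : Fin m → ℝ) :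
    coneMap b a V (1 - ∑ i, y i, y) = faceMap a V y := by
  simp only [coneMap, faceMap, sub_smul, smul_sub, Finset.sum_sub_distrib, one_smul,
    ← Finset.sum_smul]
  abel

theorem coneMap_zero {m : ℕ} (b a : E) (V : Fin m → E) (y : Fin m → ℝ) :
    coneMap b a V (0, y) = faceMap b V y := by
  simp [coneMap, faceMap]

theorem faceMap_image {m : ℕ} (b : E) (V : Fin m → E) :
    faceMap b V '' refSimplex m = convexHull ℝ (insert b (Set.range V)) := by
  apply Set.Subset.antisymm
  · rintro _ ⟨y, ⟨hy0, hy1⟩, rfl⟩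
    have h := (convex_convexHull ℝ (insert b (Set.range V))).sum_mem
      (t := Finset.univ) (w := fun o : Option (Fin m) => o.elim (1 - ∑ i, y i) y)
      (z := fun o : Option (Fin m) => o.elim b V) ?_ ?_ ?_
    · convert h using 1
      simp only [faceMap, Fintype.sum_option, Option.elim, smul_sub, Finset.sum_sub_distrib,
        sub_smul, one_smul, ← Finset.sum_smul]
      abel
    · rintro (_ | i) -
      · simpa using hy1
      · exact hy0 i
    · simp [Fintype.sum_option]
    · rintro (_ | i) -
      · exact subset_convexHull ℝ _ (Set.mem_insert _ _)
      · exact subset_convexHull ℝ _ (Set.mem_insert_of_mem _ ⟨i, rfl⟩)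
  · refine convexHull_min ?_ ?_
    · rintro x (rfl | ⟨i, rfl⟩)
      · exact ⟨0, ⟨fun _ => le_rfl, by simp⟩, by simp [faceMap]⟩
      · refine ⟨Pi.single i 1, ⟨fun j => ?_, by simp⟩, ?_⟩
        · by_cases h : j = i
          · subst h; simp
          · simp [h]
        · rw [faceMap, Finset.sum_eq_single i]
          · simp
          · intro j _ hj; simp [hj]
          · simp
    · rintro _ ⟨y, hy, rfl⟩ _ ⟨z, hz, rfl⟩ s t hs ht hst
      refine ⟨s • y + t • z, ⟨fun i => ?_, ?_⟩, ?_⟩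
      · have := hy.1 i
        have := hz.1 i
        simp only [Pi.add_apply, Pi.smul_apply, smul_eq_mul]
        positivity
      · simp only [Pi.add_apply, Pi.smul_apply, smul_eq_mul, Finset.sum_add_distrib,
          ← Finset.mul_sum]
        nlinarith [hy.2, hz.2]
      · simp only [faceMap, Pi.add_apply, Pi.smul_apply, smul_eq_mul, add_smul (M := E),
          Finset.sum_add_distrib, smul_add, Finset.smul_sum, mul_smul]
        have hb : b = s • b + t • b := by rw [← add_smul, hst, one_smul]
        generalize ∑ x, s • y x • (V x - b) = S₁
        generalize ∑ x, t • z x • (V x - b) = S₂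
        nth_rw 1 [hb]
        abel

/-- The distinguished coordinate is treated as coordinate 0 of a reference simplex of dimension m +
1, which reduces the claim to `faceMap_image`. -/
theorem coneMap_image {m : ℕ} (b a : E) (V : Fin m → E) :
    coneMap b a V '' refCone m = convexHull ℝ (insert a (insert b (Set.range V))) := by
  have h := faceMap_image (m := m + 1) b (Fin.cons a V)
  have hr : insert b (Set.range (Fin.cons a V : Fin (m + 1) → E))
      = insert a (insert b (Set.range V)) := by
    rw [Fin.range_cons, Set.insert_comm]
  rw [hr] at h
  rw [← h]
  ext x
  constructor
  · rintro ⟨⟨t, y⟩, ⟨h1, h2, h3⟩, rfl⟩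
    refine ⟨Fin.cons t y, ⟨fun i => ?_, ?_⟩, ?_⟩
    · refine Fin.cases h1 (fun i => ?_) i
      simpa using h2 i
    · simpa [Fin.sum_univ_succ] using h3
    · simp [faceMap, coneMap, Fin.sum_univ_succ]
  · rintro ⟨y, ⟨h1, h2⟩, rfl⟩
    refine ⟨(y 0, fun i => y i.succ), ⟨h1 0, fun i => h1 _, ?_⟩, ?_⟩
    · simpa [Fin.sum_univ_succ] using h2
    · simp [faceMap, coneMap, Fin.sum_univ_succ]

end Param

/-! ### Parametrizations and measures -/

theorem continuous_faceMap {E : Type*} [NormedAddCommGroup E] [InnerProductSpace ℝ E] {m : ℕ}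
    (b : E) (V : Fin m → E) : Continuous (faceMap b V) := by
  unfold faceMap
  fun_prop

theorem continuous_coneMap {E : Type*} [NormedAddCommGroup E] [InnerProductSpace ℝ E] {m : ℕ}
    (b a : E) (V : Fin m → E) : Continuous (coneMap b a V) := by
  unfold coneMap
  fun_prop

/-- The parametrizations of a simplex and of one of its faces by reference simplices multiply the
measures by constants, whose quotient is the height. -/
theorem exists_map_param {m : ℕ} (b a : Space (m + 1)) (V : Fin m → Space (m + 1))
    (n : Space (m + 1)) (hn : ‖n‖ = 1) (hV : ∀ k, inner ℝ n (V k - b) = 0)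
    (hli : LinearIndependent ℝ fun k => V k - b) (ha : inner ℝ n (a - b) ≠ 0) :
    MeasurableEmbedding (faceMap b V) ∧ MeasurableEmbedding (coneMap b a V) ∧
    ∃ c : ENNReal, c ≠ 0 ∧ c ≠ ⊤ ∧
      (volume.restrict (refSimplex m)).map (faceMap b V)
        = c • (Measure.euclideanHausdorffMeasure m).restrict
          (convexHull ℝ (insert b (Set.range V))) ∧
      (volume.restrict (refCone m)).map (coneMap b a V)
        = (ENNReal.ofReal |(inner ℝ n (a - b))⁻¹| * c) •
          volume.restrict (convexHull ℝ (insert a (insert b (Set.range V)))) := by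
  set H : Submodule ℝ (Space (m + 1)) := (ℝ ∙ n)ᗮ with hH
  set h : ℝ := inner ℝ n (a - b) with hh
  have hn0 : n ≠ 0 := by rintro rfl; simp at hn
  have hrank : Module.finrank ℝ H = m := by
    have : Fact (Module.finrank ℝ (Space (m + 1)) = m + 1) := ⟨by simp⟩
    exact Submodule.finrank_orthogonal_span_singleton hn0
  have hmem : ∀ x : Space (m + 1), x ∈ H ↔ inner ℝ n x = 0 := fun x =>
    Submodule.mem_orthogonal_singleton_iff_inner_right
  let w : Fin m → H := fun k => ⟨V k - b, (hmem _).2 (hV k)⟩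
  have hw : LinearIndependent ℝ w := by
    refine LinearIndependent.of_comp H.subtype ?_
    exact hli
  -- The tangential part of a - b; its normal part is h • n, with h the signed height of a over the
  -- face.
  let z₀ : H := ⟨(a - b) - h • n, (hmem _).2 (by
    rw [inner_sub_right, real_inner_smul_right, real_inner_self_eq_norm_sq, hn]; simp [hh])⟩
  let L₀ : (Fin m → ℝ) →ₗ[ℝ] H := Fintype.linearCombination ℝ w
  have hL₀ : Function.Injective L₀ := by
    exact hw.fintypeLinearCombination_injective
  let L : (Fin m → ℝ) ≃L[ℝ] H :=
    (L₀.linearEquivOfInjective hL₀ (by rw [hrank]; simp)).toContinuousLinearEquiv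
  have hL : ∀ y, ((L y : H) : Space (m + 1)) = ∑ k, y k • (V k - b) := by
    intro y
    change ((L₀ y : H) : Space (m + 1)) = _
    simp [L₀, Fintype.linearCombination_apply, w]
  have hLm : MeasurableEmbedding L := L.toHomeomorph.measurableEmbedding
  -- the scaling constant
  let c' : NNReal := Measure.addHaarScalarFactor (Measure.map L volume) (volume : Measure H)
  -- The image of Lebesgue measure is translation invariant, so uniqueness of Haar measure makes it
  -- a multiple of the volume of `H`. The value of the factor is irrelevant; what counts is that
  -- face and cone share it.
  have hc' : Measure.map L volume = c' • (volume : Measure H) :=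
    Measure.isAddLeftInvariant_eq_smul _ _
  let c : ENNReal := c'
  have hcL : Measure.map L volume = c • (volume : Measure H) := by
    rw [hc']; rfl
  have hc0 : c' ≠ 0 := by
    intro h0
    have : Measure.map L volume (Set.univ : Set H) = 0 := by rw [hc', h0]; simp
    rw [Measure.map_apply L.continuous.measurable MeasurableSet.univ, Set.preimage_univ] at this
    exact (isOpen_univ.measure_pos volume Set.univ_nonempty).ne' this
  -- the face
  have hface : faceMap b V = (fun x => b + x) ∘ Subtype.val ∘ L := by
    ext1 y
    simp only [Function.comp_apply, hL]
    rfl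
  have hvalm : MeasurableEmbedding (Subtype.val : H → Space (m + 1)) :=
    MeasurableEmbedding.subtype_coe H.closed_of_finiteDimensional.measurableSet
  have hfe : MeasurableEmbedding (faceMap b V) := by
    rw [hface]
    exact (measurableEmbedding_addLeft b).comp (hvalm.comp hLm)
  -- The inclusion of `H` is an isometry, so it carries intrinsic volume, which is m-dimensional
  -- Hausdorff measure, to Hausdorff measure on the hyperplane.
  have hvol : Measure.map (Subtype.val : H → Space (m + 1)) volume
      = (Measure.euclideanHausdorffMeasure m).restrict H := by
    have h1 := isometry_subtype_coe (s := (H : Set (Space (m + 1)))) |>.map_euclideanHausdorffMeasure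
      (d := m)
    rw [Subtype.range_coe] at h1
    rw [← h1]
    congr 1
    rw [← InnerProductSpace.euclideanHausdorffMeasure_eq_volume (V := H), hrank]
  have hmapface : Measure.map (faceMap b V) volume
      = c • (Measure.euclideanHausdorffMeasure m).restrict ((fun x => -b + x) ⁻¹' H) := by
    rw [hface, ← Measure.map_map (measurable_const_add b) (hvalm.comp hLm).measurable,
      ← Measure.map_map hvalm.measurable hLm.measurable, hcL, Measure.map_smul, hvol,
      Measure.map_smul]
    congr 1
    have h2 := (measurableEmbedding_addLeft b).restrict_map
      (Measure.euclideanHausdorffMeasure m : Measure (Space (m + 1))) ((fun x => -b + x) ⁻¹' H)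
    rw [map_add_left_eq_self] at h2
    rw [h2]
    congr 2
    ext x
    simp
  -- the cone
  let f₁ : ℝ × (Fin m → ℝ) ≃ᵐ ℝ × H :=
    MeasurableEquiv.prodCongr (Homeomorph.mulLeft₀ h ha).toMeasurableEquiv
      L.toHomeomorph.toMeasurableEquiv
  -- The cone map factors as a scaling by h together with `L` (`f₁`), a shear along `z₀` (`f₂`), the
  -- identification of ℝ with the line of n (`f₃`) and the orthogonal decomposition with origin b
  -- (`f₄`). The shear translates every slice, so only `f₁` changes the measure, by the factor |h⁻¹|
  -- c.
  let f₂ : ℝ × H ≃ₜ ℝ × H :=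
    { toFun := fun p => (p.1, p.2 + (h⁻¹ * p.1) • z₀)
      invFun := fun p => (p.1, p.2 - (h⁻¹ * p.1) • z₀)
      left_inv := fun p => by simp
      right_inv := fun p => by simp
      continuous_toFun := by fun_prop
      continuous_invFun := by fun_prop }
  let e := (LinearIsometryEquiv.toSpanUnitSingleton (𝕜 := ℝ) n hn)
  let f₃ : ℝ × H ≃ᵐ (ℝ ∙ n) × H :=
    MeasurableEquiv.prodCongr e.toHomeomorph.toMeasurableEquiv (MeasurableEquiv.refl H)
  let f₄ : (ℝ ∙ n) × H ≃ᵐ Space (m + 1) := ((ℝ ∙ n).measurableEquivProd b).symm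
  have h1 : MeasurePreserving f₁ volume ((ENNReal.ofReal |h⁻¹| * c) • volume) := by
    have hp1 : MeasurePreserving (fun x : ℝ => h * x) volume (ENNReal.ofReal |h⁻¹| • volume) :=
      ⟨by fun_prop, Real.map_volume_mul_left ha⟩
    have hp2 : MeasurePreserving L volume (c • volume) := ⟨hLm.measurable, hcL⟩
    have hp := hp1.prod hp2
    have heq : (ENNReal.ofReal |h⁻¹| • (volume : Measure ℝ)).prod (c • (volume : Measure H))
        = (ENNReal.ofReal |h⁻¹| * c) • volume := by
      rw [Measure.prod_smul_left, Measure.prod_smul_right, smul_smul]; rfl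
    rw [heq] at hp
    exact hp
  have h2 : MeasurePreserving f₂ volume volume := by
    have := (MeasurePreserving.id (volume : Measure ℝ)).skew_product (μc := (volume : Measure H))
      (μd := (volume : Measure H)) (g := fun t z => z + (h⁻¹ * t) • z₀) (by fun_prop)
      (ae_of_all _ fun t => map_add_right_eq_self _ _)
    exact this
  have h3 : MeasurePreserving f₃ volume volume :=
    e.measurePreserving.prod (MeasurePreserving.id (volume : Measure H))
  have h4 : MeasurePreserving f₄ volume volume := by
    have h := (ℝ ∙ n).measurePreserving_measurableEquivProd b
    rw [InnerProductSpace.euclideanHausdorffMeasure_eq_volume] at h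
    exact h.symm
  have hcone : coneMap b a V = f₄ ∘ f₃ ∘ f₂ ∘ f₁ := by
    ext1 p
    obtain ⟨t, y⟩ := p
    have hz : (h⁻¹ * (h * t)) = t := by field_simp
    simp only [Function.comp_apply]
    change _ = f₄ (f₃ (f₂ (h * t, L y)))
    change _ = f₄ (f₃ (h * t, L y + (h⁻¹ * (h * t)) • z₀))
    rw [hz]
    change _ = f₄ (e (h * t), L y + t • z₀)
    have hf₄ : ∀ q, f₄ q = (q.1 : Space (m + 1)) + q.2 + b := fun q =>
      Submodule.measurableEquivProd_symm_apply _ _ _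
    rw [hf₄]
    simp only [e, LinearIsometryEquiv.toSpanUnitSingleton_apply, Submodule.coe_add,
      Submodule.coe_smul, hL, coneMap, z₀]
    module
  have hce : MeasurableEmbedding (coneMap b a V) := by
    rw [hcone]
    exact f₄.measurableEmbedding.comp (f₃.measurableEmbedding.comp
      (f₂.measurableEmbedding.comp f₁.measurableEmbedding))
  have hmapcone : Measure.map (coneMap b a V) volume = (ENNReal.ofReal |h⁻¹| * c) • volume := by
    rw [hcone, ← Measure.map_map f₄.measurable
      (f₃.measurable.comp (f₂.measurable.comp f₁.measurable)),
      ← Measure.map_map f₃.measurable (f₂.measurable.comp f₁.measurable),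
      ← Measure.map_map f₂.measurable f₁.measurable, h1.map_eq, Measure.map_smul, h2.map_eq,
      Measure.map_smul, h3.map_eq, Measure.map_smul, h4.map_eq]
  refine ⟨hfe, hce, c, by simpa [c] using hc0, by simp [c], ?_, ?_⟩
  · have h5 := hfe.restrict_map volume (convexHull ℝ (insert b (Set.range V)))
    rw [← faceMap_image, hfe.injective.preimage_image, hmapface, Measure.restrict_smul,
      Measure.restrict_restrict_of_subset] at h5
    · rw [← faceMap_image, h5]
    · rintro _ ⟨y, -, rfl⟩
      simp only [hface, Function.comp_apply, Set.mem_preimage, neg_add_cancel_left]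
      exact (L y).2
  · have h5 := hce.restrict_map volume (convexHull ℝ (insert a (insert b (Set.range V))))
    rw [← coneMap_image, hce.injective.preimage_image, hmapcone, Measure.restrict_smul] at h5
    rw [← coneMap_image, h5]

/-! ### Simplices and barycentric coordinates -/

theorem inner_affGrad {d : ℕ} (v : Space d →ᵃ[ℝ] ℝ) (w : Space d) :
    inner ℝ (affGrad v) w = v.linear w := by
  rw [affGrad, InnerProductSpace.toDual_symm_apply]
  rfl

theorem inner_affGrad_sub {d : ℕ} (v : Space d →ᵃ[ℝ] ℝ) (x y : Space d) :
    inner ℝ (affGrad v) (x - y) = v x - v y := by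
  rw [inner_affGrad]
  exact v.linearMap_vsub x y

/-- `K` is the vertex set of a nondegenerate simplex of full dimension. -/
structure IsSimplex {d : ℕ} (K : Finset (Space d)) : Prop where
  card_eq : K.card = d + 1
  indep : AffineIndependent ℝ (Subtype.val : K → Space d)

namespace IsSimplex

variable {d : ℕ} {K : Finset (Space d)}

/-- The vertices as an affine basis. -/
def basis (hK : IsSimplex K) : AffineBasis K ℝ (Space d) where
  toFun := Subtype.val
  ind' := hK.indep
  tot' := by
    rw [hK.indep.affineSpan_eq_top_iff_card_eq_finrank_add_one]
    simp [hK.card_eq]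

@[simp]
theorem basis_apply (hK : IsSimplex K) (a : K) : hK.basis a = a := rfl

theorem range_basis (hK : IsSimplex K) : Set.range hK.basis = (K : Set (Space d)) :=
  Subtype.range_coe

/-- The gradient of a barycentric coordinate. -/
def grad (hK : IsSimplex K) (a : K) : Space d := affGrad (hK.basis.coord a)

theorem coord_vertex_self (hK : IsSimplex K) (a : K) : hK.basis.coord a a = 1 :=
  hK.basis.coord_apply_eq a

theorem coord_vertex_ne (hK : IsSimplex K) {a b : K} (h : a ≠ b) : hK.basis.coord a b = 0 :=
  hK.basis.coord_apply_ne h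

theorem inner_grad_sub (hK : IsSimplex K) (a : K) (x y : Space d) :
    inner ℝ (hK.grad a) (x - y) = hK.basis.coord a x - hK.basis.coord a y :=
  inner_affGrad_sub _ _ _

theorem grad_ne_zero (hK : IsSimplex K) {a b : K} (h : a ≠ b) : hK.grad a ≠ 0 := by
  intro h0
  have := hK.inner_grad_sub a a b
  rw [h0, inner_zero_left, hK.coord_vertex_self, hK.coord_vertex_ne h] at this
  norm_num at this

/-- The derivative in direction w of the identity x = ∑ λ_a(x) a. -/
theorem sum_inner_grad_smul (hK : IsSimplex K) (w : Space d) :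
    ∑ a : K, inner ℝ (hK.grad a) w • (a : Space d) = w := by
  have h1 := hK.basis.linear_combination_coord_eq_self w
  have h2 := hK.basis.linear_combination_coord_eq_self 0
  have h3 : ∀ a, inner ℝ (hK.grad a) w = hK.basis.coord a w - hK.basis.coord a 0 := fun a => by
    rw [← hK.inner_grad_sub, sub_zero]
  simp only [h3, sub_smul, Finset.sum_sub_distrib]
  simp only [basis_apply] at h1 h2
  rw [h1, h2, sub_zero]

/-- The derivative in direction w of ∑ λ_a = 1. -/
theorem sum_inner_grad (hK : IsSimplex K) (w : Space d) :
    ∑ a : K, inner ℝ (hK.grad a) w = 0 := by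
  have h3 : ∀ a, inner ℝ (hK.grad a) w = hK.basis.coord a w - hK.basis.coord a 0 := fun a => by
    rw [← hK.inner_grad_sub, sub_zero]
  simp only [h3, Finset.sum_sub_distrib, hK.basis.sum_coord_apply_eq_one, sub_self]

theorem convexHull_eq (hK : IsSimplex K) :
    convexHull ℝ (K : Set (Space d)) = {x | ∀ a, 0 ≤ hK.basis.coord a x} := by
  rw [← hK.range_basis, hK.basis.convexHull_eq_nonneg_coord]

theorem cell_eq (hK : IsSimplex K) : cell K = {x | ∀ a, 0 < hK.basis.coord a x} := by
  rw [cell, ← hK.range_basis, hK.basis.interior_convexHull]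

theorem exists_ne (hK : IsSimplex K) (hd : 0 < d) (a : K) : ∃ b : K, a ≠ b := by
  have : 1 < Fintype.card K := by simp [hK.card_eq, hd]
  obtain ⟨b, hb⟩ := Fintype.exists_ne_of_one_lt_card this a
  exact ⟨b, hb.symm⟩

theorem norm_grad_pos (hK : IsSimplex K) (hd : 0 < d) (a : K) : 0 < ‖hK.grad a‖ := by
  obtain ⟨b, hb⟩ := hK.exists_ne hd a
  exact norm_pos_iff.2 (hK.grad_ne_zero hb)

open scoped Classical in
theorem face_indep (hK : IsSimplex K) (a : K) :
    AffineIndependent ℝ (Subtype.val : (K.erase a.1 : Finset (Space d)) → Space d) :=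
  hK.indep.mono (Finset.coe_subset.2 (Finset.erase_subset _ _))

open scoped Classical in
theorem coord_eq_zero_of_mem_face (hK : IsSimplex K) (a : K) {x : Space d}
    (hx : x ∈ affineSpan ℝ ((K.erase a.1 : Finset (Space d)) : Set (Space d))) :
    hK.basis.coord a x = 0 := by
  -- The affine subspace of ℝ on the right is {0}, so its preimage is the zero set of the
  -- coordinate; it suffices to check the vertices of the face.
  have hle : affineSpan ℝ ((K.erase a.1 : Finset (Space d)) : Set (Space d))
      ≤ (AffineSubspace.mk' (0 : ℝ) (⊥ : Submodule ℝ ℝ)).comap (hK.basis.coord a) := by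
    refine affineSpan_le_of_subset_coe ?_
    intro y hy
    have hy' := Finset.mem_erase.1 (Finset.mem_coe.1 hy)
    have h0 := hK.coord_vertex_ne (a := a) (b := ⟨y, hy'.2⟩)
      (fun h => hy'.1 (congrArg Subtype.val h).symm)
    simp [AffineSubspace.mem_mk'] at h0 ⊢
    exact h0
  simpa [AffineSubspace.mem_mk'] using hle hx

-- λ_a is constant on the face, which gives one inclusion; both spaces have dimension d - 1.
open scoped Classical in
theorem vectorSpan_face (hK : IsSimplex K) (hd : 0 < d) (a : K) :
    vectorSpan ℝ ((K.erase a.1 : Finset (Space d)) : Set (Space d)) = (ℝ ∙ hK.grad a)ᗮ := by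
  obtain ⟨b, hb⟩ := hK.exists_ne hd a
  obtain ⟨m, rfl⟩ : ∃ m, d = m + 1 := ⟨d - 1, by omega⟩
  refine Submodule.eq_of_le_of_finrank_eq ?_ ?_
  · rw [vectorSpan_def, Submodule.span_le]
    rintro _ ⟨x, hx, y, hy, rfl⟩
    beta_reduce
    rw [SetLike.mem_coe, Submodule.mem_orthogonal_singleton_iff_inner_right, vsub_eq_sub,
      hK.inner_grad_sub, hK.coord_eq_zero_of_mem_face a (subset_affineSpan ℝ _ hx),
      hK.coord_eq_zero_of_mem_face a (subset_affineSpan ℝ _ hy), sub_self]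
  · have : Fact (Module.finrank ℝ (Space (m + 1)) = m + 1) := ⟨by simp⟩
    have h' := Submodule.finrank_orthogonal_span_singleton (𝕜 := ℝ) (n := m) (hK.grad_ne_zero hb)
    have h := (hK.face_indep a).finrank_vectorSpan (n := m) (by
      rw [Fintype.card_coe, Finset.card_erase_of_mem a.2, hK.card_eq]; rfl)
    rw [h']
    have hr : vectorSpan ℝ ((K.erase a.1 : Finset (Space (m + 1))) : Set (Space (m + 1)))
        = vectorSpan ℝ (Set.range
          (Subtype.val : (K.erase a.1 : Finset (Space (m + 1))) → Space (m + 1))) := by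
      rw [Subtype.range_coe]
    rw [hr]
    exact h

-- λ_a is 0 at the centroid of the face and 1/(d+1) at that of K, so the vector between them has a
-- negative inner product with ∇λ_a. By `vectorSpan_face` the projection is onto the line of ∇λ_a,
-- hence a negative multiple of it.
open scoped Classical in
theorem outerNormal_eq (hK : IsSimplex K) (hd : 0 < d) (a : K) :
    outerNormal K (K.erase a.1) = -(‖hK.grad a‖⁻¹ • hK.grad a) := by
  have hpos := hK.norm_grad_pos hd a
  obtain ⟨b, hb⟩ := hK.exists_ne hd a
  set g := hK.grad a with hg
  set u := (K.erase a.1).centroid ℝ id - K.centroid ℝ id with hu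
  have h1 : hK.basis.coord a ((K.erase a.1).centroid ℝ id) = 0 := by
    refine hK.coord_eq_zero_of_mem_face a ?_
    have hne : (Finset.univ : Finset (K.erase a.1 : Finset (Space d))).Nonempty :=
      ⟨⟨b, Finset.mem_erase.2 ⟨fun h => hb (Subtype.ext h.symm), b.2⟩⟩, Finset.mem_univ _⟩
    have := centroid_mem_affineSpan_of_nonempty ℝ
      (Subtype.val : (K.erase a.1 : Finset (Space d)) → Space d) hne
    rwa [Finset.centroid_univ, Subtype.range_coe] at this
  have h2 : hK.basis.coord a (K.centroid ℝ id) = (d + 1 : ℝ)⁻¹ := by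
    have := hK.basis.coord_apply_centroid (Finset.mem_univ a)
    rw [Finset.card_univ, Fintype.card_coe, hK.card_eq] at this
    rw [← Finset.centroid_univ]
    exact_mod_cast this
  have h3 : inner ℝ g u = -(d + 1 : ℝ)⁻¹ := by
    rw [hg, hu, hK.inner_grad_sub, h1, h2, zero_sub]
  set t : ℝ := inner ℝ g u / ‖g‖ ^ 2 with ht
  have htneg : t < 0 := by
    rw [ht, h3]
    exact div_neg_of_neg_of_pos (neg_neg_of_pos (by positivity)) (by positivity)
  have hproj : (vectorSpan ℝ ((K.erase a.1 : Finset (Space d)) : Set (Space d)))ᗮ.starProjection u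
      = t • g := by
    rw [hK.vectorSpan_face hd]
    refine (Submodule.eq_starProjection_of_mem_orthogonal ?_ ?_)
    · rw [Submodule.orthogonal_orthogonal]
      exact Submodule.smul_mem _ _ (Submodule.mem_span_singleton_self _)
    · rw [Submodule.orthogonal_orthogonal, Submodule.mem_orthogonal_singleton_iff_inner_right,
        inner_sub_right, real_inner_smul_right, real_inner_self_eq_norm_sq, ht]
      field_simp
      ring
  have : outerNormal K (K.erase a.1) = ‖t • g‖⁻¹ • (t • g) := by
    rw [← hproj]; rfl
  rw [this, norm_smul, Real.norm_of_nonpos htneg.le, smul_smul, ← neg_smul]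
  congr 1
  field_simp
  rw [div_self htneg.ne]

end IsSimplex

namespace IsSimplex

/-! ### The divergence theorem on a simplex -/

variable {m : ℕ} {K : Finset (Space (m + 1))}

open scoped Classical in
/-- An enumeration of the vertices other than `a` and `b`. -/
theorem exists_enum (hK : IsSimplex K) {a b : K} (hab : a ≠ b) :
    ∃ V : Fin m → K, Function.Injective V ∧ (∀ k, V k ≠ a) ∧ (∀ k, V k ≠ b) ∧
      ∀ c, c ≠ a → c ≠ b → ∃ k, V k = c := by
  have hcard : (((Finset.univ : Finset K).erase a).erase b).card = m := by
    rw [Finset.card_erase_of_mem (by simp [hab.symm]), Finset.card_erase_of_mem (by simp)]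
    simp [hK.card_eq]
  let e := (Finset.equivFinOfCardEq hcard).symm
  refine ⟨fun k => (e k).1, fun i j h => e.injective (Subtype.ext h), fun k => ?_, fun k => ?_,
    fun c hca hcb => ?_⟩
  · have := (e k).2
    simp only [Finset.mem_erase] at this
    exact this.2.1
  · have := (e k).2
    simp only [Finset.mem_erase] at this
    exact this.1
  · obtain ⟨k, hk⟩ := e.surjective ⟨c, by simp [hca, hcb]⟩
    exact ⟨k, congrArg Subtype.val hk⟩

open scoped Classical in
theorem insert_range_enum {a b : K} (hab : a ≠ b) {V : Fin m → K} (hVa : ∀ k, V k ≠ a)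
    (hV : ∀ c, c ≠ a → c ≠ b → ∃ k, V k = c) :
    insert (b : Space (m + 1)) (Set.range fun k => (V k : Space (m + 1)))
      = ((K.erase a.1 : Finset (Space (m + 1))) : Set (Space (m + 1))) := by
  ext x
  simp only [Set.mem_insert_iff, Set.mem_range, Finset.coe_erase, Set.mem_sdiff,
    Finset.mem_coe, Set.mem_singleton_iff]
  constructor
  · rintro (rfl | ⟨k, rfl⟩)
    · exact ⟨b.2, fun h => hab (Subtype.ext h.symm)⟩
    · exact ⟨(V k).2, fun h => hVa k (Subtype.ext h)⟩
  · rintro ⟨hx, hxa⟩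
    by_cases hxb : x = b
    · exact Or.inl hxb
    · obtain ⟨k, hk⟩ := hV ⟨x, hx⟩ (fun h => hxa (congrArg Subtype.val h))
        (fun h => hxb (congrArg Subtype.val h))
      exact Or.inr ⟨k, congrArg Subtype.val hk⟩

open scoped Classical in
/-- Integrals over a simplex and over one of its faces, computed on reference simplices. -/
theorem exists_integral_param (hK : IsSimplex K) {a b : K} (hab : a ≠ b) {V : Fin m → K}
    (hVi : Function.Injective V) (hVa : ∀ k, V k ≠ a) (hVb : ∀ k, V k ≠ b)
    (hV : ∀ c, c ≠ a → c ≠ b → ∃ k, V k = c) :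
    (surface (K.erase a.1) Set.univ ≠ 0 ∧ surface (K.erase a.1) Set.univ ≠ ⊤) ∧
    ∃ c : ℝ, 0 < c ∧
      (∀ g : Space (m + 1) → ℝ,
        ∫ y in refSimplex m, g (faceMap b.1 (fun k => (V k).1) y)
          = c * ∫ x, g x ∂(surface (K.erase a.1))) ∧
      (∀ g : Space (m + 1) → ℝ,
        ∫ p in refCone m, g (coneMap b.1 a.1 (fun k => (V k).1) p)
          = c * ‖hK.grad a‖ * ∫ x in convexHull ℝ (K : Set (Space (m + 1))), g x) := by
  have hpos := hK.norm_grad_pos m.succ_pos a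
  have hn : ‖‖hK.grad a‖⁻¹ • hK.grad a‖ = 1 := by
    rw [norm_smul, norm_inv, norm_norm, inv_mul_cancel₀ hpos.ne']
  have hin : ∀ x y, inner ℝ (‖hK.grad a‖⁻¹ • hK.grad a) (x - y)
      = ‖hK.grad a‖⁻¹ * (hK.basis.coord a x - hK.basis.coord a y) := fun x y => by
    rw [real_inner_smul_left, hK.inner_grad_sub]
  -- The height of a over the opposite face is 1/|∇λ_a|.
  have hab' : inner ℝ (‖hK.grad a‖⁻¹ • hK.grad a) (a.1 - b.1) = ‖hK.grad a‖⁻¹ := by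
    rw [hin, hK.coord_vertex_self, hK.coord_vertex_ne hab, sub_zero, mul_one]
  have hli : LinearIndependent ℝ fun k => (V k).1 - b.1 := by
    have h := (affineIndependent_iff_linearIndependent_vsub ℝ _ b).1 hK.indep
    exact h.comp (fun k => ⟨V k, hVb k⟩) fun i j hij => hVi (congrArg Subtype.val hij)
  obtain ⟨hfe, hce, c, hc0, hct, hf, hc⟩ := exists_map_param b.1 a.1 (fun k => (V k).1)
    (‖hK.grad a‖⁻¹ • hK.grad a) hn
    (fun k => by rw [hin, hK.coord_vertex_ne (hVa k).symm, hK.coord_vertex_ne hab]; simp)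
    hli (by rw [hab']; positivity)
  rw [insert_range_enum hab hVa hV] at hf hc
  have hins : insert (a : Space (m + 1))
      ((K.erase a.1 : Finset (Space (m + 1))) : Set (Space (m + 1))) = K := by
    rw [← Finset.coe_insert, Finset.insert_erase a.2]
  rw [hins, hab', inv_inv, abs_of_pos hpos] at hc
  have hf' : (volume.restrict (refSimplex m)).map (faceMap b.1 fun k => (V k).1)
      = c • surface (K.erase a.1) := hf
  have hu := congrArg (fun μ => μ Set.univ) hf'
  simp only [Measure.map_apply hfe.measurable MeasurableSet.univ, Set.preimage_univ,
    Measure.restrict_apply_univ, Measure.smul_apply, smul_eq_mul] at hu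
  refine ⟨⟨fun h0 => ?_, fun h0 => ?_⟩, c.toReal, ENNReal.toReal_pos hc0 hct, fun g => ?_,
    fun g => ?_⟩
  · rw [h0, mul_zero] at hu
    exact (volume_refSimplex_pos m).ne' hu
  · rw [h0, ENNReal.mul_top hc0] at hu
    exact (isCompact_refSimplex m).measure_ne_top hu
  · rw [← hfe.integral_map, hf', integral_smul_measure, smul_eq_mul]
  · rw [← hce.integral_map, hc, integral_smul_measure, smul_eq_mul, ENNReal.toReal_mul,
      ENNReal.toReal_ofReal hpos.le, mul_comm c.toReal]

open scoped Classical in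
theorem surface_face_univ (hK : IsSimplex K) (a : K) :
    surface (K.erase a.1) Set.univ ≠ 0 ∧ surface (K.erase a.1) Set.univ ≠ ⊤ := by
  obtain ⟨b, hab⟩ := hK.exists_ne m.succ_pos a
  obtain ⟨V, hVi, hVa, hVb, hV⟩ := hK.exists_enum hab
  exact (hK.exists_integral_param hab hVi hVa hVb hV).1

open scoped Classical in
/-- Integration of a directional derivative along an edge of a simplex. -/
theorem integral_fderiv_edge (hK : IsSimplex K) (a b : K) {g : Space (m + 1) → ℝ}
    (hg : ContDiff ℝ 1 g) :
    ∫ x in convexHull ℝ (K : Set (Space (m + 1))), fderiv ℝ g x (a.1 - b.1)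
      = ‖hK.grad b‖⁻¹ * ∫ x, g x ∂(surface (K.erase b.1))
        - ‖hK.grad a‖⁻¹ * ∫ x, g x ∂(surface (K.erase a.1)) := by
  by_cases hab : a = b
  · subst hab; simp
  obtain ⟨V, hVi, hVa, hVb, hV⟩ := hK.exists_enum hab
  obtain ⟨-, c, hc, hcf, hcc⟩ := hK.exists_integral_param hab hVi hVa hVb hV
  -- With a and b exchanged, the base face is the one opposite b, which is what the slanted face of
  -- the first parametrization covers.
  obtain ⟨-, c', hc', hcf', hcc'⟩ := hK.exists_integral_param (Ne.symm hab) hVi hVb hVa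
    (fun x h1 h2 => hV x h2 h1)
  have hga := hK.norm_grad_pos m.succ_pos a
  have hgb := hK.norm_grad_pos m.succ_pos b
  -- both parametrizations have the same Jacobian
  have hvol : ∫ x in convexHull ℝ (K : Set (Space (m + 1))), (1 : ℝ) ≠ 0 := by
    intro h0
    have h1 := hcc fun _ => 1
    rw [h0, mul_zero, setIntegral_const, smul_eq_mul, mul_one, measureReal_eq_zero_iff
      (isCompact_refCone m).measure_ne_top] at h1
    exact (volume_refCone_pos m).ne' h1
  have hκ : c * ‖hK.grad a‖ = c' * ‖hK.grad b‖ :=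
    mul_right_cancel₀ hvol ((hcc fun _ => 1).symm.trans (hcc' fun _ => 1))
  have hd : ∀ t y, HasDerivAt (fun t => g (coneMap b.1 a.1 (fun k => (V k).1) (t, y)))
      (fderiv ℝ g (coneMap b.1 a.1 (fun k => (V k).1) (t, y)) (a.1 - b.1)) t := by
    intro t y
    have h1 : HasDerivAt (fun t : ℝ => coneMap b.1 a.1 (fun k => (V k).1) (t, y))
        (a.1 - b.1) t := by
      have := ((hasDerivAt_id t).smul_const (a.1 - b.1)).add_const
        (∑ k, y k • ((V k).1 - b.1)) |>.const_add b.1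
      simpa [coneMap] using this
    exact ((hg.differentiable one_ne_zero _).hasFDerivAt).comp_hasDerivAt t h1
  have hcont : Continuous fun p => fderiv ℝ g (coneMap b.1 a.1 (fun k => (V k).1) p)
      (a.1 - b.1) :=
    ((hg.continuous_fderiv one_ne_zero).clm_apply continuous_const).comp (continuous_coneMap _ _ _)
  have hF := setIntegral_refCone_deriv
    (G := fun p => g (coneMap b.1 a.1 (fun k => (V k).1) p)) hcont hd
  have hint : ∀ x : Space (m + 1), IntegrableOn
      (fun y => g (faceMap x (fun k => (V k).1) y)) (refSimplex m) := fun x =>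
    (hg.continuous.comp (continuous_faceMap _ _)).continuousOn.integrableOn_compact
      (isCompact_refSimplex m)
  simp only [coneMap_slanted, coneMap_zero] at hF
  rw [integral_sub (hint _) (hint _), hcf, hcf',
    hcc fun x => fderiv ℝ g x (a.1 - b.1)] at hF
  generalize ∫ x in convexHull ℝ (K : Set (Space (m + 1))), fderiv ℝ g x (a.1 - b.1) = I at *
  generalize ∫ x, g x ∂(surface (K.erase a.1)) = J at *
  generalize ∫ x, g x ∂(surface (K.erase b.1)) = J' at *
  have h5 : c * ‖hK.grad a‖ ≠ 0 := by positivity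
  apply mul_left_cancel₀ h5
  rw [hF, mul_sub]
  congr 1
  · rw [hκ]; field_simp
  · field_simp

open scoped Classical in
/-- The divergence theorem for `g w` on a simplex. -/
theorem integral_fderiv (hK : IsSimplex K) {g : Space (m + 1) → ℝ} (hg : ContDiff ℝ 1 g)
    (w : Space (m + 1)) :
    ∫ x in convexHull ℝ (K : Set (Space (m + 1))), fderiv ℝ g x w
      = ∑ a : K, inner ℝ (outerNormal K (K.erase a.1)) w * ∫ x, g x ∂(surface (K.erase a.1)) := by
  have hcomp : IsCompact (convexHull ℝ (K : Set (Space (m + 1)))) :=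
    K.finite_toSet.isCompact_convexHull ℝ
  have hint : ∀ w, IntegrableOn (fun x => fderiv ℝ g x w)
      (convexHull ℝ (K : Set (Space (m + 1)))) := fun w =>
    ((hg.continuous_fderiv one_ne_zero).clm_apply
      continuous_const).continuousOn.integrableOn_compact hcomp
  have hne : K.Nonempty := Finset.card_pos.1 (by rw [hK.card_eq]; omega)
  obtain ⟨b, hb⟩ := hne
  -- Because the coefficients sum to zero, any fixed vertex b may be subtracted: w becomes a
  -- combination of the edges at b.
  have hw : w = ∑ a : K, inner ℝ (hK.grad a) w • (a.1 - b) := by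
    simp only [smul_sub, Finset.sum_sub_distrib, hK.sum_inner_grad_smul, ← Finset.sum_smul,
      hK.sum_inner_grad, zero_smul, sub_zero]
  calc ∫ x in convexHull ℝ (K : Set (Space (m + 1))), fderiv ℝ g x w
      = ∑ a : K, inner ℝ (hK.grad a) w *
          ∫ x in convexHull ℝ (K : Set (Space (m + 1))), fderiv ℝ g x (a.1 - b) := by
        simp only [← integral_const_mul]
        rw [← integral_finsetSum _ fun a _ => (hint _).const_mul _]
        congr 1
        ext x
        conv_lhs => rw [hw]
        simp [map_sum]
    _ = ∑ a : K, inner ℝ (hK.grad a) w *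
          (‖hK.grad ⟨b, hb⟩‖⁻¹ * ∫ x, g x ∂(surface (K.erase b))
            - ‖hK.grad a‖⁻¹ * ∫ x, g x ∂(surface (K.erase a.1))) := by
        refine Finset.sum_congr rfl fun a _ => ?_
        rw [← hK.integral_fderiv_edge a ⟨b, hb⟩ hg]
    _ = _ := by
        simp only [mul_sub, Finset.sum_sub_distrib]
        -- The face opposite b received the factor ∑ ⟨∇λ_a, w⟩ = 0 from the first terms; in the
        -- second ones, -∇λ_a/|∇λ_a| is the outer normal.
        rw [← Finset.sum_mul, hK.sum_inner_grad, zero_mul, zero_sub, ← Finset.sum_neg_distrib]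
        refine Finset.sum_congr rfl fun a _ => ?_
        rw [hK.outerNormal_eq m.succ_pos, inner_neg_left, real_inner_smul_left]
        ring

end IsSimplex

/-! ### Raviart-Thomas fields on a simplex -/

theorem isCompact_convexHull_finset {d : ℕ} (K : Finset (Space d)) :
    IsCompact (convexHull ℝ (K : Set (Space d))) :=
  K.finite_toSet.isCompact_convexHull ℝ

/-- The boundary of a convex set is a Lebesgue null set. -/
theorem cell_ae_eq {d : ℕ} (K : Finset (Space d)) :
    cell K =ᵐ[volume] convexHull ℝ (K : Set (Space d)) :=
  interior_ae_eq_of_null_frontier ((convex_convexHull ℝ _).addHaar_frontier volume)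

namespace IsSimplex

section

variable {d : ℕ} {K : Finset (Space d)}

open scoped Classical in
theorem centroid_face (hK : IsSimplex K) (a : K) :
    (K.erase a.1).centroid ℝ id = (Finset.univ.erase a).centroid ℝ hK.basis := by
  have h : (Finset.univ.erase a).map (Function.Embedding.subtype (· ∈ K)) = K.erase a.1 := by
    ext x
    simp only [Finset.mem_map, Finset.mem_erase, Finset.mem_univ, and_true,
      Function.Embedding.subtype_apply, Subtype.exists, exists_and_right, exists_eq_right]
    constructor
    · rintro ⟨hx, hne⟩
      exact ⟨fun h => hne (Subtype.ext h), hx⟩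
    · rintro ⟨hne, hx⟩
      exact ⟨hx, fun h => hne (congrArg Subtype.val h)⟩
  rw [← h, Finset.centroid_map]
  rfl

open scoped Classical in
theorem centroid_face_mem (hK : IsSimplex K) (hd : 0 < d) (a : K) :
    (K.erase a.1).centroid ℝ id ∈ convexHull ℝ ((K.erase a.1 : Finset (Space d)) :
      Set (Space d)) := by
  obtain ⟨b, hb⟩ := hK.exists_ne hd a
  exact Finset.centroid_mem_convexHull _
    ⟨b, Finset.mem_erase.2 ⟨fun h => hb (Subtype.ext h.symm), b.2⟩⟩

-- Places the centroid in the relative interior of the face; it is the base point of the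
-- perturbation arguments in `outerNormal_eq_neg` and `IsTestFunction.eq_zero_of_boundary`.
open scoped Classical in
theorem coord_centroid_face_pos (hK : IsSimplex K) {a b : K} (h : b ≠ a) :
    0 < hK.basis.coord b ((K.erase a.1).centroid ℝ id) := by
  have hb : b ∈ Finset.univ.erase a := by simp [h]
  rw [hK.centroid_face, hK.basis.coord_apply_centroid hb]
  have := Finset.card_pos.2 ⟨b, hb⟩
  positivity

open scoped Classical in
theorem coord_eq_zero_of_mem_convexHull_face (hK : IsSimplex K) (a : K) {x : Space d}
    (hx : x ∈ convexHull ℝ ((K.erase a.1 : Finset (Space d)) : Set (Space d))) :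
    hK.basis.coord a x = 0 :=
  hK.coord_eq_zero_of_mem_face a (convexHull_subset_affineSpan _ hx)

open scoped Classical in
theorem inner_sub_outerNormal (hK : IsSimplex K) (hd : 0 < d) (a : K) (x y : Space d) :
    inner ℝ (x - y) (outerNormal K (K.erase a.1))
      = -(‖hK.grad a‖⁻¹ * (hK.basis.coord a x - hK.basis.coord a y)) := by
  rw [hK.outerNormal_eq hd, inner_neg_right, real_inner_smul_right, real_inner_comm,
    hK.inner_grad_sub]

open scoped Classical in
theorem norm_outerNormal (hK : IsSimplex K) (hd : 0 < d) (a : K) :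
    ‖outerNormal K (K.erase a.1)‖ = 1 := by
  rw [hK.outerNormal_eq hd, norm_neg, norm_smul, norm_inv, norm_norm,
    inv_mul_cancel₀ (hK.norm_grad_pos hd a).ne']

/-- The coefficients `(a, b)` of the Raviart-Thomas field `a + b x` with prescribed normal
components on the faces (indexed by the opposite vertices). -/
def rtCoef (hK : IsSimplex K) (F : K → ℝ) : Space d × ℝ :=
  (-∑ a, (F a * ‖hK.grad a‖) • a.1, ∑ a, F a * ‖hK.grad a‖)

-- The field is ∑ F_b |∇λ_b| (x - b). On the face opposite a, the normal component of x - b is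
-- (λ_a(b) - λ_a(x))/|∇λ_a| with λ_a(x) = 0, which is 1/|∇λ_a| for b = a and zero for every other
-- vertex.
open scoped Classical in
theorem inner_rtCoef (hK : IsSimplex K) (hd : 0 < d) (F : K → ℝ) (a : K) {x : Space d}
    (hx : x ∈ convexHull ℝ ((K.erase a.1 : Finset (Space d)) : Set (Space d))) :
    inner ℝ ((hK.rtCoef F).1 + (hK.rtCoef F).2 • x) (outerNormal K (K.erase a.1)) = F a := by
  have h1 : (hK.rtCoef F).1 + (hK.rtCoef F).2 • x
      = ∑ b, (F b * ‖hK.grad b‖) • (x - b.1) := by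
    simp only [rtCoef, smul_sub, Finset.sum_sub_distrib, ← Finset.sum_smul]
    abel
  rw [h1, sum_inner, Finset.sum_eq_single a]
  · rw [real_inner_smul_left, hK.inner_sub_outerNormal hd,
      hK.coord_eq_zero_of_mem_convexHull_face a hx, hK.coord_vertex_self]
    have := (hK.norm_grad_pos hd a).ne'
    field_simp
    ring
  · intro b _ hb
    rw [real_inner_smul_left, hK.inner_sub_outerNormal hd,
      hK.coord_eq_zero_of_mem_convexHull_face a hx, hK.coord_vertex_ne hb.symm]
    simp
  · simp

open scoped Classical in
/-- A Raviart-Thomas field on a simplex is determined by its normal components. -/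
theorem rt_unique (hK : IsSimplex K) (hd : 0 < d) {c c' : Space d × ℝ}
    (h : ∀ a : K, ∀ x ∈ convexHull ℝ ((K.erase a.1 : Finset (Space d)) : Set (Space d)),
      inner ℝ (c.1 + c.2 • x) (outerNormal K (K.erase a.1))
        = inner ℝ (c'.1 + c'.2 • x) (outerNormal K (K.erase a.1))) : c = c' := by
  -- At a vertex b the difference of the fields is orthogonal to the normals of the d faces through
  -- b, hence to ∇λ_a for a ≠ b, and to ∇λ_b because the gradients sum to zero. So it vanishes at
  -- every vertex, and two distinct vertices force equal slopes.
  have hv : ∀ b : K, (c.1 - c'.1) + (c.2 - c'.2) • b.1 = 0 := by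
    intro b
    have hz : ∀ a : K, a ≠ b →
        inner ℝ (hK.grad a) ((c.1 - c'.1) + (c.2 - c'.2) • b.1) = 0 := by
      intro a hab
      have h1 := h a b.1 (subset_convexHull ℝ _ (Finset.mem_coe.2
        (Finset.mem_erase.2 ⟨fun h => hab (Subtype.ext h.symm), b.2⟩)))
      rw [← sub_eq_zero, ← inner_sub_left, hK.outerNormal_eq hd, inner_neg_right,
        real_inner_smul_right, neg_eq_zero, mul_eq_zero, inv_eq_zero] at h1
      rcases h1 with h1 | h1
      · exact absurd h1 (hK.norm_grad_pos hd a).ne'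
      · rw [real_inner_comm, ← h1]
        congr 1
        module
    have hzb : inner ℝ (hK.grad b) ((c.1 - c'.1) + (c.2 - c'.2) • b.1) = 0 := by
      have := hK.sum_inner_grad ((c.1 - c'.1) + (c.2 - c'.2) • b.1)
      rwa [Finset.sum_eq_single b (fun a _ hab => hz a hab) (by simp)] at this
    have := hK.sum_inner_grad_smul ((c.1 - c'.1) + (c.2 - c'.2) • b.1)
    rw [← this]
    refine Finset.sum_eq_zero fun a _ => ?_
    by_cases hab : a = b
    · subst hab; rw [hzb, zero_smul]
    · rw [hz a hab, zero_smul]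
  have hne : K.Nonempty := Finset.card_pos.1 (by rw [hK.card_eq]; omega)
  obtain ⟨b, hb⟩ := hne
  obtain ⟨b', hbb⟩ := hK.exists_ne hd ⟨b, hb⟩
  have h2 : (c.2 - c'.2) • (b - b'.1) = 0 := by
    have := sub_eq_zero.2 ((hv ⟨b, hb⟩).trans (hv b').symm)
    rw [← this]
    module
  have h3 : c.2 = c'.2 := by
    rcases smul_eq_zero.1 h2 with h | h
    · exact sub_eq_zero.1 h
    · exact absurd (Subtype.ext (sub_eq_zero.1 h)) hbb
  have h4 := hv ⟨b, hb⟩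
  rw [h3, sub_self, zero_smul, add_zero, sub_eq_zero] at h4
  exact Prod.ext h4 h3

end

variable {m : ℕ} {K : Finset (Space (m + 1))}

open scoped Classical in
theorem isFiniteMeasure_surface (hK : IsSimplex K) (a : K) :
    IsFiniteMeasure (surface (K.erase a.1)) :=
  ⟨(hK.surface_face_univ a).2.lt_top⟩

open scoped Classical in
theorem integrable_surface (hK : IsSimplex K) (a : K) {g : Space (m + 1) → ℝ}
    (hg : Continuous g) : Integrable g (surface (K.erase a.1)) := by
  have hfin := hK.isFiniteMeasure_surface a
  have h := hg.continuousOn.integrableOn_compact (μ := surface (K.erase a.1))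
    (isCompact_convexHull_finset (K.erase a.1))
  rwa [IntegrableOn, surface, Measure.restrict_restrict
    (isCompact_convexHull_finset _).isClosed.measurableSet, Set.inter_self] at h

open scoped Classical in
/-- The divergence theorem for the product of a function and a Raviart-Thomas field. -/
theorem integral_rt (hK : IsSimplex K) (c : Space (m + 1) × ℝ) {φ : Space (m + 1) → ℝ}
    (hφ : ContDiff ℝ 1 φ) :
    ∫ x in convexHull ℝ (K : Set (Space (m + 1))),
        (inner ℝ (c.1 + c.2 • x) (gradient φ x) + ((m + 1 : ℕ) * c.2) * φ x)
      = ∑ a : K, ∫ x, φ x * inner ℝ (c.1 + c.2 • x) (outerNormal K (K.erase a.1))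
          ∂(surface (K.erase a.1)) := by
  -- The scalar divergence theorem is applied to each component of φ q in its own coordinate
  -- direction. The factor m + 1 is the divergence of x.
  let e : Fin (m + 1) → Space (m + 1) := fun k => EuclideanSpace.single k 1
  let g : Fin (m + 1) → Space (m + 1) → ℝ := fun k x => φ x * (c.1 k + c.2 * x k)
  have hg : ∀ k, ContDiff ℝ 1 (g k) := fun k => by
    refine hφ.mul (contDiff_const.add (contDiff_const.mul ?_))
    exact (EuclideanSpace.proj (𝕜 := ℝ) k).contDiff
  have hcomp := isCompact_convexHull_finset K
  have hd : ∀ k x, fderiv ℝ (g k) x (e k)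
      = φ x * c.2 + (c.1 k + c.2 * x k) * fderiv ℝ φ x (e k) := by
    intro k x
    have h1 : HasFDerivAt (fun x : Space (m + 1) => c.1 k + c.2 * x k)
        (c.2 • (EuclideanSpace.proj (𝕜 := ℝ) k : Space (m + 1) →L[ℝ] ℝ)) x :=
      ((EuclideanSpace.proj (𝕜 := ℝ) k : Space (m + 1) →L[ℝ] ℝ).hasFDerivAt.const_mul
        c.2).const_add (c.1 k)
    have h2 : HasFDerivAt (g k) _ x := ((hφ.differentiable one_ne_zero x).hasFDerivAt).mul h1
    rw [h2.fderiv]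
    simp [e]
  have hsum : ∀ x, inner ℝ (c.1 + c.2 • x) (gradient φ x) + ((m + 1 : ℕ) * c.2) * φ x
      = ∑ k, fderiv ℝ (g k) x (e k) := by
    intro x
    simp only [hd, Finset.sum_add_distrib, Finset.sum_const, Finset.card_univ, Fintype.card_fin,
      nsmul_eq_mul]
    have h1 : inner ℝ (c.1 + c.2 • x) (gradient φ x) = fderiv ℝ φ x (c.1 + c.2 • x) := by
      rw [real_inner_comm, gradient, InnerProductSpace.toDual_symm_apply]
    have h2 : c.1 + c.2 • x = ∑ k, (c.1 k + c.2 * x k) • e k := by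
      have := (EuclideanSpace.basisFun (Fin (m + 1)) ℝ).sum_repr (c.1 + c.2 • x)
      simpa [e] using this.symm
    rw [h1, h2, map_sum]
    simp only [map_smul, smul_eq_mul]
    ring
  simp only [hsum]
  rw [integral_finsetSum _ fun k _ => (((hg k).continuous_fderiv one_ne_zero).clm_apply
      continuous_const).continuousOn.integrableOn_compact hcomp]
  simp only [hK.integral_fderiv (hg _)]
  rw [Finset.sum_comm]
  refine Finset.sum_congr rfl fun a _ => ?_
  simp only [← integral_const_mul]
  rw [← integral_finsetSum _ fun k _ => (hK.integrable_surface a (hg k).continuous).const_mul _]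
  congr 1
  ext x
  simp only [g, PiLp.inner_apply, e]
  rw [Finset.mul_sum]
  refine Finset.sum_congr rfl fun k _ => ?_
  simp
  ring

end IsSimplex

namespace Mesh

/-! ### The geometry of a grid -/

variable {m : ℕ} {Ω : Set (Space (m + 1))} (T : Mesh Ω)

theorem simplex (K : T.cells) : IsSimplex K.1 :=
  ⟨T.card_cell K.1 K.2, T.affineIndependent K.1 K.2⟩

variable {T}

theorem mem_adjacent {Γ : T.faces} {K : T.cells} : K ∈ T.adjacent Γ ↔ Γ.1 ⊆ K.1 := by
  simp [adjacent]

theorem card_face (Γ : T.faces) : Γ.1.card = m + 1 := by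
  obtain ⟨K, -, hK⟩ := Finset.mem_biUnion.1 Γ.2
  exact (Finset.mem_powersetCard.1 hK).2

-- A face has one vertex fewer than an adjacent element, so it is the face opposite some vertex and
-- the barycentric calculus on a simplex applies.
open scoped Classical in
theorem exists_vertex {Γ : T.faces} {K : T.cells} (h : K ∈ T.adjacent Γ) :
    ∃ a : K.1, Γ.1 = K.1.erase a.1 := by
  rw [mem_adjacent] at h
  have hc : (K.1 \ Γ.1).card = 1 := by
    rw [Finset.card_sdiff_of_subset h, card_face, (T.simplex K).card_eq]
    omega
  obtain ⟨a, ha⟩ := Finset.card_eq_one.1 hc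
  have haK : a ∈ K.1 := (Finset.mem_sdiff.1 (ha ▸ Finset.mem_singleton_self a)).1
  refine ⟨⟨a, haK⟩, ?_⟩
  rw [Finset.erase_eq, ← ha, Finset.sdiff_sdiff_eq_self h]

variable (T) in
open scoped Classical in
/-- The face of an element opposite to a vertex. -/
def faceOf (K : T.cells) (a : K.1) : T.faces :=
  ⟨K.1.erase a.1, Finset.mem_biUnion.2 ⟨K.1, K.2, Finset.mem_powersetCard.2
    ⟨Finset.erase_subset _ _, by rw [Finset.card_erase_of_mem a.2, T.card_cell _ K.2]; rfl⟩⟩⟩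

open scoped Classical in
theorem faceOf_mem (K : T.cells) (a : K.1) : K ∈ T.adjacent (T.faceOf K a) :=
  mem_adjacent.2 (Finset.erase_subset _ _)

open scoped Classical in
/-- A sum over the faces of an element. -/
theorem sum_faceOf {M : Type*} [AddCommMonoid M] (K : T.cells) (G : T.faces → M) :
    ∑ a : K.1, G (T.faceOf K a) = ∑ Γ : T.faces, if K ∈ T.adjacent Γ then G Γ else 0 := by
  rw [← Finset.sum_filter]
  refine Finset.sum_bij (fun a _ => T.faceOf K a) ?_ ?_ ?_ ?_
  · intro a _
    simp [faceOf_mem]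
  · intro a _ b _ h
    have h' : K.1.erase a.1 = K.1.erase b.1 := congrArg Subtype.val h
    by_contra hab
    have : b.1 ∈ K.1.erase a.1 :=
      Finset.mem_erase.2 ⟨fun h => hab (Subtype.ext h.symm), b.2⟩
    rw [h'] at this
    exact absurd rfl (Finset.mem_erase.1 this).1
  · intro Γ hΓ
    obtain ⟨a, ha⟩ := exists_vertex (Finset.mem_filter.1 hΓ).2
    exact ⟨a, Finset.mem_univ _, Subtype.ext ha.symm⟩
  · intro a _
    rfl

theorem norm_outerNormal {Γ : T.faces} {K : T.cells} (hK : K ∈ T.adjacent Γ) :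
    ‖outerNormal K.1 Γ.1‖ = 1 := by
  classical
  obtain ⟨a, ha⟩ := exists_vertex hK
  rw [ha]
  convert (T.simplex K).norm_outerNormal m.succ_pos a

/-- Two elements sharing a face lie on opposite sides of it. -/
theorem outerNormal_eq_neg {Γ : T.faces} {K L : T.cells} (hK : K ∈ T.adjacent Γ)
    (hL : L ∈ T.adjacent Γ) (hKL : K ≠ L) : outerNormal L.1 Γ.1 = -outerNormal K.1 Γ.1 := by
  classical
  obtain ⟨a, ha⟩ := exists_vertex hK
  obtain ⟨b, hb⟩ := exists_vertex hL
  have sK := T.simplex K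
  have sL := T.simplex L
  have hd := m.succ_pos
  have hga := sK.norm_grad_pos hd a
  have hgb := sL.norm_grad_pos hd b
  -- the gradients are parallel
  obtain ⟨t, ht⟩ : ∃ t : ℝ, t • sK.grad a = sL.grad b := by
    rw [← Submodule.mem_span_singleton, ← Submodule.orthogonal_orthogonal (ℝ ∙ sK.grad a),
      ← sK.vectorSpan_face hd, ← ha, hb, sL.vectorSpan_face hd, Submodule.orthogonal_orthogonal]
    exact Submodule.mem_span_singleton_self _
  have hnK : outerNormal K.1 Γ.1 = -(‖sK.grad a‖⁻¹ • sK.grad a) := by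
    rw [ha]; convert sK.outerNormal_eq hd a
  have hnL : outerNormal L.1 Γ.1 = -(‖sL.grad b‖⁻¹ • sL.grad b) := by
    rw [hb]; convert sL.outerNormal_eq hd b
  have ht0 : t ≠ 0 := by
    rintro rfl
    rw [zero_smul] at ht
    rw [← ht, norm_zero] at hgb
    exact lt_irrefl _ hgb
  rcases lt_or_gt_of_ne ht0 with htn | htp
  · rw [hnK, hnL, ← ht, norm_smul, Real.norm_of_nonpos htn.le, smul_smul, ← neg_smul, neg_neg]
    congr 1
    field_simp
  -- If t > 0, both elements lie on the same side. A small move from the centroid of Γ along ∇λ_a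
  -- then stays in both closed elements, so by conformity in the hull of their common vertices.
  -- Those all lie on Γ, where λ_a = 0, yet λ_a has grown to ε |∇λ_a|².
  exfalso
  set x₀ := Γ.1.centroid ℝ id with hx₀
  have hcont : Continuous fun ε : ℝ => x₀ + ε • sK.grad a := by fun_prop
  have evpos : ∀ (J : T.cells) (c : J.1), (∃ e : J.1, Γ.1 = J.1.erase e.1 ∧ c ≠ e) →
      ∀ᶠ ε in 𝓝[>] (0 : ℝ), 0 ≤ (T.simplex J).basis.coord c (x₀ + ε • sK.grad a) := by
    rintro J c ⟨e, he, hce⟩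
    have h1 : 0 < (T.simplex J).basis.coord c (x₀ + (0 : ℝ) • sK.grad a) := by
      rw [zero_smul, add_zero, hx₀, he]
      exact (T.simplex J).coord_centroid_face_pos hce
    have h2 : ContinuousAt (fun ε : ℝ => (T.simplex J).basis.coord c (x₀ + ε • sK.grad a)) 0 :=
      ((continuous_barycentric_coord _ _).comp hcont).continuousAt
    exact (h2.eventually (lt_mem_nhds h1)).filter_mono nhdsWithin_le_nhds |>.mono
      fun _ h => h.le
  have hcoord : ∀ (J : T.cells) (e : J.1), Γ.1 = J.1.erase e.1 → ∀ ε : ℝ,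
      (T.simplex J).basis.coord e (x₀ + ε • sK.grad a)
        = ε * inner ℝ ((T.simplex J).grad e) (sK.grad a) := by
    intro J e he ε
    have h1 := (T.simplex J).inner_grad_sub e (x₀ + ε • sK.grad a) x₀
    have h2 : (T.simplex J).basis.coord e x₀ = 0 := by
      rw [hx₀, he]
      exact (T.simplex J).coord_eq_zero_of_mem_convexHull_face e
        ((T.simplex J).centroid_face_mem hd e)
    rw [h2, sub_zero, add_sub_cancel_left, real_inner_smul_right] at h1
    exact h1.symm
  have hev : ∀ (J : T.cells) (e : J.1), Γ.1 = J.1.erase e.1 →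
      0 < inner ℝ ((T.simplex J).grad e) (sK.grad a) →
      ∀ᶠ ε in 𝓝[>] (0 : ℝ), x₀ + ε • sK.grad a ∈ convexHull ℝ (J.1 : Set (Space (m + 1))) := by
    intro J e he hpos
    rw [(T.simplex J).convexHull_eq]
    simp only [Set.mem_ofPred_eq, Filter.eventually_all]
    intro c
    by_cases hce : c = e
    · subst hce
      filter_upwards [self_mem_nhdsWithin] with ε hε
      rw [hcoord J c he]
      exact mul_nonneg (le_of_lt hε) hpos.le
    · exact evpos J c ⟨e, he, hce⟩
  have hpK : 0 < inner ℝ (sK.grad a) (sK.grad a) := by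
    rw [real_inner_self_eq_norm_sq]; positivity
  have hpL : 0 < inner ℝ (sL.grad b) (sK.grad a) := by
    rw [← ht, real_inner_smul_left]; positivity
  obtain ⟨ε, ⟨h1, h2⟩, hε⟩ :=
    (((hev K a ha hpK).and (hev L b hb hpL)).and self_mem_nhdsWithin).exists
  have h3 := T.conforming K.1 K.2 L.1 L.2 ▸ Set.mem_inter h1 h2
  -- Were a also a vertex of L, all of K would be contained in L, and equal cardinalities would give
  -- K = L.
  have h4 : (K.1 : Set (Space (m + 1))) ∩ L.1 ⊆ (K.1.erase a.1 : Finset _) := by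
    rintro x ⟨hxK, hxL⟩
    refine Finset.mem_coe.2 (Finset.mem_erase.2 ⟨?_, hxK⟩)
    rintro rfl
    refine hKL (Subtype.ext (Finset.eq_of_subset_of_card_le ?_ ?_))
    · rw [← Finset.insert_erase a.2, ← ha]
      exact Finset.insert_subset hxL (mem_adjacent.1 hL)
    · rw [sK.card_eq, sL.card_eq]
  have h5 := sK.coord_eq_zero_of_mem_convexHull_face a (convexHull_mono h4 h3)
  rw [hcoord K a ha] at h5
  exact (mul_pos hε hpK).ne' h5

-- Three distinct elements at one face would have pairwise opposite outer normals, which is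
-- impossible for unit vectors. Hence a face has at most one neighbour besides K⁻.
open scoped Classical in
theorem card_erase_minus_le_one (o : T.Orientation) (Γ : T.faces) :
    ((T.adjacent Γ).erase (o.minus Γ)).card ≤ 1 := by
  refine Finset.card_le_one.2 fun K hK L hL => ?_
  by_contra hKL
  obtain ⟨hK0, hK⟩ := Finset.mem_erase.1 hK
  obtain ⟨hL0, hL⟩ := Finset.mem_erase.1 hL
  have hM : o.minus Γ ∈ T.adjacent Γ := mem_adjacent.2 (o.subset_minus Γ)
  have h1 := outerNormal_eq_neg hM hK (Ne.symm hK0)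
  have h2 := outerNormal_eq_neg hM hL (Ne.symm hL0)
  have h3 := outerNormal_eq_neg hK hL hKL
  have h4 := norm_outerNormal hM
  rw [h1, h2, neg_neg] at h3
  have h5 : (2 : ℝ) • outerNormal (o.minus Γ).1 Γ.1 = 0 := by
    rw [two_smul]
    nth_rw 1 [← h3]
    exact neg_add_cancel _
  rw [(smul_eq_zero.1 h5).resolve_left two_ne_zero, norm_zero] at h4
  exact zero_ne_one h4

theorem minus_mem_adjacent (o : T.Orientation) (Γ : T.faces) : o.minus Γ ∈ T.adjacent Γ :=
  mem_adjacent.2 (o.subset_minus Γ)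

open scoped Classical in
/-- The sign of the outer normal of an element relative to the normal of a face. -/
def sign (o : T.Orientation) (Γ : T.faces) (K : T.cells) : ℝ := if K = o.minus Γ then 1 else -1

theorem outerNormal_eq_sign (o : T.Orientation) {Γ : T.faces} {K : T.cells}
    (hK : K ∈ T.adjacent Γ) : outerNormal K.1 Γ.1 = sign o Γ K • T.normal o Γ := by
  unfold sign normal
  split_ifs with h
  · rw [h, one_smul]
  · rw [neg_one_smul, outerNormal_eq_neg (minus_mem_adjacent o Γ) hK (Ne.symm h)]

/-- A test function on `Ω` vanishes on faces with only one adjacent element. -/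
theorem IsTestFunction.eq_zero_of_boundary (hΩ : IsOpen Ω) {φ : Space (m + 1) → ℝ}
    (hφ : IsTestFunction Ω φ) {Γ : T.faces} {K : T.cells} (hK : T.adjacent Γ = {K})
    {x : Space (m + 1)} (hx : x ∈ convexHull ℝ (Γ.1 : Set (Space (m + 1)))) : φ x = 0 := by
  classical
  have hKm : K ∈ T.adjacent Γ := by rw [hK]; exact Finset.mem_singleton_self _
  obtain ⟨a, ha⟩ := exists_vertex hKm
  have sK := T.simplex K
  have hd := m.succ_pos
  -- points of the relative interior of the face do not belong to `Ω`
  have key : ∀ y, sK.basis.coord a y = 0 → (∀ c, c ≠ a → 0 < sK.basis.coord c y) → y ∉ Ω := by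
    intro y hy0 hypos hyΩ
    have hyK : y ∈ convexHull ℝ (K.1 : Set (Space (m + 1))) := by
      rw [sK.convexHull_eq]
      intro c
      by_cases hc : c = a
      · rw [hc, hy0]
      · exact (hypos c hc).le
    -- Since L is not adjacent to Γ, it misses a vertex z of Γ. By conformity a common point y lies
    -- in the face of K opposite z, contradicting λ_z(y) > 0.
    have hyL : ∀ L : T.cells, L ≠ K → y ∉ convexHull ℝ (L.1 : Set (Space (m + 1))) := by
      intro L hLK hyL
      have h3 := T.conforming K.1 K.2 L.1 L.2 ▸ Set.mem_inter hyK hyL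
      refine hLK (Finset.mem_singleton.1 (hK ▸ mem_adjacent.2 ?_))
      intro z hz
      rw [ha] at hz
      obtain ⟨hza, hzK⟩ := Finset.mem_erase.1 hz
      by_contra hzL
      have h4 : (K.1 : Set (Space (m + 1))) ∩ L.1 ⊆ (K.1.erase z : Finset _) := by
        rintro w ⟨hwK, hwL⟩
        exact Finset.mem_coe.2 (Finset.mem_erase.2 ⟨fun h => hzL (h ▸ hwL), hwK⟩)
      have h5 := sK.coord_eq_zero_of_mem_convexHull_face ⟨z, hzK⟩ (convexHull_mono h4 h3)
      exact (hypos ⟨z, hzK⟩ fun h => hza (congrArg Subtype.val h)).ne' h5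
    have hclosed : IsClosed (⋃ L ∈ (Finset.univ.erase K : Finset T.cells),
        convexHull ℝ (L.1 : Set (Space (m + 1)))) :=
      (Finset.univ.erase K).finite_toSet.isClosed_biUnion
        fun L _ => (isCompact_convexHull_finset L.1).isClosed
    -- Removing the other closed elements from Ω leaves an open neighbourhood of y inside K. So y is
    -- interior to K, which contradicts λ_a(y) = 0.
    have hcell : y ∈ cell K.1 := by
      refine mem_interior.2 ⟨Ω \ ⋃ L ∈ (Finset.univ.erase K : Finset T.cells),
        convexHull ℝ (L.1 : Set (Space (m + 1))), ?_, hΩ.sdiff hclosed, hyΩ, ?_⟩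
      · rintro z ⟨hzΩ, hz⟩
        have hz' := T.iUnion_closure ▸ subset_closure hzΩ
        simp only [Set.mem_iUnion] at hz'
        obtain ⟨L, hL, hzL⟩ := hz'
        by_cases hLK : L = K.1
        · exact hLK ▸ hzL
        · refine absurd ?_ hz
          simp only [Set.mem_iUnion]
          exact ⟨⟨L, hL⟩, by simpa [Subtype.ext_iff] using hLK, hzL⟩
      · simp only [Set.mem_iUnion, not_exists]
        intro L hL
        exact hyL L (by simpa using hL)
    rw [sK.cell_eq] at hcell
    exact (hcell a).ne' hy0
  have hzero : ∀ y, y ∉ Ω → φ y = 0 := fun y hy =>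
    image_eq_zero_of_notMem_tsupport fun h => hy (hφ.2.2 h)
  -- approximate `x` from the relative interior
  set x₀ := Γ.1.centroid ℝ id with hx₀
  have hcx := sK.coord_eq_zero_of_mem_convexHull_face a (ha ▸ hx)
  have hnn : ∀ c, 0 ≤ sK.basis.coord c x := by
    have : x ∈ convexHull ℝ (K.1 : Set (Space (m + 1))) :=
      convexHull_mono (Finset.coe_subset.2 (mem_adjacent.1 hKm)) hx
    rwa [sK.convexHull_eq] at this
  have hline : ∀ (t : ℝ) (c : K.1), sK.basis.coord c (AffineMap.lineMap x x₀ t)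
      = (1 - t) * sK.basis.coord c x + t * sK.basis.coord c x₀ := by
    intro t c
    rw [AffineMap.apply_lineMap, AffineMap.lineMap_apply_ring']
    ring
  have hc0 : sK.basis.coord a x₀ = 0 := by
    rw [hx₀, ha]
    exact sK.coord_eq_zero_of_mem_convexHull_face a (sK.centroid_face_mem hd a)
  have hcpos : ∀ c, c ≠ a → 0 < sK.basis.coord c x₀ := by
    intro c hc
    rw [hx₀, ha]
    exact sK.coord_centroid_face_pos hc
  have hev : ∀ᶠ t in 𝓝[>] (0 : ℝ), φ (AffineMap.lineMap x x₀ t) = 0 := by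
    filter_upwards [Ioo_mem_nhdsGT zero_lt_one] with t ht
    refine hzero _ (key _ ?_ fun c hc => ?_)
    · rw [hline, hcx, hc0]; ring
    · rw [hline]
      have h1 := mul_nonneg (sub_nonneg.2 ht.2.le) (hnn c)
      have h2 := mul_pos ht.1 (hcpos c hc)
      linarith
  have hlim : Tendsto (fun t : ℝ => φ (AffineMap.lineMap x x₀ t)) (𝓝[>] 0) (𝓝 (φ x)) := by
    have hc : Continuous fun t : ℝ => φ (AffineMap.lineMap x x₀ t) :=
      hφ.1.continuous.comp AffineMap.lineMap_continuous
    have := hc.tendsto 0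
    rw [AffineMap.lineMap_apply_zero] at this
    exact this.mono_left nhdsWithin_le_nhds
  exact tendsto_nhds_unique hlim (tendsto_const_nhds.congr' (hev.mono fun _ h => h.symm))

/-! ### Decomposition of integrals over the domain -/

/-- A vertex z of K is missing from L, so by conformity the closed elements meet only in the face of
K opposite z, which the open simplex avoids. -/
theorem disjoint_cell {K L : T.cells} (h : K ≠ L) : Disjoint (cell K.1) (cell L.1) := by
  classical
  rw [Set.disjoint_left]
  intro x hxK hxL
  have h3 := T.conforming K.1 K.2 L.1 L.2 ▸
    Set.mem_inter (interior_subset hxK) (interior_subset hxL)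
  obtain ⟨z, hzK, hzL⟩ : ∃ z ∈ K.1, z ∉ L.1 := by
    by_contra hcon
    push Not at hcon
    exact h (Subtype.ext (Finset.eq_of_subset_of_card_le hcon
      (by rw [T.card_cell _ K.2, T.card_cell _ L.2])))
  have h4 : (K.1 : Set (Space (m + 1))) ∩ L.1 ⊆ (K.1.erase z : Finset _) := by
    rintro w ⟨hwK, hwL⟩
    exact Finset.mem_coe.2 (Finset.mem_erase.2 ⟨fun h => hzL (h ▸ hwL), hwK⟩)
  have h5 := (T.simplex K).coord_eq_zero_of_mem_convexHull_face ⟨z, hzK⟩ (convexHull_mono h4 h3)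
  rw [(T.simplex K).cell_eq] at hxK
  exact (hxK ⟨z, hzK⟩).ne' h5

-- Ω lies between the union of the open elements and that of the closed ones, and the two differ by
-- finitely many null boundaries.
variable (T) in
theorem iUnion_cell_ae_eq : (⋃ K : T.cells, cell K.1) =ᵐ[volume] Ω := by
  have h1 : (⋃ K : T.cells, cell K.1) ⊆ Ω := Set.iUnion_subset fun K => T.cell_subset _ K.2
  have h2 : Ω ⊆ ⋃ K : T.cells, convexHull ℝ (K.1 : Set (Space (m + 1))) := by
    intro x hx
    have := T.iUnion_closure ▸ subset_closure hx
    simp only [Set.mem_iUnion] at this ⊢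
    obtain ⟨K, hK, hxK⟩ := this
    exact ⟨⟨K, hK⟩, hxK⟩
  have h3 : (⋃ K : T.cells, cell K.1)
      =ᵐ[volume] ⋃ K : T.cells, convexHull ℝ (K.1 : Set (Space (m + 1))) :=
    Filter.EventuallyEq.countable_iUnion fun K => cell_ae_eq K.1
  exact Filter.EventuallyLE.antisymm h1.eventuallyLE (h2.eventuallyLE.trans h3.symm.le)

variable (T) in
theorem ae_restrict_iff {p : Space (m + 1) → Prop} :
    (∀ᵐ x ∂(volume.restrict Ω), p x) ↔ ∀ K : T.cells, ∀ᵐ x ∂(volume.restrict (cell K.1)), p x := by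
  rw [← Measure.restrict_congr_set T.iUnion_cell_ae_eq, ae_restrict_iUnion_iff]

variable (T) in
theorem setIntegral_eq_sum {g : Space (m + 1) → ℝ} (hg : IntegrableOn g Ω) :
    ∫ x in Ω, g x = ∑ K : T.cells, ∫ x in cell K.1, g x := by
  rw [← Measure.restrict_congr_set T.iUnion_cell_ae_eq]
  exact integral_iUnion_fintype (fun K => isOpen_interior.measurableSet)
    (fun K L h => disjoint_cell h) fun K => hg.mono_set (T.cell_subset _ K.2)

end Mesh

/-! ### Raviart-Thomas fields on a grid -/

theorem memLp_cell {d : ℕ} {E : Type*} [NormedAddCommGroup E] (K : Finset (Space d))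
    {g : Space d → E} (hg : Continuous g) (p : ENNReal) : MemLp g p (volume.restrict (cell K)) := by
  have hc := isCompact_convexHull_finset K
  have : IsFiniteMeasure (volume.restrict (cell K)) :=
    ⟨by
      rw [Measure.restrict_apply_univ]
      exact (measure_mono interior_subset).trans_lt hc.measure_lt_top⟩
  obtain ⟨C, hC⟩ := hc.exists_bound_of_continuousOn hg.continuousOn
  refine MemLp.of_bound hg.aestronglyMeasurable C ?_
  filter_upwards [ae_restrict_mem isOpen_interior.measurableSet] with x hx
  exact hC x (interior_subset hx)

theorem setIntegral_cell {d : ℕ} (K : Finset (Space d)) (g : Space d → ℝ) :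
    ∫ x in cell K, g x = ∫ x in convexHull ℝ (K : Set (Space d)), g x :=
  setIntegral_congr_set (cell_ae_eq K)

namespace Mesh

variable {m : ℕ} {Ω : Set (Space (m + 1))}

theorem isFiniteMeasure (T : Mesh Ω) : IsFiniteMeasure (volume.restrict Ω) := by
  refine ⟨?_⟩
  rw [Measure.restrict_apply_univ]
  refine (measure_mono (T.iUnion_closure ▸ subset_closure)).trans_lt
    (T.cells.finite_toSet.isCompact_biUnion fun K _ => isCompact_convexHull_finset K).measure_lt_top

theorem integrable_of_L2 (T : Mesh Ω) (g : L2Scal Ω) : Integrable g (volume.restrict Ω) := by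
  have := T.isFiniteMeasure
  exact (Lp.memLp g).integrable one_le_two

/-- An element of `H_div` is determined by its field. -/
theorem hdiv_ext (T : Mesh Ω) (hΩ : IsOpen Ω) {q q' : HDiv Ω} (h : HDiv.field q = HDiv.field q') : q = q' := by
  refine Subtype.ext (WithLp.ofLp_injective 2 (Prod.ext h ?_))
  change HDiv.div q = HDiv.div q'
  have hint := T.integrable_of_L2 (HDiv.div q - HDiv.div q')
  refine sub_eq_zero.1 (Lp.eq_zero_iff_ae_eq_zero.2 ?_)
  refine (ae_restrict_iff' hΩ.measurableSet).2 ?_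
  -- Fields that agree have the same pairings with ∇φ, so the difference of the divergences
  -- integrates to zero against every test function.
  refine hΩ.ae_eq_zero_of_integral_contDiff_smul_eq_zero
    (IntegrableOn.locallyIntegrableOn hint) fun φ h1 h2 h3 => ?_
  have hφ : IsTestFunction Ω φ := ⟨h1, h2, h3⟩
  have e1 := q.2 φ hφ
  have e2 := q'.2 φ hφ
  have e3 : q.1.fst = q'.1.fst := h
  rw [e3, e2, neg_inj] at e1
  have e4 : ∫ x in Ω, HDiv.div q' x * φ x = ∫ x in Ω, HDiv.div q x * φ x := e1
  have e5 : ∫ x in Ω, φ x • (HDiv.div q - HDiv.div q') x = 0 := by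
    rw [← sub_eq_zero.2 e4.symm, ← integral_sub (hφ.integrable_mul _) (hφ.integrable_mul _)]
    refine integral_congr_ae ?_
    filter_upwards [Lp.coeFn_sub (HDiv.div q) (HDiv.div q')] with x hx
    rw [hx, Pi.sub_apply, smul_eq_mul]
    ring
  rw [← e5]
  symm
  refine setIntegral_eq_integral_of_forall_compl_eq_zero fun x hx => ?_
  rw [image_eq_zero_of_notMem_tsupport fun h => hx (h3 h), zero_smul]

variable (T : Mesh Ω)

/-- The field of `q` is `a_K + b_K x` on each element, where `c K = (a_K, b_K)`. -/
def HasCoef (q : HDiv Ω) (c : T.cells → Space (m + 1) × ℝ) : Prop :=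
  ∀ K : T.cells, ∀ᵐ x ∂(volume.restrict (cell K.1)), HDiv.field q x = (c K).1 + (c K).2 • x

variable {T}

/-- Reduces identities in H_div between piecewise fields to identities between their coefficients.
-/
theorem HasCoef.unique (hΩ : IsOpen Ω) {q q' : HDiv Ω} {c : T.cells → Space (m + 1) × ℝ}
    (h : T.HasCoef q c) (h' : T.HasCoef q' c) : q = q' := by
  refine T.hdiv_ext hΩ (Lp.ext ?_)
  refine T.ae_restrict_iff.2 fun K => ?_
  filter_upwards [h K, h' K] with x h1 h2
  rw [h1, h2]

theorem ae_cell {p : Space (m + 1) → Prop} (h : ∀ᵐ x ∂(volume.restrict Ω), p x) (K : T.cells) :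
    ∀ᵐ x ∂(volume.restrict (cell K.1)), p x := T.ae_restrict_iff.1 h K

theorem HasCoef.add {q q' : HDiv Ω} {c c' : T.cells → Space (m + 1) × ℝ}
    (h : T.HasCoef q c) (h' : T.HasCoef q' c') : T.HasCoef (q + q') (c + c') := by
  intro K
  filter_upwards [h K, h' K, ae_cell (Lp.coeFn_add (HDiv.field q) (HDiv.field q')) K] with x h1 h2 h3
  change (HDiv.field q + HDiv.field q' : L2Vec Ω) x = _
  rw [h3, Pi.add_apply, h1, h2]
  simp only [Pi.add_apply, Prod.fst_add, Prod.snd_add, add_smul]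
  abel

theorem HasCoef.smul {q : HDiv Ω} {c : T.cells → Space (m + 1) × ℝ} (r : ℝ)
    (h : T.HasCoef q c) : T.HasCoef (r • q) (r • c) := by
  intro K
  filter_upwards [h K, ae_cell (Lp.coeFn_smul r (HDiv.field q)) K] with x h1 h3
  change (r • HDiv.field q : L2Vec Ω) x = _
  rw [h3, Pi.smul_apply, h1]
  simp only [Pi.smul_apply, Prod.smul_fst, Prod.smul_snd, smul_add, smul_eq_mul, mul_smul]

/-! ### The Raviart-Thomas space -/

open scoped Classical in
theorem sum_indicator_cell {E : Type*} [AddCommMonoid E] (g : T.cells → Space (m + 1) → E)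
    {K : T.cells} {x : Space (m + 1)} (hx : x ∈ cell K.1) :
    ∑ L : T.cells, (cell L.1).indicator (g L) x = g K x := by
  rw [Finset.sum_eq_single K]
  · exact Set.indicator_of_mem hx _
  · intro L _ hLK
    exact Set.indicator_of_notMem (fun h => Set.disjoint_left.1 (disjoint_cell hLK) h hx) _
  · simp

theorem memLp_sum_indicator {E : Type*} [NormedAddCommGroup E] (g : T.cells → Space (m + 1) → E)
    (hg : ∀ K, Continuous (g K)) (p : ENNReal) :
    MemLp (fun x => ∑ L : T.cells, (cell L.1).indicator (g L) x) p (volume.restrict Ω) := by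
  refine memLp_finsetSum _ fun L _ => ?_
  have : MemLp ((cell L.1).indicator (g L)) p volume :=
    (memLp_indicator_iff_restrict isOpen_interior.measurableSet).2 (memLp_cell _ (hg L) p)
  exact this.restrict Ω

/-- The coefficients on `K` of the Raviart-Thomas field with normal components `F`. -/
def rtCell (o : T.Orientation) (F : T.faces → ℝ) (K : T.cells) : Space (m + 1) × ℝ :=
  (T.simplex K).rtCoef fun a => sign o (T.faceOf K a) K * F (T.faceOf K a)

theorem sign_mul_self (o : T.Orientation) (Γ : T.faces) (K : T.cells) :
    sign o Γ K * sign o Γ K = 1 := by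
  unfold sign
  split_ifs <;> norm_num

theorem inner_rtCell (o : T.Orientation) (F : T.faces → ℝ) {Γ : T.faces} {K : T.cells}
    (hK : K ∈ T.adjacent Γ) {x : Space (m + 1)}
    (hx : x ∈ convexHull ℝ (Γ.1 : Set (Space (m + 1)))) :
    inner ℝ ((rtCell o F K).1 + (rtCell o F K).2 • x) (T.normal o Γ) = F Γ := by
  classical
  obtain ⟨a, ha⟩ := exists_vertex hK
  have hΓ : Γ = T.faceOf K a := Subtype.ext (by rw [ha]; unfold faceOf; congr!)
  have h1 : inner ℝ ((rtCell o F K).1 + (rtCell o F K).2 • x) (outerNormal K.1 Γ.1)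
      = sign o Γ K * F Γ := by
    rw [ha] at hx ⊢
    have := (T.simplex K).inner_rtCoef m.succ_pos
      (fun a => sign o (T.faceOf K a) K * F (T.faceOf K a)) a (x := x) (by convert hx)
    rw [hΓ]
    unfold rtCell
    convert this
  rw [outerNormal_eq_sign o hK, real_inner_smul_right] at h1
  have h2 : sign o Γ K ≠ 0 := fun h => by simpa [h] using sign_mul_self o Γ K
  exact mul_left_cancel₀ h2 h1

/-- The source both of linearity in the face values and of uniqueness of the reconstruction. -/
theorem rtCell_unique (o : T.Orientation) (F : T.faces → ℝ) {K : T.cells} {c : Space (m + 1) × ℝ}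
    (h : ∀ Γ, K ∈ T.adjacent Γ → ∀ x ∈ convexHull ℝ (Γ.1 : Set (Space (m + 1))),
      inner ℝ (c.1 + c.2 • x) (T.normal o Γ) = F Γ) : c = rtCell o F K := by
  classical
  refine (T.simplex K).rt_unique m.succ_pos fun a x hx => ?_
  have hmem := faceOf_mem K a
  have hx' : x ∈ convexHull ℝ ((T.faceOf K a).1 : Set (Space (m + 1))) := by
    unfold faceOf
    convert hx
  have e : outerNormal K.1 (K.1.erase a.1) = sign o (T.faceOf K a) K • T.normal o (T.faceOf K a) := by
    rw [← outerNormal_eq_sign o hmem]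
    unfold faceOf
    congr!
  rw [e, real_inner_smul_right, real_inner_smul_right, h _ hmem x hx', inner_rtCell o F hmem hx']

theorem rtCell_add (o : T.Orientation) (F G : T.faces → ℝ) :
    rtCell o (F + G) = rtCell o F + rtCell o G := by
  ext1 K
  symm
  refine rtCell_unique o _ fun Γ hΓ x hx => ?_
  have h1 := inner_rtCell o F hΓ hx
  have h2 := inner_rtCell o G hΓ hx
  rw [Pi.add_apply, Pi.add_apply, ← h1, ← h2, ← inner_add_left]
  congr 1
  simp only [Prod.fst_add, Prod.snd_add, add_smul]
  abel

theorem rtCell_smul (o : T.Orientation) (r : ℝ) (F : T.faces → ℝ) :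
    rtCell o (r • F) = r • rtCell o F := by
  ext1 K
  symm
  refine rtCell_unique o _ fun Γ hΓ x hx => ?_
  have h1 := inner_rtCell o F hΓ hx
  rw [Pi.smul_apply, Pi.smul_apply, ← h1, smul_eq_mul, ← real_inner_smul_left]
  congr 1
  simp only [Prod.smul_fst, Prod.smul_snd, smul_add, smul_eq_mul, mul_smul]

/-- The divergence theorem on an element for a Raviart-Thomas field. -/
theorem integral_rtCell (o : T.Orientation) (F : T.faces → ℝ) (K : T.cells)
    {φ : Space (m + 1) → ℝ} (hφ : ContDiff ℝ 1 φ) :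
    ∫ x in cell K.1, (inner ℝ ((rtCell o F K).1 + (rtCell o F K).2 • x) (gradient φ x)
        + ((m + 1 : ℕ) * (rtCell o F K).2) * φ x)
      = ∑ Γ : T.faces, open scoped Classical in if K ∈ T.adjacent Γ then
          sign o Γ K * F Γ * ∫ x, φ x ∂(surface Γ.1) else 0 := by
  classical
  rw [setIntegral_cell, (T.simplex K).integral_rt _ hφ,
    ← sum_faceOf K fun Γ => sign o Γ K * F Γ * ∫ x, φ x ∂(surface Γ.1)]
  refine Finset.sum_congr rfl fun a _ => ?_
  have hmem := faceOf_mem K a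
  have hΓ : (T.faceOf K a).1 = K.1.erase a.1 := by unfold faceOf; congr!
  rw [← integral_const_mul, ← hΓ]
  refine setIntegral_congr_fun (isCompact_convexHull_finset _).isClosed.measurableSet
    fun x hx => ?_
  beta_reduce
  rw [outerNormal_eq_sign o hmem, real_inner_smul_right, inner_rtCell o F hmem hx]
  ring

theorem ae_surface_of_forall {d : ℕ} (Γ : Finset (Space d)) {p : Space d → Prop}
    (h : ∀ x ∈ convexHull ℝ (Γ : Set (Space d)), p x) : ∀ᵐ x ∂(surface Γ), p x :=
  ae_restrict_of_forall_mem (isCompact_convexHull_finset _).isClosed.measurableSet h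

/-- On an inner face the signs 1 and -1 cancel; on a boundary face only one sign occurs, but the
test function vanishes there. -/
theorem sum_sign_mul (hΩ : IsOpen Ω) (o : T.Orientation) (Γ : T.faces)
    {φ : Space (m + 1) → ℝ} (hφ : IsTestFunction Ω φ) :
    (∑ K ∈ T.adjacent Γ, sign o Γ K) * ∫ x, φ x ∂(surface Γ.1) = 0 := by
  classical
  have hM := minus_mem_adjacent o Γ
  have hs : ∑ K ∈ T.adjacent Γ, sign o Γ K
      = 1 - ((T.adjacent Γ).erase (o.minus Γ)).card := by
    rw [← Finset.add_sum_erase _ _ hM, Finset.sum_congr rfl (g := fun _ => (-1 : ℝ))]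
    · simp [sign]
      ring
    · intro K hK
      simp [sign, (Finset.mem_erase.1 hK).1]
  rcases Nat.le_one_iff_eq_zero_or_eq_one.1 (card_erase_minus_le_one o Γ) with h | h
  · have h0 : (T.adjacent Γ).erase (o.minus Γ) = ∅ := Finset.card_eq_zero.1 h
    have hadj : T.adjacent Γ = {o.minus Γ} := by
      have e := Finset.insert_erase hM
      rw [h0] at e
      exact e.symm
    have : ∫ x, φ x ∂(surface Γ.1) = 0 := by
      refine integral_eq_zero_of_ae (ae_surface_of_forall _ fun x hx => ?_)
      exact IsTestFunction.eq_zero_of_boundary hΩ hφ hadj hx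
    rw [this, mul_zero]
  · rw [hs]
    have h' : (((T.adjacent Γ).erase (o.minus Γ)).card : ℝ) = 1 := by
      rw [h, Nat.cast_one]
    rw [h', sub_self, zero_mul]

/-- The Raviart-Thomas field with normal components `F`. -/
def rtFun (o : T.Orientation) (F : T.faces → ℝ) (x : Space (m + 1)) : Space (m + 1) :=
  ∑ K : T.cells, (cell K.1).indicator (fun x => (rtCell o F K).1 + (rtCell o F K).2 • x) x

/-- Its divergence. -/
def rtDivFun (o : T.Orientation) (F : T.faces → ℝ) (x : Space (m + 1)) : ℝ :=
  ∑ K : T.cells, (cell K.1).indicator (fun _ => (m + 1 : ℕ) * (rtCell o F K).2) x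

theorem memLp_rtFun (o : T.Orientation) (F : T.faces → ℝ) :
    MemLp (rtFun o F) 2 (volume.restrict Ω) :=
  memLp_sum_indicator _ (fun K => by fun_prop) 2

theorem memLp_rtDivFun (o : T.Orientation) (F : T.faces → ℝ) :
    MemLp (rtDivFun o F) 2 (volume.restrict Ω) :=
  memLp_sum_indicator (fun K _ => (m + 1 : ℕ) * (rtCell o F K).2) (fun _ => continuous_const) 2

/-- Integrate by parts on each element and exchange the sums over elements and faces. Since the
normal component F_Γ is common to both sides, each face contributes F_Γ times the quantity that
vanishes by `sum_sign_mul`. -/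
theorem isWeakDiv_rtFun (hΩ : IsOpen Ω) (o : T.Orientation) (F : T.faces → ℝ) :
    IsWeakDiv Ω ((memLp_rtFun o F).toLp _) ((memLp_rtDivFun o F).toLp _) := by
  classical
  intro φ hφ
  rw [← add_eq_zero_iff_eq_neg,
    ← integral_add (hφ.integrable_inner _) (hφ.integrable_mul _)]
  refine (T.setIntegral_eq_sum ((hφ.integrable_inner _).add (hφ.integrable_mul _))).trans ?_
  simp only [Pi.add_apply]
  have h1 : ∀ K : T.cells, ∫ x in cell K.1, (inner ℝ ((memLp_rtFun o F).toLp _ x) (gradient φ x)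
        + (memLp_rtDivFun o F).toLp _ x * φ x)
      = ∫ x in cell K.1, (inner ℝ ((rtCell o F K).1 + (rtCell o F K).2 • x) (gradient φ x)
        + ((m + 1 : ℕ) * (rtCell o F K).2) * φ x) := by
    intro K
    refine integral_congr_ae ?_
    filter_upwards [ae_cell (memLp_rtFun o F).coeFn_toLp K,
      ae_cell (memLp_rtDivFun o F).coeFn_toLp K,
      ae_restrict_mem isOpen_interior.measurableSet] with x hx1 hx2 hx
    rw [hx1, hx2, rtFun, rtDivFun, sum_indicator_cell _ hx, sum_indicator_cell _ hx]
  simp only [h1, integral_rtCell o F _ (hφ.1.of_le (by simp))]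
  rw [Finset.sum_comm]
  refine Finset.sum_eq_zero fun Γ _ => ?_
  rw [← Finset.sum_filter]
  have h2 := sum_sign_mul hΩ o Γ hφ
  have h3 : Finset.univ.filter (fun K => K ∈ T.adjacent Γ) = T.adjacent Γ := by
    ext K; simp
  rw [h3]
  calc ∑ K ∈ T.adjacent Γ, sign o Γ K * F Γ * ∫ x, φ x ∂(surface Γ.1)
      = F Γ * ((∑ K ∈ T.adjacent Γ, sign o Γ K) * ∫ x, φ x ∂(surface Γ.1)) := by
        rw [Finset.sum_mul, Finset.mul_sum]
        exact Finset.sum_congr rfl fun K _ => by ring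
    _ = 0 := by rw [h2, mul_zero]

/-- The element of `H_div` with normal components `F`. -/
def rtElem (hΩ : IsOpen Ω) (o : T.Orientation) (F : T.faces → ℝ) : HDiv Ω :=
  ⟨WithLp.toLp 2 ((memLp_rtFun o F).toLp _, (memLp_rtDivFun o F).toLp _),
    isWeakDiv_rtFun hΩ o F⟩

theorem hasCoef_rtElem (hΩ : IsOpen Ω) (o : T.Orientation) (F : T.faces → ℝ) :
    T.HasCoef (rtElem hΩ o F) (rtCell o F) := by
  intro K
  filter_upwards [ae_cell (memLp_rtFun o F).coeFn_toLp K,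
    ae_restrict_mem isOpen_interior.measurableSet] with x hx1 hx
  change (memLp_rtFun o F).toLp _ x = _
  rw [hx1, rtFun, sum_indicator_cell _ hx]

theorem div_rtElem (hΩ : IsOpen Ω) (o : T.Orientation) (F : T.faces → ℝ) (K : T.cells) :
    ∀ᵐ x ∂(volume.restrict (cell K.1)),
      HDiv.div (rtElem hΩ o F) x = (m + 1 : ℕ) * (rtCell o F K).2 := by
  filter_upwards [ae_cell (memLp_rtDivFun o F).coeFn_toLp K,
    ae_restrict_mem isOpen_interior.measurableSet] with x hx1 hx
  change (memLp_rtDivFun o F).toLp _ x = _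
  rw [hx1, rtDivFun, sum_indicator_cell _ hx]

theorem rtElem_add (hΩ : IsOpen Ω) (o : T.Orientation) (F G : T.faces → ℝ) :
    rtElem hΩ o (F + G) = rtElem hΩ o F + rtElem hΩ o G := by
  have h := hasCoef_rtElem hΩ o (F + G)
  rw [rtCell_add] at h
  exact HasCoef.unique hΩ h (HasCoef.add (hasCoef_rtElem hΩ o F) (hasCoef_rtElem hΩ o G))

theorem rtElem_smul (hΩ : IsOpen Ω) (o : T.Orientation) (r : ℝ) (F : T.faces → ℝ) :
    rtElem hΩ o (r • F) = r • rtElem hΩ o F := by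
  have h := hasCoef_rtElem hΩ o (r • F)
  rw [rtCell_smul] at h
  exact HasCoef.unique hΩ h (HasCoef.smul r (hasCoef_rtElem hΩ o F))

/-- The isomorphism from face values to the Raviart-Thomas space. -/
def rtLift (hΩ : IsOpen Ω) (o : T.Orientation) : (T.faces → ℝ) →ₗ[ℝ] HDiv Ω where
  toFun := rtElem hΩ o
  map_add' := rtElem_add hΩ o
  map_smul' := rtElem_smul hΩ o

end Mesh

namespace Mesh

/-! ### The flux reconstruction -/

variable {m : ℕ} {Ω : Set (Space (m + 1))} {T : Mesh Ω}

/-- The prescribed flux of the reconstruction of `v` over a face. -/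
def faceData (o : T.Orientation) (ν : ℝ) (s : Space (m + 1) → ℝ) (v : T.DGSpace)
    (Γ : T.faces) : ℝ :=
  ∫ x, (- T.avgFlux o s v Γ x + ν / faceDiam Γ.1 * T.jumpAt o v Γ x) ∂(surface Γ.1)

theorem surface_real_ne_zero (Γ : T.faces) : (surface Γ.1).real Set.univ ≠ 0 := by
  classical
  obtain ⟨K, hK, hΓ⟩ := Finset.mem_biUnion.1 Γ.2
  have hmem : (⟨K, hK⟩ : T.cells) ∈ T.adjacent Γ :=
    mem_adjacent.2 (Finset.mem_powersetCard.1 hΓ).1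
  obtain ⟨a, ha⟩ := exists_vertex hmem
  have h := (T.simplex ⟨K, hK⟩).surface_face_univ a
  rw [ha, Measure.real, ENNReal.toReal_ne_zero]
  convert h

theorem integrable_surface (Γ : T.faces) {g : Space (m + 1) → ℝ} (hg : Continuous g) :
    Integrable g (surface Γ.1) := by
  classical
  obtain ⟨K, hK, hΓ⟩ := Finset.mem_biUnion.1 Γ.2
  have hmem : (⟨K, hK⟩ : T.cells) ∈ T.adjacent Γ :=
    mem_adjacent.2 (Finset.mem_powersetCard.1 hΓ).1
  obtain ⟨a, ha⟩ := exists_vertex hmem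
  rw [ha]
  convert (T.simplex ⟨K, hK⟩).integrable_surface a hg

theorem integral_surface_of_forall_eq (Γ : T.faces) {g : Space (m + 1) → ℝ} {r : ℝ}
    (h : ∀ x ∈ convexHull ℝ (Γ.1 : Set (Space (m + 1))), g x = r) :
    ∫ x, g x ∂(surface Γ.1) = (surface Γ.1).real Set.univ * r := by
  rw [integral_congr_ae (ae_surface_of_forall Γ.1 h), integral_const, smul_eq_mul]

/-- The vector x - y is tangential to the face, so the part b x adds a constant to the normal
component. A prescribed face integral thus fixes that component upon division by the area. -/
theorem inner_normal_const (o : T.Orientation) (Γ : T.faces) (c : Space (m + 1) × ℝ)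
    {x y : Space (m + 1)} (hx : x ∈ convexHull ℝ (Γ.1 : Set (Space (m + 1))))
    (hy : y ∈ convexHull ℝ (Γ.1 : Set (Space (m + 1)))) :
    inner ℝ (c.1 + c.2 • x) (T.normal o Γ) = inner ℝ (c.1 + c.2 • y) (T.normal o Γ) := by
  classical
  obtain ⟨a, ha⟩ := exists_vertex (minus_mem_adjacent o Γ)
  have sK := T.simplex (o.minus Γ)
  have e : T.normal o Γ = outerNormal (o.minus Γ).1 ((o.minus Γ).1.erase a.1) := by
    unfold normal
    rw [ha]
  rw [ha] at hx hy
  have h1 := sK.inner_sub_outerNormal m.succ_pos a x y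
  rw [sK.coord_eq_zero_of_mem_convexHull_face a (by convert hx),
    sK.coord_eq_zero_of_mem_convexHull_face a (by convert hy), sub_zero, mul_zero, neg_zero] at h1
  rw [← sub_eq_zero, ← inner_sub_left, add_sub_add_left_eq_sub, ← smul_sub, real_inner_smul_left, e,
    h1, mul_zero]

/-- The face conditions determine the flux reconstruction, which is given by its normal
components. -/
theorem isFluxReconstruction_iff (hΩ : IsOpen Ω) (o : T.Orientation) (ν : ℝ)
    (s : Space (m + 1) → ℝ) (v : T.DGSpace) (q : HDiv Ω) :
    T.IsFluxReconstruction o ν s v q ↔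
      q = rtLift hΩ o fun Γ => ((surface Γ.1).real Set.univ)⁻¹ * faceData o ν s v Γ := by
  constructor
  · rintro ⟨c, ⟨hc1, hc2⟩, hc3⟩
    have h1 : c = rtCell o
        (fun Γ => ((surface Γ.1).real Set.univ)⁻¹ * faceData o ν s v Γ) := by
      ext1 K
      refine rtCell_unique o _ fun Γ hΓ x hx => ?_
      rw [hc2 Γ K hΓ (o.minus Γ) (minus_mem_adjacent o Γ) x hx]
      have h2 := hc3 Γ
      rw [integral_surface_of_forall_eq Γ fun y hy => inner_normal_const o Γ _ hy hx] at h2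
      rw [faceData, ← h2, inv_mul_cancel_left₀ (surface_real_ne_zero Γ)]
    have h3 : T.HasCoef q (rtCell o
        fun Γ => ((surface Γ.1).real Set.univ)⁻¹ * faceData o ν s v Γ) := by
      rw [← h1]; exact hc1
    exact h3.unique hΩ (hasCoef_rtElem hΩ o _)
  · rintro rfl
    refine ⟨_, ⟨hasCoef_rtElem hΩ o _, fun Γ K hK L hL x hx => ?_⟩, fun Γ => ?_⟩
    · rw [inner_rtCell o _ hK hx, inner_rtCell o _ hL hx]
    · have h4 := integral_surface_of_forall_eq Γ fun x hx => inner_rtCell o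
        (fun Γ => ((surface Γ.1).real Set.univ)⁻¹ * faceData o ν s v Γ)
        (minus_mem_adjacent o Γ) (x := x) hx
      rw [mul_inv_cancel_left₀ (surface_real_ne_zero Γ)] at h4
      exact h4

theorem existsUnique_fluxReconstruction (hΩ : IsOpen Ω) (o : T.Orientation) (ν : ℝ)
    (s : Space (m + 1) → ℝ) (v : T.DGSpace) : ∃! q, T.IsFluxReconstruction o ν s v q := by
  simp only [isFluxReconstruction_iff hΩ]
  exact existsUnique_eq

theorem fluxReconstruction_eq (hΩ : IsOpen Ω) (o : T.Orientation) (ν : ℝ)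
    (s : Space (m + 1) → ℝ) (v : T.DGSpace) :
    T.fluxReconstruction o ν s v
      = rtLift hΩ o fun Γ => ((surface Γ.1).real Set.univ)⁻¹ * faceData o ν s v Γ := by
  have h : ∃ q, T.IsFluxReconstruction o ν s v q := (existsUnique_fluxReconstruction hΩ o ν s v).exists
  rw [← isFluxReconstruction_iff hΩ, fluxReconstruction, dif_pos h]
  exact h.choose_spec

/-! ### Local conservation -/

theorem hdiv_div_add (p q : HDiv Ω) : HDiv.div (p + q) = HDiv.div p + HDiv.div q := rfl

theorem hdiv_div_smul (r : ℝ) (q : HDiv Ω) : HDiv.div (r • q) = r • HDiv.div q := rfl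

variable (T) in
/-- The integral of the divergence over an element. -/
def divIntegral (K : T.cells) : HDiv Ω →ₗ[ℝ] ℝ where
  toFun q := ∫ x in cell K.1, HDiv.div q x
  map_add' p q := by
    have hint : ∀ q : HDiv Ω, Integrable (HDiv.div q) (volume.restrict (cell K.1)) := fun q =>
      IntegrableOn.mono_set (T.integrable_of_L2 _) (T.cell_subset _ K.2)
    refine Eq.trans (integral_congr_ae ?_) (integral_add (hint p) (hint q))
    filter_upwards [ae_cell (Lp.coeFn_add (HDiv.div p) (HDiv.div q)) K] with x hx
    rw [hdiv_div_add, hx, Pi.add_apply]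
  map_smul' r q := by
    refine Eq.trans (integral_congr_ae ?_) (integral_const_mul r _)
    filter_upwards [ae_cell (Lp.coeFn_smul r (HDiv.div q)) K] with x hx
    rw [hdiv_div_smul, hx, Pi.smul_apply, smul_eq_mul]

theorem mem_conservative {g : Space (m + 1) → ℝ} {q : HDiv Ω} :
    q ∈ T.conservative g ↔ ∀ K : T.cells, T.divIntegral K q = ∫ x in cell K.1, g x := by
  simp only [conservative, Set.mem_ofPred_eq, Subtype.forall]
  rfl

-- The divergence theorem with φ = 1.
open scoped Classical in
theorem divIntegral_rtLift (hΩ : IsOpen Ω) (o : T.Orientation) (F : T.faces → ℝ) (K : T.cells) :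
    T.divIntegral K (rtLift hΩ o F)
      = ∑ Γ : T.faces, if K ∈ T.adjacent Γ then
          sign o Γ K * F Γ * (surface Γ.1).real Set.univ else 0 := by
  have h := integral_rtCell o F K (φ := fun _ => 1) contDiff_const
  have h1 : T.divIntegral K (rtLift hΩ o F)
      = ∫ x in cell K.1, ((m + 1 : ℕ) * (rtCell o F K).2) :=
    integral_congr_ae (div_rtElem hΩ o F K)
  rw [h1]
  simp only [gradient_fun_const, inner_zero_right, zero_add, mul_one, integral_const,
    smul_eq_mul] at h ⊢
  rw [h]

open scoped Classical in
theorem divIntegral_fluxReconstruction (hΩ : IsOpen Ω) (o : T.Orientation) (ν : ℝ)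
    (s : Space (m + 1) → ℝ) (v : T.DGSpace) (K : T.cells) :
    T.divIntegral K (T.fluxReconstruction o ν s v)
      = ∑ Γ : T.faces, if K ∈ T.adjacent Γ then sign o Γ K * faceData o ν s v Γ else 0 := by
  rw [fluxReconstruction_eq hΩ, divIntegral_rtLift]
  refine Finset.sum_congr rfl fun Γ _ => ?_
  have := surface_real_ne_zero Γ
  split_ifs
  · field_simp
  · rfl

open scoped Classical in
/-- The characteristic function of an element. -/
def charFun (K : T.cells) : T.DGSpace := Pi.single K (AffineMap.const ℝ (Space (m + 1)) 1)

theorem affGrad_charFun (K L : T.cells) : affGrad (charFun K L) = 0 := by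
  have h : (charFun K L).linear = 0 := by
    unfold charFun
    by_cases h : L = K
    · subst h; rw [Pi.single_eq_same]; rfl
    · rw [Pi.single_eq_of_ne h]; rfl
  rw [affGrad, h]
  simp

open scoped Classical in
theorem charFun_apply (K L : T.cells) (x : Space (m + 1)) :
    charFun K L x = if L = K then 1 else 0 := by
  unfold charFun
  split_ifs with h
  · subst h; rw [Pi.single_eq_same]; rfl
  · rw [Pi.single_eq_of_ne h]; rfl

-- The jump takes the value 1 for K = K⁻ and -1 for the other neighbour: exactly the orientation
-- sign in the divergence theorem.
open scoped Classical in
theorem jumpAt_charFun (o : T.Orientation) (K : T.cells) (Γ : T.faces) (x : Space (m + 1)) :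
    T.jumpAt o (charFun K) Γ x = if K ∈ T.adjacent Γ then sign o Γ K else 0 := by
  simp only [jumpAt, jump, charFun_apply, Finset.sum_ite_eq', Finset.mem_erase, sign]
  have := minus_mem_adjacent o Γ
  by_cases h : K = o.minus Γ
  · subst h; simp [this]
  · simp [h, Ne.symm h]
    split_ifs <;> simp

theorem avgFlux_charFun (o : T.Orientation) (s : Space (m + 1) → ℝ) (K : T.cells) (Γ : T.faces)
    (x : Space (m + 1)) : T.avgFlux o s (charFun K) Γ x = 0 := by
  simp [avgFlux, avg, affGrad_charFun]

-- Zero gradient removes the volume term and the average flux of the test function. What remains is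
-- the right-hand side of `divIntegral_fluxReconstruction`, so testing with an element computes the
-- total divergence over it.
open scoped Classical in
theorem ipForm_charFun (o : T.Orientation) (ν : ℝ) (s : Space (m + 1) → ℝ) (u : T.DGSpace)
    (K : T.cells) : T.ipForm o ν s u (charFun K)
      = ∑ Γ : T.faces, if K ∈ T.adjacent Γ then sign o Γ K * faceData o ν s u Γ else 0 := by
  simp only [ipForm, affGrad_charFun, inner_zero_right, mul_zero, integral_zero,
    Finset.sum_const_zero, zero_add, avgFlux_charFun, neg_zero, zero_mul, zero_sub,
    jumpAt_charFun]
  refine Finset.sum_congr rfl fun Γ _ => ?_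
  split_ifs
  · rw [faceData, ← integral_const_mul]
    congr 1
    ext x
    ring
  · simp

theorem load_charFun (f : Space (m + 1) → ℝ) (K : T.cells) :
    T.load f (charFun K) = ∫ x in cell K.1, f x := by
  classical
  rw [load, Finset.sum_eq_single K]
  · simp [charFun_apply]
  · intro L _ hL
    simp [charFun_apply, hL]
  · simp

/-- The flux reconstruction of an IPDG solution is locally conservative. -/
theorem fluxReconstruction_conservative (hΩ : IsOpen Ω) (o : T.Orientation) (ν : ℝ)
    {s f : Space (m + 1) → ℝ} {u : T.DGSpace} (hu : T.IsGalerkinSolution o ν s f ⊤ u) :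
    T.fluxReconstruction o ν s u ∈ T.conservative f := by
  classical
  refine mem_conservative.2 fun K => ?_
  rw [divIntegral_fluxReconstruction hΩ, ← ipForm_charFun, hu.2 _ trivial, load_charFun]

end Mesh

/-! ### Traces -/

theorem HasTraceAt.trace_eq {d : ℕ} {K : Finset (Space d)} {s : Space d → ℝ} {x : Space d} {c : ℝ}
    (h : HasTraceAt K s x c) : trace K s x = c :=
  h.limUnder_eq

theorem HasTraceAt.congr_ae {d : ℕ} {K : Finset (Space d)} {s s' : Space d → ℝ} {x : Space d}
    {c : ℝ} (h : HasTraceAt K s x c) (hs : s =ᵐ[volume.restrict (cell K)] s') :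
    HasTraceAt K s' x c := by
  refine Tendsto.congr (fun r => ?_) h
  exact average_congr (ae_restrict_of_ae_restrict_of_subset Set.inter_subset_right hs)

theorem HasTraceAt.sum {d : ℕ} {ι : Type*} [Fintype ι] {K : Finset (Space d)}
    {s : ι → Space d → ℝ} {x : Space d} {c : ι → ℝ} (h : ∀ i, HasTraceAt K (s i) x (c i))
    (hs : ∀ i, IntegrableOn (s i) (cell K)) (θ : ι → ℝ) :
    HasTraceAt K (fun y => ∑ i, θ i * s i y) x (∑ i, θ i * c i) := by
  have h1 := tendsto_finsetSum Finset.univ fun i _ => (h i).const_mul (θ i)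
  refine Tendsto.congr (fun r => ?_) h1
  have hint : ∀ i, IntegrableOn (s i) (Metric.ball x r ∩ cell K) := fun i =>
    (hs i).mono_set Set.inter_subset_right
  simp only [setAverage_eq]
  rw [integral_finsetSum _ fun i _ => (hint i).const_mul _]
  simp only [integral_const_mul, smul_eq_mul]
  rw [Finset.mul_sum]
  exact Finset.sum_congr rfl fun i _ => by ring

/-- Averages over balls are measurable functions of the centre. -/
theorem measurable_setAverage_ball {d : ℕ} {s : Space d → ℝ} (hs : Measurable s)
    (A : Set (Space d)) (r : ℝ) :
    StronglyMeasurable fun x => ⨍ y in Metric.ball x r ∩ A, s y := by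
  have key : ∀ g : Space d → ℝ, Measurable g →
      StronglyMeasurable fun x => ∫ y in Metric.ball x r ∩ A, g y := by
    intro g hg
    -- The moving ball becomes a fixed measurable set of pairs, so that measurability of parametric
    -- integrals applies.
    have hset : MeasurableSet {p : Space d × Space d | dist p.2 p.1 < r} :=
      measurableSet_lt (by fun_prop) measurable_const
    have h1 : StronglyMeasurable fun p : Space d × Space d =>
        {p : Space d × Space d | dist p.2 p.1 < r}.indicator (fun p => g p.2) p :=
      ((hg.comp measurable_snd).indicator hset).stronglyMeasurable
    have h2 := h1.integral_prod_right' (ν := volume.restrict A)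
    refine (congrArg StronglyMeasurable (funext fun x => ?_)).mp h2
    have h3 : (fun y => {p : Space d × Space d | dist p.2 p.1 < r}.indicator
        (fun p => g p.2) (x, y)) = (Metric.ball x r).indicator g := by
      ext y
      by_cases hy : dist y x < r
      · rw [Set.indicator_of_mem (by exact hy), Set.indicator_of_mem (by exact hy)]
      · rw [Set.indicator_of_notMem (by exact hy), Set.indicator_of_notMem (by exact hy)]
    rw [h3, integral_indicator Metric.isOpen_ball.measurableSet,
      Measure.restrict_restrict Metric.isOpen_ball.measurableSet]
  have hone : StronglyMeasurable fun x => volume.real (Metric.ball x r ∩ A) := by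
    have := key (fun _ => 1) measurable_const
    simpa using this
  simp only [setAverage_eq]
  exact (hone.measurable.inv.mul (key s hs).measurable).stronglyMeasurable

namespace Mesh

variable {m : ℕ} {Ω : Set (Space (m + 1))} {T : Mesh Ω}

theorem IsCoefficient.integrableOn_cell {s : Space (m + 1) → ℝ} (hs : T.IsCoefficient s)
    (K : T.cells) : IntegrableOn s (cell K.1) := by
  have := T.isFiniteMeasure
  exact IntegrableOn.mono_set (hs.memLp.integrable le_top) (T.cell_subset _ K.2)

theorem IsCoefficient.hasTraceAt {s : Space (m + 1) → ℝ} (hs : T.IsCoefficient s) {Γ : T.faces}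
    {K : T.cells} (hK : K ∈ T.adjacent Γ) :
    ∀ᵐ x ∂(surface Γ.1), HasTraceAt K.1 s x (trace K.1 s x) := by
  filter_upwards [hs.hasTrace Γ K hK] with x hx
  obtain ⟨c, hc⟩ := hx
  rwa [hc.trace_eq]

/-- The trace is an almost everywhere limit of averages over balls of radius 1/(k+1), which depend
measurably on the centre once s is replaced by a measurable representative; averages do not notice
the replacement. -/
theorem IsCoefficient.aestronglyMeasurable_trace {s : Space (m + 1) → ℝ}
    (hs : T.IsCoefficient s) {Γ : T.faces} {K : T.cells} (hK : K ∈ T.adjacent Γ) :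
    AEStronglyMeasurable (trace K.1 s) (surface Γ.1) := by
  have hsm := (hs.integrableOn_cell K).aestronglyMeasurable
  have hu : Tendsto (fun k : ℕ => 1 / ((k : ℝ) + 1)) atTop (𝓝[>] 0) :=
    tendsto_nhdsWithin_iff.2 ⟨tendsto_one_div_add_atTop_nhds_zero_nat,
      Eventually.of_forall fun k => Set.mem_Ioi.2 (by positivity)⟩
  refine aestronglyMeasurable_of_tendsto_ae atTop
    (f := fun (k : ℕ) x => ⨍ y in Metric.ball x (1 / ((k : ℝ) + 1)) ∩ cell K.1, hsm.mk s y)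
    (fun k => (measurable_setAverage_ball hsm.stronglyMeasurable_mk.measurable _
      _).aestronglyMeasurable) ?_
  filter_upwards [hs.hasTraceAt hK] with x hx
  exact (hx.congr_ae hsm.ae_eq_mk).comp hu

/-- Averages obey the essential bound of s, and so do their limits. -/
theorem IsCoefficient.exists_trace_bound {s : Space (m + 1) → ℝ}
    (hs : T.IsCoefficient s) {Γ : T.faces} {K : T.cells} (hK : K ∈ T.adjacent Γ) :
    ∃ C, ∀ᵐ x ∂(surface Γ.1), ‖trace K.1 s x‖ ≤ C := by
  obtain ⟨C, hC0, hC⟩ : ∃ C : ℝ, 0 ≤ C ∧ ∀ᵐ x ∂(volume.restrict Ω), ‖s x‖ ≤ C :=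
    ⟨_, ENNReal.toReal_nonneg, by
      filter_upwards [ae_le_eLpNormEssSup (f := s) (μ := volume.restrict Ω)] with x hx
      rw [← toReal_enorm]
      refine ENNReal.toReal_mono ?_ hx
      rw [← eLpNorm_exponent_top]
      exact hs.memLp.2.ne⟩
  refine ⟨C, ?_⟩
  filter_upwards [hs.hasTraceAt hK] with x hx
  refine le_of_tendsto hx.norm (Eventually.of_forall fun r => ?_)
  have hfin : volume (Metric.ball x r ∩ cell K.1) < ⊤ :=
    (measure_mono Set.inter_subset_left).trans_lt measure_ball_lt_top
  have h1 : ‖∫ y in Metric.ball x r ∩ cell K.1, s y‖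
      ≤ C * volume.real (Metric.ball x r ∩ cell K.1) :=
    norm_setIntegral_le_of_norm_le_const_ae hfin
      (ae_restrict_of_ae_restrict_of_subset Set.inter_subset_right (ae_cell hC K))
  rw [setAverage_eq, norm_smul, norm_inv, Real.norm_of_nonneg measureReal_nonneg]
  -- If the intersection is null, the average has the default value 0; this case needs C ≥ 0.
  rcases (measureReal_nonneg (μ := volume) (s := Metric.ball x r ∩ cell K.1)).eq_or_lt with h0 | h0
  · rw [← h0, inv_zero, zero_mul]
    exact hC0
  · rw [inv_mul_le_iff₀ h0, mul_comm]
    exact h1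

theorem IsCoefficient.integrable_trace_mul {s : Space (m + 1) → ℝ}
    (hs : T.IsCoefficient s) {Γ : T.faces} {K : T.cells} (hK : K ∈ T.adjacent Γ)
    {g : Space (m + 1) → ℝ} (hg : Continuous g) :
    Integrable (fun x => trace K.1 s x * g x) (surface Γ.1) := by
  obtain ⟨C, hC⟩ := hs.exists_trace_bound hK
  exact (integrable_surface Γ hg).bdd_mul (hs.aestronglyMeasurable_trace hK) hC

/-- Faces are null sets, so an identity almost everywhere in Ω cannot be restricted to them. It
passes to the traces because these are limits of volume averages, which are linear in the
coefficient. -/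
theorem IsCoefficient.trace_sum {ι : Type*} [Fintype ι] {s : Space (m + 1) → ℝ}
    {τ : ι → Space (m + 1) → ℝ} (hτ : ∀ i, T.IsCoefficient (τ i)) (θ : ι → ℝ)
    (hsum : ∀ᵐ x ∂(volume.restrict Ω), s x = ∑ i, θ i * τ i x)
    {Γ : T.faces} {K : T.cells} (hK : K ∈ T.adjacent Γ) :
    ∀ᵐ x ∂(surface Γ.1), trace K.1 s x = ∑ i, θ i * trace K.1 (τ i) x := by
  have h := ae_all_iff.2 fun i => (hτ i).hasTraceAt hK
  filter_upwards [h] with x hx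
  have h1 := HasTraceAt.sum hx (fun i => (hτ i).integrableOn_cell K) θ
  refine (h1.congr_ae ?_).trace_eq
  filter_upwards [ae_cell hsum K] with y hy
  exact hy.symm

/-! ### Linearity of the face terms -/

theorem continuous_jumpAt (o : T.Orientation) (v : T.DGSpace) (Γ : T.faces) :
    Continuous (T.jumpAt o v Γ) := by
  have h : ∀ K : T.cells, Continuous (v K) := fun K => (v K).continuous_of_finiteDimensional
  unfold jumpAt jump
  exact (h _).sub (continuous_finsetSum _ fun K _ => h K)

theorem jumpAt_add (o : T.Orientation) (u v : T.DGSpace) (Γ : T.faces) (x : Space (m + 1)) :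
    T.jumpAt o (u + v) Γ x = T.jumpAt o u Γ x + T.jumpAt o v Γ x := by
  simp only [jumpAt, jump, Pi.add_apply, AffineMap.coe_add, Finset.sum_add_distrib]
  ring

theorem jumpAt_smul (o : T.Orientation) (r : ℝ) (v : T.DGSpace) (Γ : T.faces)
    (x : Space (m + 1)) : T.jumpAt o (r • v) Γ x = r * T.jumpAt o v Γ x := by
  simp only [jumpAt, jump, Pi.smul_apply, AffineMap.coe_smul, smul_eq_mul, ← Finset.mul_sum]
  ring

end Mesh

theorem affGrad_add {d : ℕ} (u v : Space d →ᵃ[ℝ] ℝ) : affGrad (u + v) = affGrad u + affGrad v := by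
  refine ext_inner_right ℝ fun w => ?_
  rw [inner_add_left]
  simp only [inner_affGrad]
  rfl

theorem affGrad_smul {d : ℕ} (r : ℝ) (v : Space d →ᵃ[ℝ] ℝ) : affGrad (r • v) = r • affGrad v := by
  refine ext_inner_right ℝ fun w => ?_
  rw [real_inner_smul_left]
  simp only [inner_affGrad]
  rfl

namespace Mesh

variable {m : ℕ} {Ω : Set (Space (m + 1))} {T : Mesh Ω}

theorem avgFlux_add (o : T.Orientation) (s : Space (m + 1) → ℝ) (u v : T.DGSpace) (Γ : T.faces)
    (x : Space (m + 1)) :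
    T.avgFlux o s (u + v) Γ x = T.avgFlux o s u Γ x + T.avgFlux o s v Γ x := by
  simp only [avgFlux, avg, Pi.add_apply, affGrad_add, inner_add_left, mul_add,
    Finset.sum_add_distrib]

theorem avgFlux_smul (o : T.Orientation) (s : Space (m + 1) → ℝ) (r : ℝ) (v : T.DGSpace)
    (Γ : T.faces) (x : Space (m + 1)) :
    T.avgFlux o s (r • v) Γ x = r * T.avgFlux o s v Γ x := by
  simp only [avgFlux, avg, Pi.smul_apply, affGrad_smul, real_inner_smul_left, Finset.mul_sum]
  exact Finset.sum_congr rfl fun K _ => by ring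

theorem IsCoefficient.integrable_avgFlux_mul {s : Space (m + 1) → ℝ} (hs : T.IsCoefficient s)
    (o : T.Orientation) (v : T.DGSpace) (Γ : T.faces) {g : Space (m + 1) → ℝ}
    (hg : Continuous g) : Integrable (fun x => T.avgFlux o s v Γ x * g x) (surface Γ.1) := by
  have h : ∀ x, T.avgFlux o s v Γ x * g x = ((T.adjacent Γ).card : ℝ)⁻¹ *
      ∑ K ∈ T.adjacent Γ, inner ℝ (affGrad (v K)) (T.normal o Γ) * (trace K.1 s x * g x) := by
    intro x
    simp only [avgFlux, avg, mul_assoc, Finset.sum_mul]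
    congr 1
    exact Finset.sum_congr rfl fun K _ => by ring
  simp only [h]
  exact (integrable_finsetSum _ fun K hK =>
    (hs.integrable_trace_mul hK hg).const_mul _).const_mul _

/-- The exceptional null set comes from the traces alone and so serves all v at once. -/
theorem IsCoefficient.avgFlux_sum {ι : Type*} [Fintype ι] {s : Space (m + 1) → ℝ}
    {τ : ι → Space (m + 1) → ℝ} (hτ : ∀ i, T.IsCoefficient (τ i)) (θ : ι → ℝ)
    (hsum : ∀ᵐ x ∂(volume.restrict Ω), s x = ∑ i, θ i * τ i x) (o : T.Orientation) (Γ : T.faces) :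
    ∀ᵐ x ∂(surface Γ.1), ∀ v, T.avgFlux o s v Γ x = ∑ i, θ i * T.avgFlux o (τ i) v Γ x := by
  have h : ∀ᵐ x ∂(surface Γ.1), ∀ K ∈ T.adjacent Γ,
      trace K.1 s x = ∑ i, θ i * trace K.1 (τ i) x :=
    (Finset.eventually_all _).2 fun K hK => IsCoefficient.trace_sum hτ θ hsum hK
  filter_upwards [h] with x hx v
  simp only [avgFlux, avg]
  rw [Finset.sum_congr rfl fun K hK => by rw [hx K hK]]
  simp only [Finset.sum_mul, Finset.mul_sum]
  rw [Finset.sum_comm]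
  exact Finset.sum_congr rfl fun i _ => Finset.sum_congr rfl fun K _ => by ring

/-- The face term `∫_Γ ⟨(s ∇u) · n⟩ g`. -/
def fluxTerm (o : T.Orientation) (s : Space (m + 1) → ℝ) (Γ : T.faces) (u : T.DGSpace)
    (g : Space (m + 1) → ℝ) : ℝ := ∫ x, T.avgFlux o s u Γ x * g x ∂(surface Γ.1)

theorem IsCoefficient.fluxTerm_add {s : Space (m + 1) → ℝ} (hs : T.IsCoefficient s)
    (o : T.Orientation) (Γ : T.faces) (u v : T.DGSpace) {g : Space (m + 1) → ℝ}
    (hg : Continuous g) :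
    fluxTerm o s Γ (u + v) g = fluxTerm o s Γ u g + fluxTerm o s Γ v g := by
  simp only [fluxTerm, avgFlux_add, add_mul]
  exact integral_add (hs.integrable_avgFlux_mul o u Γ hg) (hs.integrable_avgFlux_mul o v Γ hg)

theorem fluxTerm_smul {s : Space (m + 1) → ℝ} (o : T.Orientation) (Γ : T.faces) (r : ℝ)
    (u : T.DGSpace) (g : Space (m + 1) → ℝ) :
    fluxTerm o s Γ (r • u) g = r * fluxTerm o s Γ u g := by
  simp only [fluxTerm, avgFlux_smul, mul_assoc]
  exact integral_const_mul _ _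

theorem IsCoefficient.fluxTerm_jumpAt_add {s : Space (m + 1) → ℝ} (hs : T.IsCoefficient s)
    (o : T.Orientation) (Γ : T.faces) (w u v : T.DGSpace) :
    fluxTerm o s Γ w (T.jumpAt o (u + v) Γ)
      = fluxTerm o s Γ w (T.jumpAt o u Γ) + fluxTerm o s Γ w (T.jumpAt o v Γ) := by
  simp only [fluxTerm, jumpAt_add, mul_add]
  exact integral_add (hs.integrable_avgFlux_mul o w Γ (continuous_jumpAt o u Γ))
    (hs.integrable_avgFlux_mul o w Γ (continuous_jumpAt o v Γ))

theorem fluxTerm_jumpAt_smul {s : Space (m + 1) → ℝ} (o : T.Orientation) (Γ : T.faces) (r : ℝ)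
    (w u : T.DGSpace) :
    fluxTerm o s Γ w (T.jumpAt o (r • u) Γ) = r * fluxTerm o s Γ w (T.jumpAt o u Γ) := by
  simp only [fluxTerm, jumpAt_smul, mul_left_comm _ r]
  exact integral_const_mul _ _

theorem IsCoefficient.fluxTerm_sum {ι : Type*} [Fintype ι] {s : Space (m + 1) → ℝ}
    {τ : ι → Space (m + 1) → ℝ} (hτ : ∀ i, T.IsCoefficient (τ i)) (θ : ι → ℝ)
    (hsum : ∀ᵐ x ∂(volume.restrict Ω), s x = ∑ i, θ i * τ i x) (o : T.Orientation) (Γ : T.faces)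
    (u : T.DGSpace) {g : Space (m + 1) → ℝ} (hg : Continuous g) :
    fluxTerm o s Γ u g = ∑ i, θ i * fluxTerm o (τ i) Γ u g := by
  simp only [fluxTerm, ← integral_const_mul]
  rw [← integral_finsetSum _ fun i _ => ((hτ i).integrable_avgFlux_mul o u Γ hg).const_mul _]
  refine integral_congr_ae ?_
  filter_upwards [IsCoefficient.avgFlux_sum hτ θ hsum o Γ] with x hx
  rw [hx u, Finset.sum_mul]
  exact Finset.sum_congr rfl fun i _ => by ring

/-- The penalty term `∫_Γ [u] [v]`. -/
def jumpTerm (o : T.Orientation) (Γ : T.faces) (u v : T.DGSpace) : ℝ :=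
  ∫ x, T.jumpAt o u Γ x * T.jumpAt o v Γ x ∂(surface Γ.1)

theorem integrable_jumpAt_mul (o : T.Orientation) (Γ : T.faces) (u v : T.DGSpace) :
    Integrable (fun x => T.jumpAt o u Γ x * T.jumpAt o v Γ x) (surface Γ.1) :=
  integrable_surface Γ ((continuous_jumpAt o u Γ).mul (continuous_jumpAt o v Γ))

theorem jumpTerm_add (o : T.Orientation) (Γ : T.faces) (u u' v : T.DGSpace) :
    jumpTerm o Γ (u + u') v = jumpTerm o Γ u v + jumpTerm o Γ u' v := by
  simp only [jumpTerm, jumpAt_add, add_mul]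
  exact integral_add (integrable_jumpAt_mul o Γ u v) (integrable_jumpAt_mul o Γ u' v)

theorem jumpTerm_smul (o : T.Orientation) (Γ : T.faces) (r : ℝ) (u v : T.DGSpace) :
    jumpTerm o Γ (r • u) v = r * jumpTerm o Γ u v := by
  simp only [jumpTerm, jumpAt_smul, mul_assoc]
  exact integral_const_mul _ _

theorem jumpTerm_comm (o : T.Orientation) (Γ : T.faces) (u v : T.DGSpace) :
    jumpTerm o Γ u v = jumpTerm o Γ v u := by
  simp only [jumpTerm, mul_comm]

/-- The part of the bilinear form that depends on the coefficient. -/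
def diffusionForm (o : T.Orientation) (s : Space (m + 1) → ℝ) (u v : T.DGSpace) : ℝ :=
  (∑ K : T.cells, (∫ x in cell K.1, s x) * inner ℝ (affGrad (u K)) (affGrad (v K)))
  - (∑ Γ : T.faces, fluxTerm o s Γ v (T.jumpAt o u Γ))
  - ∑ Γ : T.faces, fluxTerm o s Γ u (T.jumpAt o v Γ)

/-- Isolates the penalty, which becomes the form a₀. Splitting the face integral requires each
summand to be integrable, which is what boundedness and measurability of the traces provide. -/
theorem IsCoefficient.ipForm_eq {s : Space (m + 1) → ℝ} (hs : T.IsCoefficient s)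
    (o : T.Orientation) (ν : ℝ) (u v : T.DGSpace) :
    T.ipForm o ν s u v
      = (∑ Γ : T.faces, ν / faceDiam Γ.1 * jumpTerm o Γ u v) + diffusionForm o s u v := by
  have h : ∀ Γ : T.faces, ∫ x, (- T.avgFlux o s v Γ x * T.jumpAt o u Γ x
        - T.avgFlux o s u Γ x * T.jumpAt o v Γ x
        + ν / faceDiam Γ.1 * T.jumpAt o u Γ x * T.jumpAt o v Γ x) ∂(surface Γ.1)
      = - fluxTerm o s Γ v (T.jumpAt o u Γ) - fluxTerm o s Γ u (T.jumpAt o v Γ)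
        + ν / faceDiam Γ.1 * jumpTerm o Γ u v := by
    intro Γ
    have i1 : Integrable (fun x => -(T.avgFlux o s v Γ x * T.jumpAt o u Γ x)) (surface Γ.1) :=
      (hs.integrable_avgFlux_mul o v Γ (continuous_jumpAt o u Γ)).neg
    have i2 := hs.integrable_avgFlux_mul o u Γ (continuous_jumpAt o v Γ)
    have i3 := (integrable_jumpAt_mul o Γ u v).const_mul (ν / faceDiam Γ.1)
    have e1 := integral_sub i1 i2
    have e2 := integral_add (i1.sub i2) i3
    simp only [Pi.sub_apply] at e2
    rw [e1, integral_neg, integral_const_mul] at e2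
    rw [fluxTerm, fluxTerm, jumpTerm, ← e2]
    congr 1
    ext x
    ring
  simp only [ipForm, diffusionForm, h, integral_mul_const, Finset.sum_add_distrib,
    Finset.sum_sub_distrib, Finset.sum_neg_distrib]
  ring

theorem IsCoefficient.diffusionForm_sum {ι : Type*} [Fintype ι] {s : Space (m + 1) → ℝ}
    {τ : ι → Space (m + 1) → ℝ} (hτ : ∀ i, T.IsCoefficient (τ i)) (θ : ι → ℝ)
    (hsum : ∀ᵐ x ∂(volume.restrict Ω), s x = ∑ i, θ i * τ i x) (o : T.Orientation)
    (u v : T.DGSpace) : diffusionForm o s u v = ∑ i, θ i * diffusionForm o (τ i) u v := by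
  have h1 : ∀ K : T.cells, ∫ x in cell K.1, s x = ∑ i, θ i * ∫ x in cell K.1, τ i x := by
    intro K
    simp only [← integral_const_mul]
    rw [← integral_finsetSum _ fun i _ => ((hτ i).integrableOn_cell K).const_mul _]
    exact integral_congr_ae (ae_cell hsum K)
  have h2 : ∀ Γ, ∀ u w, fluxTerm o s Γ w (T.jumpAt o u Γ)
      = ∑ i, θ i * fluxTerm o (τ i) Γ w (T.jumpAt o u Γ) := fun Γ u w =>
    IsCoefficient.fluxTerm_sum hτ θ hsum o Γ w (continuous_jumpAt o u Γ)
  simp only [diffusionForm, h1, h2, mul_sub, Finset.sum_sub_distrib, Finset.mul_sum,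
    Finset.sum_mul]
  congr 1
  · congr 1
    · rw [Finset.sum_comm]
      exact Finset.sum_congr rfl fun i _ => Finset.sum_congr rfl fun K _ => by ring
    · rw [Finset.sum_comm]
  · rw [Finset.sum_comm]

/-- Symmetry transfers linearity from the first argument to the second. -/
theorem diffusionForm_comm (o : T.Orientation) (s : Space (m + 1) → ℝ) (u v : T.DGSpace) :
    diffusionForm o s u v = diffusionForm o s v u := by
  simp only [diffusionForm, real_inner_comm]
  ring

theorem IsCoefficient.diffusionForm_add {s : Space (m + 1) → ℝ} (hs : T.IsCoefficient s)
    (o : T.Orientation) (u u' v : T.DGSpace) :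
    diffusionForm o s (u + u') v = diffusionForm o s u v + diffusionForm o s u' v := by
  simp only [diffusionForm, hs.fluxTerm_jumpAt_add, hs.fluxTerm_add o _ u u'
    (continuous_jumpAt o v _), Pi.add_apply, affGrad_add, inner_add_left, mul_add,
    Finset.sum_add_distrib]
  ring

theorem diffusionForm_smul (s : Space (m + 1) → ℝ)
    (o : T.Orientation) (r : ℝ) (u v : T.DGSpace) :
    diffusionForm o s (r • u) v = r * diffusionForm o s u v := by
  simp only [diffusionForm, fluxTerm_jumpAt_smul, fluxTerm_smul, Pi.smul_apply, affGrad_smul,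
    real_inner_smul_left, mul_left_comm _ r, ← Finset.mul_sum]
  ring

/-- The coefficient-dependent part as a bilinear form. -/
def diffusionBilin (o : T.Orientation) {s : Space (m + 1) → ℝ} (hs : T.IsCoefficient s) :
    T.DGSpace →ₗ[ℝ] T.DGSpace →ₗ[ℝ] ℝ :=
  LinearMap.mk₂ ℝ (diffusionForm o s) (hs.diffusionForm_add o)
    (fun r u v => diffusionForm_smul s o r u v)
    (fun u v v' => by
      rw [diffusionForm_comm, hs.diffusionForm_add, diffusionForm_comm o s v,
        diffusionForm_comm o s v'])
    (fun r u v => by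
      rw [diffusionForm_comm, diffusionForm_smul, diffusionForm_comm o s v]
      rfl)

variable (T) in
/-- The penalty part as a bilinear form. -/
def penaltyBilin (o : T.Orientation) (ν : ℝ) : T.DGSpace →ₗ[ℝ] T.DGSpace →ₗ[ℝ] ℝ :=
  LinearMap.mk₂ ℝ (fun u v => ∑ Γ : T.faces, ν / faceDiam Γ.1 * jumpTerm o Γ u v)
    (fun u u' v => by simp only [jumpTerm_add, mul_add, Finset.sum_add_distrib])
    (fun r u v => by
      simp only [jumpTerm_smul, smul_eq_mul, Finset.mul_sum]
      exact Finset.sum_congr rfl fun Γ _ => by ring)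
    (fun u v v' => by
      simp only [jumpTerm_comm o _ u, jumpTerm_add, mul_add, Finset.sum_add_distrib])
    (fun r u v => by
      simp only [jumpTerm_comm o _ u, jumpTerm_smul, smul_eq_mul, Finset.mul_sum]
      exact Finset.sum_congr rfl fun Γ _ => by ring)

end Mesh

/-! ### Orthogonal projections -/

theorem existsUnique_orthogonal {E : Type*} [NormedAddCommGroup E] [InnerProductSpace ℝ E]
    (Q : Submodule ℝ E) [FiniteDimensional ℝ Q] (z : E) :
    ∃! p, p ∈ Q ∧ ∀ q ∈ Q, inner ℝ p q = inner ℝ z q := by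
  refine ⟨Q.starProjection z, ⟨Q.starProjection_apply_mem z, fun q hq => ?_⟩, ?_⟩
  · have h := Q.sub_starProjection_mem_orthogonal z
    have h1 := (Submodule.mem_orthogonal' _ _).1 h q hq
    rw [inner_sub_left, sub_eq_zero] at h1
    exact h1.symm
  · rintro p ⟨hp, hpz⟩
    refine (Submodule.eq_starProjection_of_mem_of_inner_eq_zero hp fun q hq => ?_).symm
    rw [inner_sub_left, hpz q hq, sub_self]

/-- Both sides of the orthogonality relation are linear in q, so testing with the spanning family is
enough. The family may be dependent, since β enters only through the vector it represents. -/
theorem orthogonal_span_iff {E : Type*} [NormedAddCommGroup E] [InnerProductSpace ℝ E]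
    {Q : Submodule ℝ E} {M : ℕ}
    {χ : Fin M → E} (hχ : Submodule.span ℝ (Set.range χ) = Q) (z : E) (β : Fin M → ℝ) :
    (∑ j, β j • χ j ∈ Q ∧ ∀ q ∈ Q, inner ℝ (∑ j, β j • χ j) q = inner ℝ z q)
      ↔ ∀ i, ∑ j, inner ℝ (χ j) (χ i) * β j = inner ℝ z (χ i) := by
  have hsum : ∀ q, inner ℝ (∑ j, β j • χ j) q = ∑ j, inner ℝ (χ j) q * β j := by
    intro q
    rw [sum_inner]
    exact Finset.sum_congr rfl fun j _ => by rw [real_inner_smul_left, mul_comm]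
  constructor
  · rintro ⟨-, h⟩ i
    rw [← hsum]
    exact h _ (hχ ▸ Submodule.subset_span ⟨i, rfl⟩)
  · intro h
    refine ⟨hχ ▸ Submodule.sum_mem _ fun j _ => Submodule.smul_mem _ _
      (Submodule.subset_span ⟨j, rfl⟩), fun q hq => ?_⟩
    rw [← hχ] at hq
    induction hq using Submodule.span_induction with
    | mem q hq =>
      obtain ⟨i, rfl⟩ := hq
      rw [hsum, h i]
    | zero => simp only [inner_zero_right]
    | add p q _ _ hp hq => rw [inner_add_right, inner_add_right, hp, hq]
    | smul r q _ hq => rw [real_inner_smul_right, real_inner_smul_right, hq]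

theorem orthogonal_span_affine_iff {E V : Type*} [NormedAddCommGroup E] [InnerProductSpace ℝ E]
    [AddCommGroup V] [Module ℝ V] {Q : Submodule ℝ E} {M N Ξ : ℕ} {χ : Fin M → E}
    (hχ : Submodule.span ℝ (Set.range χ) = Q) (R₀ : V →ₗ[ℝ] E) (R : Fin Ξ → V →ₗ[ℝ] E)
    (θ : Fin Ξ → ℝ) (t : E) (ψ : Fin N → V) (α : Fin N → ℝ) (β : Fin M → ℝ) :
    (∑ j, β j • χ j ∈ Q ∧ ∀ q ∈ Q, inner ℝ (∑ j, β j • χ j) q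
      = inner ℝ (R₀ (∑ j, α j • ψ j) + ∑ ξ, θ ξ • R ξ (∑ j, α j • ψ j) - t) q)
      ↔ (Matrix.of fun i j => inner ℝ (χ j) (χ i)).mulVec β
        = ((Matrix.of fun i j => inner ℝ (R₀ (ψ j)) (χ i))
          + ∑ ξ, θ ξ • Matrix.of fun i j => inner ℝ (R ξ (ψ j)) (χ i)).mulVec α
          - fun i => inner ℝ t (χ i) := by
  rw [orthogonal_span_iff hχ, funext_iff]
  refine forall_congr' fun i => ?_
  have key : ((Matrix.of fun i j => inner ℝ (R₀ (ψ j)) (χ i))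
      + ∑ ξ, θ ξ • Matrix.of fun i j => inner ℝ (R ξ (ψ j)) (χ i)).mulVec α i
      = inner ℝ (R₀ (∑ j, α j • ψ j) + ∑ ξ, θ ξ • R ξ (∑ j, α j • ψ j)) (χ i) := by
    rw [Matrix.add_mulVec, Matrix.sum_mulVec]
    simp only [map_sum, map_smul, inner_add_left, sum_inner, real_inner_smul_left,
      Matrix.smul_mulVec, Pi.add_apply, Finset.sum_apply, Pi.smul_apply, Matrix.mulVec, dotProduct,
      Matrix.of_apply, smul_eq_mul, mul_comm]
  rw [Pi.sub_apply, key, inner_sub_left]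
  rfl

theorem existsUnique_isProjection {d : ℕ} {Ω : Set (Space d)} (Q : Submodule ℝ (HDiv Ω))
    (hQ : Module.Finite ℝ Q) (z : HDiv Ω) : ∃! p, IsProjection Q z p :=
  existsUnique_orthogonal (E := HDiv Ω) Q z

theorem isProjection_span_affine_iff {d : ℕ} {Ω : Set (Space d)} {V : Type*} [AddCommGroup V]
    [Module ℝ V] {Q : Submodule ℝ (HDiv Ω)} {M N Ξ : ℕ} {χ : Fin M → HDiv Ω}
    (hχ : Submodule.span ℝ (Set.range χ) = Q) (R₀ : V →ₗ[ℝ] HDiv Ω) (R : Fin Ξ → V →ₗ[ℝ] HDiv Ω)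
    (θ : Fin Ξ → ℝ) (t : HDiv Ω) (ψ : Fin N → V) (α : Fin N → ℝ) (β : Fin M → ℝ) {z : HDiv Ω}
    (hz : z = R₀ (∑ j, α j • ψ j) + ∑ ξ, θ ξ • R ξ (∑ j, α j • ψ j)) :
    IsProjection Q (z - t) (∑ j, β j • χ j)
      ↔ (Matrix.of fun i j => inner ℝ (χ j) (χ i)).mulVec β
        = ((Matrix.of fun i j => inner ℝ (R₀ (ψ j)) (χ i))
          + ∑ ξ, θ ξ • Matrix.of fun i j => inner ℝ (R ξ (ψ j)) (χ i)).mulVec α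
          - fun i => inner ℝ t (χ i) := by
  subst hz
  exact orthogonal_span_affine_iff hχ R₀ R θ t ψ α β

theorem map_add_sum_smul {V E ι : Type*} [AddCommGroup V] [Module ℝ V] [AddCommGroup E]
    [Module ℝ E] [Fintype ι] (L : V →ₗ[ℝ] E) (p : V) (θ : ι → ℝ) (q : ι → V) :
    L (p + ∑ i, θ i • q i) = L p + ∑ i, θ i • L (q i) := by
  simp only [map_add, map_sum, map_smul]

namespace Mesh

variable {m : ℕ} {Ω : Set (Space (m + 1))} {T : Mesh Ω}

/-! ### The reduced systems -/

theorem integrableOn_load {f : Space (m + 1) → ℝ} (hf : MemLp f 2 (volume.restrict Ω))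
    (v : T.DGSpace) (K : T.cells) : IntegrableOn (fun x => f x * v K x) (cell K.1) := by
  have h1 : MemLp f 2 (volume.restrict (cell K.1)) :=
    hf.mono_measure (Measure.restrict_mono (T.cell_subset _ K.2) le_rfl)
  exact h1.integrable_mul (q := 2) (memLp_cell _ (v K).continuous_of_finiteDimensional 2)

variable (T) in
/-- The load functional as a linear map. -/
def loadLin {f : Space (m + 1) → ℝ} (hf : MemLp f 2 (volume.restrict Ω)) : T.DGSpace →ₗ[ℝ] ℝ where
  toFun := T.load f
  map_add' u v := by
    simp only [load, Pi.add_apply, AffineMap.coe_add, mul_add, ← Finset.sum_add_distrib]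
    exact Finset.sum_congr rfl fun K _ =>
      integral_add (integrableOn_load hf u K) (integrableOn_load hf v K)
  map_smul' r v := by
    simp only [load, Pi.smul_apply, AffineMap.coe_smul, smul_eq_mul, RingHom.id_apply,
      Finset.mul_sum, ← integral_const_mul]
    exact Finset.sum_congr rfl fun K _ => by congr 1; ext x; ring

/-- The test vectors satisfying the equation form a subspace, the equalizer of two linear
functionals, so it contains V once it contains a spanning family. Linearity is supplied by `B`,
since `ipForm` is only a function. -/
theorem isGalerkinSolution_span_iff (o : T.Orientation) {ν : ℝ} {s f : Space (m + 1) → ℝ}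
    (hf : MemLp f 2 (volume.restrict Ω)) {B : T.DGSpace →ₗ[ℝ] T.DGSpace →ₗ[ℝ] ℝ}
    (hB : ∀ u v, T.ipForm o ν s u v = B u v) {V : Submodule ℝ T.DGSpace} {N : ℕ}
    {ψ : Fin N → T.DGSpace} (hψ : Submodule.span ℝ (Set.range ψ) = V) (α : Fin N → ℝ) :
    T.IsGalerkinSolution o ν s f V (∑ j, α j • ψ j)
      ↔ (Matrix.of fun i j => B (ψ j) (ψ i)).mulVec α = fun i => T.load f (ψ i) := by
  have hsum : ∀ v, B (∑ j, α j • ψ j) v = ∑ j, B (ψ j) v * α j := by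
    intro v
    simp [map_sum, LinearMap.sum_apply, mul_comm]
  rw [funext_iff]
  simp only [Matrix.mulVec, dotProduct, Matrix.of_apply, ← hsum]
  constructor
  · rintro ⟨-, h⟩ i
    rw [← hB]
    exact h _ (hψ ▸ Submodule.subset_span ⟨i, rfl⟩)
  · intro h
    refine ⟨hψ ▸ Submodule.sum_mem _ fun j _ => Submodule.smul_mem _ _
      (Submodule.subset_span ⟨j, rfl⟩), fun v hv => ?_⟩
    have hle : V ≤ LinearMap.eqLocus (B (∑ j, α j • ψ j)) (T.loadLin hf) := by
      rw [← hψ, Submodule.span_le]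
      rintro _ ⟨i, rfl⟩
      exact h i
    rw [hB]
    exact hle hv

/-! ### Conservation in the reduced flux space -/

theorem sub_mem_conservative_zero {f : Space (m + 1) → ℝ} {p q : HDiv Ω}
    (hp : p ∈ T.conservative f) (hq : q ∈ T.conservative f) :
    p - q ∈ T.conservative fun _ => 0 := by
  rw [mem_conservative] at *
  intro K
  rw [map_sub, hp K, hq K, sub_self, integral_zero]

theorem add_mem_conservative {f : Space (m + 1) → ℝ} {p q : HDiv Ω}
    (hp : p ∈ T.conservative fun _ => 0) (hq : q ∈ T.conservative f) :
    p + q ∈ T.conservative f := by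
  rw [mem_conservative] at *
  intro K
  rw [map_add, hp K, hq K, integral_zero, zero_add]

/-- Mean-zero divergence on K defines the kernel of the linear functional `divIntegral`, which
passes to spans. -/
theorem span_subset_conservative_zero {ι : Type*} {χ : ι → HDiv Ω}
    (h : ∀ i, χ i ∈ T.conservative fun _ => 0) :
    (Submodule.span ℝ (Set.range χ) : Set (HDiv Ω)) ⊆ T.conservative fun _ => 0 := by
  intro q hq
  refine mem_conservative.2 fun K => ?_
  have hle : Submodule.span ℝ (Set.range χ) ≤ LinearMap.ker (T.divIntegral K) := by
    rw [Submodule.span_le]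
    rintro _ ⟨i, rfl⟩
    have := mem_conservative.1 (h i) K
    rw [integral_zero] at this
    exact this
  rw [integral_zero]
  exact hle hq

/-! ### Separation of the flux reconstruction -/

/-- The face data of the flux reconstruction that stem from the penalty. -/
def penaltyData (T : Mesh Ω) (o : T.Orientation) (ν : ℝ) : T.DGSpace →ₗ[ℝ] (T.faces → ℝ) :=
  LinearMap.pi fun Γ : T.faces =>
    { toFun := fun v => ((surface Γ.1).real Set.univ)⁻¹ *
        (ν / faceDiam Γ.1 * ∫ x, T.jumpAt o v Γ x ∂(surface Γ.1))
      map_add' := fun u v => by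
        simp only [jumpAt_add]
        rw [integral_add (integrable_surface Γ (continuous_jumpAt o u Γ))
          (integrable_surface Γ (continuous_jumpAt o v Γ))]
        ring
      map_smul' := fun r v => by
        simp only [jumpAt_smul, integral_const_mul, RingHom.id_apply, smul_eq_mul]
        ring }

/-- The face data of the flux reconstruction that depend on the coefficient. -/
def diffusionData (o : T.Orientation) {s : Space (m + 1) → ℝ} (hs : T.IsCoefficient s) :
    T.DGSpace →ₗ[ℝ] (T.faces → ℝ) :=
  LinearMap.pi fun Γ : T.faces =>
    { toFun := fun v => ((surface Γ.1).real Set.univ)⁻¹ * -fluxTerm o s Γ v fun _ => 1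
      map_add' := fun u v => by
        rw [hs.fluxTerm_add o Γ u v continuous_const]
        ring
      map_smul' := fun r v => by
        rw [fluxTerm_smul, RingHom.id_apply, smul_eq_mul]
        ring }

theorem IsCoefficient.faceData_eq {s : Space (m + 1) → ℝ} (hs : T.IsCoefficient s)
    (o : T.Orientation) (ν : ℝ) (v : T.DGSpace) (Γ : T.faces) :
    faceData o ν s v Γ = ν / faceDiam Γ.1 * ∫ x, T.jumpAt o v Γ x ∂(surface Γ.1)
      + -fluxTerm o s Γ v fun _ => 1 := by
  have h1 := (hs.integrable_avgFlux_mul o v Γ (continuous_const (y := (1 : ℝ)))).neg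
  have h2 := (integrable_surface Γ (continuous_jumpAt o v Γ)).const_mul (ν / faceDiam Γ.1)
  rw [fluxTerm, ← integral_const_mul, ← integral_neg, add_comm, faceData]
  refine Eq.trans ?_ (integral_add h1 h2)
  simp

/-- The lifting of face values does not involve the coefficient, so it is enough to separate the
face data, where the coefficient enters linearly through its traces. -/
theorem IsCoefficient.fluxReconstruction_sum {ι : Type*} [Fintype ι] {s : Space (m + 1) → ℝ}
    (hs : T.IsCoefficient s)
    {τ : ι → Space (m + 1) → ℝ} (hτ : ∀ i, T.IsCoefficient (τ i)) (θ : ι → ℝ)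
    (hsum : ∀ᵐ x ∂(volume.restrict Ω), s x = ∑ i, θ i * τ i x) (hΩ : IsOpen Ω)
    (o : T.Orientation) (ν : ℝ) (v : T.DGSpace) :
    T.fluxReconstruction o ν s v
      = (rtLift hΩ o ∘ₗ penaltyData T o ν) v
        + ∑ i, θ i • (rtLift hΩ o ∘ₗ diffusionData o (hτ i)) v := by
  refine ((fluxReconstruction_eq hΩ o ν s v).trans (congrArg (rtLift hΩ o) ?_)).trans
    (map_add_sum_smul (rtLift hΩ o) (penaltyData T o ν v) θ fun i => diffusionData o (hτ i) v)
  ext Γ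
  simp only [penaltyData, diffusionData, Pi.add_apply, Finset.sum_apply, Pi.smul_apply,
    LinearMap.pi_apply, LinearMap.coe_mk, AddHom.coe_mk, smul_eq_mul]
  rw [hs.faceData_eq, IsCoefficient.fluxTerm_sum hτ θ hsum o Γ v continuous_const, mul_add,
    ← Finset.sum_neg_distrib, Finset.mul_sum]
  congr 1
  exact Finset.sum_congr rfl fun i _ => by ring

end Mesh

end IPDG

end

/-! ### Assembly of the theorem -/

open IPDG in
theorem mainTheorem1 {d p : ℕ} (hd : d = 2 ∨ d = 3)
    -- the domain and its grid
    (Ω : Set (Space d)) (hΩ : IsOpen Ω) (T : Mesh Ω) (o : T.Orientation)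
    -- the parametric problem
    (P : Set (EuclideanSpace ℝ (Fin p))) (hP : IsCompact P)
    (σ : EuclideanSpace ℝ (Fin p) → Space d → ℝ)
    (hσ : ∀ μ ∈ P, T.IsCoefficient (σ μ))
    (hσpos : ∀ μ ∈ P, ∃ c > 0, ∀ᵐ x ∂(volume.restrict Ω), c ≤ σ μ x)
    (f : Space d → ℝ) (hf : MemLp f 2 (volume.restrict Ω))
    (ν : ℝ) (hν : 0 < ν)
    -- the IPDG solution for the coefficient `1`, and the snapshots `u_{h, μ_i}`
    (uf : T.DGSpace) (huf : T.IsGalerkinSolution o ν (fun _ => 1) f ⊤ uf)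
    (n : ℕ) (μs : Fin n → EuclideanSpace ℝ (Fin p)) (hμs : ∀ i, μs i ∈ P)
    (us : Fin n → T.DGSpace) (hus : ∀ i, T.IsGalerkinSolution o ν (σ (μs i)) f ⊤ (us i))
    -- the flux `t_f` and the reduced spaces
    (tf : HDiv Ω) (htf : tf = T.sourceFlux o ν uf)
    (Vn : Submodule ℝ T.DGSpace) (hVn : Vn = T.reducedSpace us)
    (Qn : Submodule ℝ (HDiv Ω))
    (hQn : Qn = T.reducedFluxSpace o ν (fun i => σ (μs i)) us tf) :
    -- the flux reconstruction is well defined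
    (∀ v, ∃! q, T.IsFluxReconstruction o ν (fun _ => 1) v q) ∧
    (∀ μ ∈ P, ∀ v, ∃! q, T.IsFluxReconstruction o ν (σ μ) v q) ∧
    -- reconstructions of IPDG solutions are locally conservative
    tf ∈ T.conservative f ∧
    (∀ μ ∈ P, ∀ u, T.IsGalerkinSolution o ν (σ μ) f ⊤ u →
      T.fluxReconstruction o ν (σ μ) u ∈ T.conservative f) ∧
    (Qn : Set (HDiv Ω)) ⊆ T.conservative (fun _ => 0) ∧
    -- the reduced projection is well defined
    (∀ μ ∈ P, ∀ v ∈ Vn,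
      ∃! π, IsProjection Qn (T.fluxReconstruction o ν (σ μ) v - tf) π) ∧
    -- the reduced flux is locally conservative
    (∀ μ ∈ P, ∀ u, T.IsGalerkinSolution o ν (σ μ) f Vn u →
      ∀ π, IsProjection Qn (T.fluxReconstruction o ν (σ μ) u - tf) π →
        π + tf ∈ T.conservative f) ∧
    -- if the bilinear form is separable, so is the reduced system for `u_{n, μ}`
    (∀ (Ξ : ℕ) (θ : Fin Ξ → EuclideanSpace ℝ (Fin p) → ℝ)
      (a : Fin Ξ → T.DGSpace →ₗ[ℝ] T.DGSpace →ₗ[ℝ] ℝ),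
      (∀ μ ∈ P, ∀ u v, T.ipForm o ν (σ μ) u v = ∑ ξ, θ ξ μ * a ξ u v) →
      ∀ (N : ℕ) (ψ : Fin N → T.DGSpace), Submodule.span ℝ (Set.range ψ) = Vn →
      ∀ μ ∈ P, ∀ α : Fin N → ℝ,
        T.IsGalerkinSolution o ν (σ μ) f Vn (∑ j, α j • ψ j) ↔
          (∑ ξ, θ ξ μ • Matrix.of fun i j => a ξ (ψ j) (ψ i)).mulVec α
            = fun i => T.load f (ψ i)) ∧
    -- if the coefficient is separable, so are the bilinear form, the flux reconstruction and
    -- the reduced systems for `u_{n, μ}` and for its reduced projection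
    (∀ (Ξ : ℕ) (θ : Fin Ξ → EuclideanSpace ℝ (Fin p) → ℝ) (τ : Fin Ξ → Space d → ℝ),
      (∀ ξ, T.IsCoefficient (τ ξ)) →
      (∀ μ ∈ P, ∀ᵐ x ∂(volume.restrict Ω), σ μ x = ∑ ξ, θ ξ μ * τ ξ x) →
      ∃ (a₀ : T.DGSpace →ₗ[ℝ] T.DGSpace →ₗ[ℝ] ℝ)
        (a : Fin Ξ → T.DGSpace →ₗ[ℝ] T.DGSpace →ₗ[ℝ] ℝ)
        (R₀ : T.DGSpace →ₗ[ℝ] HDiv Ω) (R' : Fin Ξ → T.DGSpace →ₗ[ℝ] HDiv Ω),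
        (∀ μ ∈ P, ∀ u v, T.ipForm o ν (σ μ) u v = a₀ u v + ∑ ξ, θ ξ μ * a ξ u v) ∧
        (∀ μ ∈ P, ∀ v, T.fluxReconstruction o ν (σ μ) v = R₀ v + ∑ ξ, θ ξ μ • R' ξ v) ∧
        ∀ (N M : ℕ) (ψ : Fin N → T.DGSpace) (χ : Fin M → HDiv Ω),
          Submodule.span ℝ (Set.range ψ) = Vn → Submodule.span ℝ (Set.range χ) = Qn →
          ∀ μ ∈ P, ∀ (α : Fin N → ℝ) (β : Fin M → ℝ),
            (T.IsGalerkinSolution o ν (σ μ) f Vn (∑ j, α j • ψ j) ↔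
              ((Matrix.of fun i j => a₀ (ψ j) (ψ i))
                + ∑ ξ, θ ξ μ • Matrix.of fun i j => a ξ (ψ j) (ψ i)).mulVec α
                = fun i => T.load f (ψ i)) ∧
            (IsProjection Qn (T.fluxReconstruction o ν (σ μ) (∑ j, α j • ψ j) - tf)
                (∑ j, β j • χ j) ↔
              (Matrix.of fun i j => inner ℝ (χ j) (χ i)).mulVec β
                = ((Matrix.of fun i j => inner ℝ (R₀ (ψ j)) (χ i))
                  + ∑ ξ, θ ξ μ • Matrix.of fun i j => inner ℝ (R' ξ (ψ j)) (χ i)).mulVec α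
                  - fun i => inner ℝ tf (χ i))) := by
  -- The preceding results are stated in dimension m + 1, with m the dimension of the faces.
  cases d with
  | zero => omega
  | succ m =>
    have htc : tf ∈ T.conservative f := by
      rw [htf]
      exact Mesh.fluxReconstruction_conservative hΩ o ν huf
    have hQ : (Qn : Set (HDiv Ω)) ⊆ T.conservative fun _ => 0 := by
      rw [hQn]
      exact Mesh.span_subset_conservative_zero fun i => Mesh.sub_mem_conservative_zero
        (Mesh.fluxReconstruction_conservative hΩ o ν (hus i)) htc
    -- Finite dimension makes Q_n complete, so the orthogonal projection onto it exists.
    have hQfin : Module.Finite ℝ Qn := by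
      rw [hQn]
      exact FiniteDimensional.span_of_finite ℝ (Set.finite_range _)
    refine ⟨fun v => Mesh.existsUnique_fluxReconstruction hΩ o ν _ v,
      fun μ _ v => Mesh.existsUnique_fluxReconstruction hΩ o ν _ v, htc,
      fun μ _ u hu => Mesh.fluxReconstruction_conservative hΩ o ν hu, hQ,
      fun μ _ v _ => existsUnique_isProjection Qn hQfin _,
      -- Membership of π in Q_n makes its divergence mean-free on each element; t_f carries the
      -- integrals of f.
      fun μ _ u _ π hπ => Mesh.add_mem_conservative (hQ hπ.1) htc, ?_, ?_⟩
    · intro Ξ θ a ha N ψ hψ μ hμ α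
      rw [Mesh.isGalerkinSolution_span_iff (B := ∑ ξ, θ ξ μ • a ξ) o hf
        (fun u v => by simpa [LinearMap.sum_apply] using ha μ hμ u v) hψ α]
      suffices h : (Matrix.of fun i j => (∑ ξ, θ ξ μ • a ξ) (ψ j) (ψ i))
          = ∑ ξ, θ ξ μ • Matrix.of fun i j => a ξ (ψ j) (ψ i) by rw [h]
      ext i j
      simp [LinearMap.sum_apply, Matrix.sum_apply]
    · intro Ξ θ τ hτ hsum
      have ha : ∀ μ ∈ P, ∀ u v, T.ipForm o ν (σ μ) u v = Mesh.penaltyBilin T o ν u v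
          + ∑ ξ, θ ξ μ * Mesh.diffusionBilin o (hτ ξ) u v := fun μ hμ u v => by
        rw [(hσ μ hμ).ipForm_eq,
          Mesh.IsCoefficient.diffusionForm_sum hτ (fun ξ => θ ξ μ) (hsum μ hμ)]
        rfl
      have hR : ∀ μ ∈ P, ∀ v, T.fluxReconstruction o ν (σ μ) v
          = (Mesh.rtLift hΩ o ∘ₗ Mesh.penaltyData T o ν) v
            + ∑ ξ, θ ξ μ • (Mesh.rtLift hΩ o ∘ₗ Mesh.diffusionData o (hτ ξ)) v := fun μ hμ v =>
        (hσ μ hμ).fluxReconstruction_sum hτ (fun ξ => θ ξ μ) (hsum μ hμ) hΩ o ν v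
      refine ⟨_, _, _, _, ha, hR, fun N M ψ χ hψ hχ μ hμ α β => ⟨?_, ?_⟩⟩
      · rw [Mesh.isGalerkinSolution_span_iff
          (B := Mesh.penaltyBilin T o ν + ∑ ξ, θ ξ μ • Mesh.diffusionBilin o (hτ ξ)) o hf
          (fun u v => by simpa [LinearMap.sum_apply] using ha μ hμ u v) hψ α]
        suffices h : (Matrix.of fun i j =>
            (Mesh.penaltyBilin T o ν + ∑ ξ, θ ξ μ • Mesh.diffusionBilin o (hτ ξ)) (ψ j) (ψ i))
            = (Matrix.of fun i j => Mesh.penaltyBilin T o ν (ψ j) (ψ i))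
              + ∑ ξ, θ ξ μ • Matrix.of fun i j => Mesh.diffusionBilin o (hτ ξ) (ψ j) (ψ i) by
          rw [h]
        ext i j
        simp [LinearMap.sum_apply, Matrix.sum_apply]
      · exact isProjection_span_affine_iff hχ (Mesh.rtLift hΩ o ∘ₗ Mesh.penaltyData T o ν)
          (fun ξ => Mesh.rtLift hΩ o ∘ₗ Mesh.diffusionData o (hτ ξ)) (fun ξ => θ ξ μ) tf ψ α β
          (hR μ hμ _)
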